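/- **Setting.** Let $\mathcal A=\mathbb C[[u]][u_1,u_2,\dots]$, $u_0=u$ (and $u_x=u_1$, $u_{xx}=u_2$), and let $\hat{\mathcal A}^1=\big(\bigoplus_{k\ge0}\mathcal A\,\theta_k\big)[[\varepsilon]]$, where $\theta_0=\theta,\theta_1,\theta_2,\dots$ are formal symbols. Give $u_k$ and $\theta_k$ differential degree $k$, and $\varepsilon$ degree $-1$. Put $\partial_x=\sum_{k\ge0}\big(u_{k+1}\frac{\partial}{\partial u_k}+\theta_{k+1}\frac{\partial}{\partial\theta_k}\big)$ and $D=\sum_{k\ge0}\big(u_k\frac{\partial}{\partial u_k}+\theta_k\frac{\partial}{\partial\theta_k}\big)+\varepsilon\frac{\partial}{\partial\varepsilon}$. A local vector field is a class $\overline X=\int X\,dx$ of some $X\in\hat{\mathcal A}^1$ in $\hat{\mathcal A}^1/\partial_x\hat{\mathcal A}^1$; its evolutionary equation is $\frac{\partial u}{\partial t}=\frac{\delta\overline X}{\delta\theta}$. Here $\frac{\delta}{\delta\theta}=\sum_k(-\partial_x)^k\frac{\partial}{\partial\theta_k}$ and $\frac{\delta}{\delta u}=\sum_k(-\partial_x)^k\frac{\partial}{\partial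 u_k}$. For $G\in\hat{\mathcal A}^1$ put $$[\overline X,G]=\sum_{k\ge0}\partial_x^k\Big(\frac{\delta\overline X}{\delta\theta}\Big)\frac{\partial G}{\partial u_k}-\sum_{k\ge0}\frac{\partial G}{\partial\theta_k}\,\partial_x^k\Big(\frac{\delta\overline X}{\delta u}\Big).$$ A local vector field $\overline X$ of differential degree $1$ is *of DR type* if (a) there are $Y_d\in\hat{\mathcal A}^1$ of differential degree $1$, $d\ge-1$, with $Y_{-1}=-\theta_1$, $\partial_x(D-1)Y_{-1}=0$ and $\partial_x(D-1)Y_{d+1}=[\overline X,Y_d]$ for all $d\ge-1$; (b) $\frac{\delta\overline X}{\delta u}=-u\theta_1+\partial_x^2R$ for some $R\in\hat{\mathcal A}^1$ of differential degree $-1$. It is *of DR type modulo $\varepsilon^{10}$* if it has differential degree $1$ and the equations in (a) and (b) hold for some $Y_d$ and $R$ of the stated degrees, up to terms divisible by $\varepsilon^{10}$. For constants $C_{1,1}\neq0$, $C_{2,1},C_{2,2},C_{3,1},C_{3,2},C_{4,1},C_{4,2}\in\mathbb C$ consider the equation $$\begin{aligned} u_t={}&uu_1+\varepsilon^2C_{1,1}u_3+\varepsilon^4\big(C_{2,1}u_5+C_{2,2}u_2u_3\big)\\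 &+\varepsilon^6\Big[C_{3,1}u_2u_5+C_{3,2}u_3u_2^2+\Big(\tfrac{10C_{2,1}^2}{7C_{1,1}}+\tfrac{9}{35}C_{1,1}C_{2,2}\Big)u_7+\Big(-\tfrac{8C_{2,1}C_{2,2}}{3C_{1,1}}+3C_{3,1}\Big)u_3u_4\Big]\\ &+\varepsilon^8\Big[C_{4,1}u_2^2u_5+C_{4,2}u_2^3u_3+\Big(\tfrac{15C_{2,1}^3}{7C_{1,1}^2}+\tfrac{58}{105}C_{2,1}C_{2,2}+\tfrac4{35}C_{1,1}C_{3,1}\Big)u_9\\ &\quad+\Big(-\tfrac{123C_{2,1}^2C_{2,2}}{28C_{1,1}^2}+\tfrac{57}{100}C_{2,2}^2+\tfrac9{16}C_{1,1}C_{3,2}+\tfrac{33C_{2,1}C_{3,1}}{7C_{1,1}}\Big)u_2u_7\\ &\quad+\Big(-\tfrac{177C_{2,1}^2C_{2,2}}{4C_{1,1}^2}+\tfrac{201}{100}C_{2,2}^2+\tfrac{333}{80}C_{1,1}C_{3,2}+\tfrac{33C_{2,1}C_{3,1}}{C_{1,1}}\Big)u_4u_5\\ &\quad+\Big(\tfrac{44C_{2,1}C_{2,2}^2}{21C_{1,1}^2}-\tfrac{55C_{2,1}C_{3,2}}{12C_{1,1}}-\tfrac{44C_{2,2}C_{3,1}}{21C_{1,1}}+2C_{4,1}\Big)u_3^3\\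 &\quad+\Big(-\tfrac{24C_{2,1}^2C_{2,2}}{C_{1,1}^2}+\tfrac{249}{175}C_{2,2}^2+\tfrac94C_{1,1}C_{3,2}+\tfrac{132C_{2,1}C_{3,1}}{7C_{1,1}}\Big)u_3u_6\\ &\quad+\Big(\tfrac{88C_{2,1}C_{2,2}^2}{21C_{1,1}^2}-\tfrac{55C_{2,1}C_{3,2}}{6C_{1,1}}-\tfrac{88C_{2,2}C_{3,1}}{21C_{1,1}}+6C_{4,1}\Big)u_2u_3u_4\Big]. \end{aligned}\tag{1}$$ **Theorem.** 1. Let $\overline X$ be a local vector field of DR type, with evolutionary equation $u_t=\sum_{s\ge0}\varepsilon^sP_s$, that deforms the dispersionless Burgers equation, i.e. $P_0=uu_1$. For $s\ge1$ let $a_s(u)\in\mathbb C[[u]]$ be the coefficient in $P_s$ of the linear monomial $u_{s+1}$ (the quasilinear part). Suppose that, if $P_s\ne0$ for some $1\le s\le9$, then $a_s\neq0$ for some $1\le s\le9$. Then, modulo $\varepsilon^{10}$, the equation $u_t=\sum_s\varepsilon^sP_s$ is either of the form (1), for some constants with $C_{1,1}\ne0$, or of the form $u_t=uu_x+\varepsilon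 Cu_{xx}$ for some constant $C\in\mathbb C$. 2. Conversely, for all values of the constants with $C_{1,1}\ne0$, the local vector field $\int P\,\theta\,dx$, where $P$ is the right-hand side of (1), is of DR type modulo $\varepsilon^{10}$. 3. For every $C\in\mathbb C$ the local vector field $\int(uu_x+\varepsilon Cu_{xx})\theta\,dx$ is of DR type (at all orders in $\varepsilon$). -/

import Mathlib

namespace DRHierarchy

noncomputable section

/-! ### Differential polynomials in one dependent variable

`DiffPoly` is the ring `ℂ[[u]][u₁, u₂, …]`; the variable `MvPolynomial.X i` is `u_{i+1}`. -/

/-- The ring `ℂ[[u]][u₁, u₂, …]`. -/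
abbrev DiffPoly : Type := MvPolynomial ℕ (PowerSeries ℂ)

instance : CommRing DiffPoly := inferInstance

/-- The jet variable `u_k`, with `u_0 = u`. -/
def u : ℕ → DiffPoly
  | 0 => MvPolynomial.C PowerSeries.X
  | k + 1 => MvPolynomial.X k

/-- Coefficientwise derivative with respect to `u`, as a function. -/
def dCoeffFun (f : DiffPoly) : DiffPoly :=
  ∑ m ∈ f.support, MvPolynomial.monomial m (PowerSeries.derivative ℂ (MvPolynomial.coeff m f))

theorem coeff_dCoeffFun (f : DiffPoly) (m : ℕ →₀ ℕ) :
    MvPolynomial.coeff m (dCoeffFun f) = PowerSeries.derivative ℂ (MvPolynomial.coeff m f) := by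
  rw [dCoeffFun, MvPolynomial.coeff_sum]
  simp only [MvPolynomial.coeff_monomial]
  rw [Finset.sum_ite_eq']
  split_ifs with hm
  · rfl
  · rw [MvPolynomial.notMem_support_iff.mp hm, map_zero]

/-- The derivation `∂/∂u` of `ℂ[[u]][u₁, u₂, …]`, acting on the coefficients in `ℂ[[u]]`. -/
def dCoeff : Derivation ℂ DiffPoly DiffPoly :=
  Derivation.mk'
    { toFun := dCoeffFun
      map_add' := fun f g => by
        ext1 m
        simp only [coeff_dCoeffFun, MvPolynomial.coeff_add, map_add]
      map_smul' := fun c f => by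
        ext1 m
        simp only [coeff_dCoeffFun, MvPolynomial.coeff_smul, RingHom.id_apply]
        exact (PowerSeries.derivative ℂ).map_smul c _ }
    (fun f g => by
      ext1 m
      simp only [LinearMap.coe_mk, AddHom.coe_mk, smul_eq_mul, MvPolynomial.coeff_add,
        coeff_dCoeffFun, MvPolynomial.coeff_mul, map_sum, Derivation.leibniz]
      rw [Finset.sum_add_distrib]
      congr 1
      exact Finset.sum_equiv (Equiv.prodComm _ _)
        (fun x => by simp [add_comm]) (fun x _ => rfl))

/-- `∂/∂u_k`. -/
def partialU : ℕ → Derivation ℂ DiffPoly DiffPoly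
  | 0 => dCoeff
  | k + 1 => (MvPolynomial.pderiv (R := PowerSeries ℂ) k).restrictScalars ℂ

/-- The total `x`-derivative `∂_x = ∑ u_{k+1} ∂/∂u_k` on `ℂ[[u]][u₁, u₂, …]`. -/
def dx : Derivation ℂ DiffPoly DiffPoly :=
  u 1 • partialU 0 +
    (MvPolynomial.mkDerivation (PowerSeries ℂ) (fun i : ℕ => u (i + 2))).restrictScalars ℂ

/-- `∑ u_k ∂/∂u_k`, which counts the variables `u_k`, `k ≥ 0`. -/
def countU : Derivation ℂ DiffPoly DiffPoly :=
  u 0 • partialU 0 +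
    (MvPolynomial.mkDerivation (PowerSeries ℂ) (fun i : ℕ => u (i + 1))).restrictScalars ℂ

theorem dCoeff_C (a : PowerSeries ℂ) :
    dCoeff (MvPolynomial.C a) = MvPolynomial.C (PowerSeries.derivative ℂ a) := by
  ext1 m
  show MvPolynomial.coeff m (dCoeffFun _) = _
  rw [coeff_dCoeffFun, MvPolynomial.coeff_C, MvPolynomial.coeff_C]
  split_ifs <;> simp

theorem dCoeff_X (i : ℕ) : dCoeff (MvPolynomial.X i) = 0 := by
  ext1 m
  show MvPolynomial.coeff m (dCoeffFun _) = _
  rw [coeff_dCoeffFun, MvPolynomial.coeff_X]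
  split_ifs <;> simp

theorem derivation_ext' {D₁ D₂ : Derivation ℂ DiffPoly DiffPoly}
    (hC : ∀ a : PowerSeries ℂ, D₁ (MvPolynomial.C a) = D₂ (MvPolynomial.C a))
    (hX : ∀ i, D₁ (MvPolynomial.X i) = D₂ (MvPolynomial.X i)) : D₁ = D₂ := by
  ext1 f
  induction f using MvPolynomial.induction_on with
  | C a => exact hC a
  | add p q hp hq => rw [map_add, map_add, hp, hq]
  | mul_X p i hp => rw [Derivation.leibniz, Derivation.leibniz, hp, hX]

/-- `∂/∂u_0` commutes with `∂_x`. -/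
theorem partialU_zero_dx (f : DiffPoly) : partialU 0 (dx f) = dx (partialU 0 f) := by
  have h : ⁅partialU 0, dx⁆ = 0 := by
    apply derivation_ext'
    · intro a
      simp [Derivation.commutator_apply, dx, partialU, dCoeff_C, dCoeff_X, u, Derivation.leibniz]
    · intro i
      simp [Derivation.commutator_apply, dx, partialU, dCoeff_X, u]
  have := congrArg (fun D => D f) h
  simpa [Derivation.commutator_apply, sub_eq_zero] using this

/-- `[∂/∂u_{k+1}, ∂_x] = ∂/∂u_k`. -/
theorem partialU_succ_dx (k : ℕ) (f : DiffPoly) :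
    partialU (k + 1) (dx f) = dx (partialU (k + 1) f) + partialU k f := by
  have h : ⁅partialU (k + 1), dx⁆ = partialU k := by
    apply derivation_ext'
    · intro a
      rcases k with _ | k <;>
      simp [Derivation.commutator_apply, dx, partialU, dCoeff_C, u, MvPolynomial.pderiv_X]
    · intro i
      rcases k with _ | k <;>
      simp [Derivation.commutator_apply, dx, partialU, dCoeff_X, u, MvPolynomial.pderiv_X,
        Pi.single_apply, apply_ite]
  have := congrArg (fun D => D f) h
  simp only [Derivation.commutator_apply] at this
  rw [← this]; abel

/-! ### Densities of local vector fields

`Dens` is the module `⊕_k ℂ[[u]][u₁, u₂, …] θ_k` of elements of degree one in the odd variables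
`θ_0, θ_1, …`. -/

/-- Finite sums `∑ f_k θ_k` with `f_k ∈ ℂ[[u]][u₁, u₂, …]`. -/
abbrev Dens : Type := ℕ →₀ DiffPoly

instance : AddCommGroup Dens := inferInstance

/-- `∂/∂u_k` on `Dens`. -/
def partialUDens (k : ℕ) : Dens →ₗ[ℂ] Dens :=
  Finsupp.mapRange.linearMap (partialU k).toLinearMap

/-- Shift of the odd variables: `∑ f_k θ_k ↦ ∑ f_k θ_{k+1}`. -/
def shiftDens : Dens →ₗ[ℂ] Dens :=
  Finsupp.lmapDomain DiffPoly ℂ Nat.succ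

/-- `∂_x` on `Dens`: `∂_x (∑ f_k θ_k) = ∑ (∂_x f_k) θ_k + ∑ f_k θ_{k+1}`. -/
def dxDens : Dens →ₗ[ℂ] Dens :=
  Finsupp.mapRange.linearMap dx.toLinearMap + shiftDens

/-- `δ/δθ = ∑ (-∂_x)^k ∂/∂θ_k` on `Dens`. -/
def varTheta₀ : Dens →ₗ[ℂ] DiffPoly :=
  Finsupp.lsum ℂ (fun k => (-dx.toLinearMap : DiffPoly →ₗ[ℂ] DiffPoly) ^ k)

theorem partialU_eventually (f : DiffPoly) : ∃ N, ∀ k, N ≤ k → partialU k f = 0 := by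
  refine ⟨f.vars.sup id + 2, fun k hk => ?_⟩
  obtain ⟨j, rfl⟩ : ∃ j, k = j + 1 := ⟨k - 1, by omega⟩
  refine MvPolynomial.pderiv_eq_zero_of_notMem_vars (fun hj => ?_)
  have : j ≤ f.vars.sup id := Finset.le_sup (f := id) hj
  omega

theorem partialUDens_eventually (F : Dens) : ∃ N, ∀ k, N ≤ k → partialUDens k F = 0 := by
  choose N hN using fun i => partialU_eventually (F i)
  refine ⟨F.support.sup N, fun k hk => ?_⟩
  ext1 i
  by_cases hi : i ∈ F.support
  · exact hN i k ((Finset.le_sup hi).trans hk)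
  · have : F i = 0 := Finsupp.notMem_support_iff.mp hi
    simp [partialUDens, this]

/-- A sum over all `k ≥ 0` of terms that are linear in `∂F/∂u_k` has finitely many nonzero terms. -/
theorem finite_support_partialUDens {M : Type*} [AddCommGroup M] [Module ℂ M]
    (A : ℕ → Dens →ₗ[ℂ] M) (F : Dens) :
    (Function.support fun k => A k (partialUDens k F)).Finite := by
  obtain ⟨N, hN⟩ := partialUDens_eventually F
  refine (Set.finite_lt_nat N).subset (fun k hk => ?_)
  by_contra h
  exact hk (by simp [hN k (not_lt.mp h)])

/-- `δ/δu = ∑ (-∂_x)^k ∂/∂u_k` on `Dens`; the sum is finite for every element. -/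
def varU₀ : Dens →ₗ[ℂ] Dens where
  toFun F := ∑ᶠ k : ℕ, ((-dxDens) ^ k) (partialUDens k F)
  map_add' F G := by
    simp only [map_add]
    exact finsum_add_distrib (finite_support_partialUDens _ F) (finite_support_partialUDens _ G)
  map_smul' c F := by
    simp only [map_smul, RingHom.id_apply]
    exact (smul_finsum' c (finite_support_partialUDens (fun k => (-dxDens) ^ k) F)).symm

theorem partialUDens_shiftDens (k : ℕ) (F : Dens) :
    partialUDens k (shiftDens F) = shiftDens (partialUDens k F) := by
  simp only [partialUDens, shiftDens, Finsupp.mapRange.linearMap_apply, Finsupp.lmapDomain_apply]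
  exact (Finsupp.mapDomain_mapRange Nat.succ F _ (map_zero _) (map_add _)).symm

theorem partialUDens_zero_dxDens (F : Dens) :
    partialUDens 0 (dxDens F) = dxDens (partialUDens 0 F) := by
  simp only [dxDens, LinearMap.add_apply, map_add, partialUDens_shiftDens]
  congr 1
  ext1 i
  exact partialU_zero_dx (F i)

theorem partialUDens_succ_dxDens (k : ℕ) (F : Dens) :
    partialUDens (k + 1) (dxDens F) = dxDens (partialUDens (k + 1) F) + partialUDens k F := by
  simp only [dxDens, LinearMap.add_apply, map_add, partialUDens_shiftDens]
  rw [add_right_comm]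
  congr 1
  ext1 i
  exact partialU_succ_dx k (F i)

theorem varTheta₀_dxDens (F : Dens) : varTheta₀ (dxDens F) = 0 := by
  induction F using Finsupp.induction_linear with
  | zero => simp
  | add F G hF hG => rw [map_add, map_add, hF, hG, add_zero]
  | single k f =>
    have h1 : dxDens (Finsupp.single k f) =
        Finsupp.single k (dx f) + Finsupp.single (k + 1) f := by
      simp [dxDens, shiftDens, Finsupp.mapDomain_single]
    rw [h1, map_add]
    simp only [varTheta₀, Finsupp.lsum_single, pow_succ, Module.End.mul_apply,
      LinearMap.neg_apply, map_neg]
    exact add_neg_cancel _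

theorem varU₀_dxDens (F : Dens) : varU₀ (dxDens F) = 0 := by
  obtain ⟨N, hN⟩ := partialUDens_eventually F
  have key : ∀ n, ∑ k ∈ Finset.range (n + 1), ((-dxDens) ^ k) (partialUDens k (dxDens F)) =
      -((-dxDens) ^ (n + 1)) (partialUDens n F) := by
    intro n
    induction n with
    | zero => simp [partialUDens_zero_dxDens]
    | succ n ih =>
      rw [Finset.sum_range_succ, ih, partialUDens_succ_dxDens, map_add,
        pow_succ (-dxDens) (n + 1), Module.End.mul_apply, LinearMap.neg_apply, map_neg]
      abel
  show ∑ᶠ k : ℕ, ((-dxDens) ^ k) (partialUDens k (dxDens F)) = 0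
  rw [finsum_eq_sum_of_support_subset (s := Finset.range (N + 1))]
  · rw [key, hN N le_rfl, map_zero, neg_zero]
  · intro k hk
    by_contra h
    have hk' : N < k := by simpa using h
    obtain ⟨j, rfl⟩ : ∃ j, k = j + 1 := ⟨k - 1, by omega⟩
    apply hk
    simp only [partialUDens_succ_dxDens, hN (j + 1) hk'.le, hN j (by omega), map_zero, add_zero]

/-- The part of the bracket of a local vector field with variational derivatives `T = δ/δθ` and
`U = δ/δu` with a density `G = ∑ g_k θ_k`:
`∑ ∂_x^k(T) ∂G/∂u_k - ∑ ∂_x^k(U) ∂G/∂θ_k`. -/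
def bracket₀ (T : DiffPoly) (U G : Dens) : Dens :=
  (∑ᶠ k : ℕ, (dx^[k] T) • partialUDens k G) - G.sum (fun k g => g • (dxDens^[k] U))

/-! ### The dispersion parameter

A formal power series in `ε` with coefficients in `M` is the sequence of its coefficients. -/

/-- `(Â¹)`: formal power series in `ε` with coefficients in `Dens`; `F s` is the coefficient
of `ε^s`. -/
abbrev Density : Type := ℕ → Dens

/-- `∂_x` on densities. -/
def dxDensity : Density →ₗ[ℂ] Density :=
  LinearMap.pi (fun s => dxDens ∘ₗ LinearMap.proj s)

/-- `D - 1` on densities, where `D = ∑ (u_k ∂/∂u_k + θ_k ∂/∂θ_k) + ε ∂/∂ε`. -/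
def dMinusOne (F : Density) : Density := fun s =>
  Finsupp.mapRange.linearMap countU.toLinearMap (F s) + F s + (s : ℂ) • F s - F s

/-- `F` is homogeneous of differential degree `d`, where `u_k` and `θ_k` have degree `k` and `ε`
has degree `-1`. -/
def HasDegree (d : ℤ) (F : Density) : Prop :=
  ∀ (s k : ℕ) (m : ℕ →₀ ℕ), MvPolynomial.coeff m (F s k) ≠ 0 →
    ((Finsupp.weight (fun i : ℕ => i + 1) m : ℕ) : ℤ) + k - s = d

/-- The density `θ_k`. -/
def theta (k : ℕ) : Density := Pi.single 0 (Finsupp.single k 1)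

/-- The density `u θ_1`. -/
def uTheta1 : Density := Pi.single 0 (Finsupp.single 1 (u 0))

/-- Local vector fields: densities modulo total `x`-derivatives. -/
abbrev LocalVectorField : Type := Density ⧸ LinearMap.range dxDensity

/-- `f ↦ ∫ f dx`. -/
def integral : Density →ₗ[ℂ] LocalVectorField := (LinearMap.range dxDensity).mkQ

/-- `δ/δθ` of a local vector field, a formal power series in `ε` of differential polynomials. -/
def varTheta : LocalVectorField →ₗ[ℂ] (ℕ → DiffPoly) :=
  (LinearMap.range dxDensity).liftQ
    (LinearMap.pi (fun s => varTheta₀ ∘ₗ LinearMap.proj s)) (by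
      rintro _ ⟨F, rfl⟩
      ext1 s
      exact varTheta₀_dxDens (F s))

/-- `δ/δu` of a local vector field. -/
def varU : LocalVectorField →ₗ[ℂ] Density :=
  (LinearMap.range dxDensity).liftQ
    (LinearMap.pi (fun s => varU₀ ∘ₗ LinearMap.proj s)) (by
      rintro _ ⟨F, rfl⟩
      ext1 s
      exact varU₀_dxDens (F s))

/-- The bracket `[X̄, G]` of a local vector field with a density of a local vector field. -/
def bracket (X : LocalVectorField) (G : Density) : Density := fun s =>
  ∑ p ∈ Finset.HasAntidiagonal.antidiagonal s, bracket₀ (varTheta X p.1) (varU X p.1) (G p.2)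

/-! ### Hierarchies of double ramification type -/

/-- The operator `𝒟_X̄ Y(z) = ∂_x (D - 1) Y(z) - z [X̄, Y(z)]` on `Â¹[[z]]`; `Y n` is the
coefficient of `z^n` (that is, `Y_{n-1}`). -/
def recursionOperator (X : LocalVectorField) (Y : ℕ → Density) : ℕ → Density
  | 0 => dxDensity (dMinusOne (Y 0))
  | n + 1 => dxDensity (dMinusOne (Y (n + 1))) - bracket X (Y n)

/-- The local vector field `X` is homogeneous of differential degree one and is of double
ramification type modulo `ε^{N+1}`: the two defining conditions hold for the coefficients
of `ε^s`, `s ≤ N`. -/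
structure IsDRTypeUpTo (N : ℕ∞) (X : LocalVectorField) : Prop where
  homogeneous : ∃ f : Density, HasDegree 1 f ∧ integral f = X
  recursion : ∃ Y : ℕ → Density, (∀ n, HasDegree 1 (Y n)) ∧ Y 0 = -theta 1 ∧
    ∀ n s : ℕ, (s : ℕ∞) ≤ N → recursionOperator X Y n s = 0
  unit : ∃ R : Density, HasDegree (-1) R ∧
    ∀ s : ℕ, (s : ℕ∞) ≤ N → varU X s = (-uTheta1 + dxDensity (dxDensity R)) s

/-- The local vector field `X` is of double ramification type (at all orders in `ε`). -/
def IsDRType (X : LocalVectorField) : Prop := IsDRTypeUpTo ⊤ X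

/-- The local vector field `∫ P θ_0 dx`, whose evolutionary equation is `∂u/∂t = P`. -/
def ofEquation (P : ℕ → DiffPoly) : LocalVectorField :=
  integral (fun s => Finsupp.single 0 (P s))

/-- The coefficient `a_s(u)` of the quasilinear term `ε^s a_s(u) u_{s+1}` of `∂u/∂t = P`. -/
def quasilinearCoeff (P : ℕ → DiffPoly) (s : ℕ) : PowerSeries ℂ :=
  MvPolynomial.coeff (Finsupp.single s 1) (P s)

/-- Right-hand side of the Burgers equation `u u_1 + ε C u_2`. -/
def burgers (C : ℂ) : ℕ → DiffPoly
  | 0 => u 0 * u 1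
  | 1 => C • u 2
  | _ => 0

/-- The coefficients of `ε^s`, `s ≤ 9`, of the right-hand side of the seven-parameter family. -/
def dKdV (C11 C21 C22 C31 C32 C41 C42 : ℂ) : ℕ → DiffPoly
  | 0 => u 0 * u 1
  | 2 => C11 • u 3
  | 4 => C21 • u 5 + C22 • (u 2 * u 3)
  | 6 => C31 • (u 2 * u 5) + C32 • (u 3 * u 2 ^ 2)
      + (10 * C21 ^ 2 / (7 * C11) + 9 / 35 * C11 * C22) • u 7
      + (-(8 * C21 * C22) / (3 * C11) + 3 * C31) • (u 3 * u 4)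
  | 8 => C41 • (u 2 ^ 2 * u 5) + C42 • (u 2 ^ 3 * u 3)
      + (15 * C21 ^ 3 / (7 * C11 ^ 2) + 58 / 105 * C21 * C22 + 4 / 35 * C11 * C31) • u 9
      + (-(123 * C21 ^ 2 * C22) / (28 * C11 ^ 2) + 57 / 100 * C22 ^ 2 + 9 / 16 * C11 * C32
          + 33 * C21 * C31 / (7 * C11)) • (u 2 * u 7)
      + (-(177 * C21 ^ 2 * C22) / (4 * C11 ^ 2) + 201 / 100 * C22 ^ 2 + 333 / 80 * C11 * C32
          + 33 * C21 * C31 / C11) • (u 4 * u 5)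
      + (44 * C21 * C22 ^ 2 / (21 * C11 ^ 2) - 55 * C21 * C32 / (12 * C11)
          - 44 * C22 * C31 / (21 * C11) + 2 * C41) • u 3 ^ 3
      + (-(24 * C21 ^ 2 * C22) / C11 ^ 2 + 249 / 175 * C22 ^ 2 + 9 / 4 * C11 * C32
          + 132 * C21 * C31 / (7 * C11)) • (u 3 * u 6)
      + (88 * C21 * C22 ^ 2 / (21 * C11 ^ 2) - 55 * C21 * C32 / (6 * C11)
          - 88 * C22 * C31 / (21 * C11) + 6 * C41) • (u 2 * u 3 * u 4)
  | _ => 0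

end

end DRHierarchy

/-! Write `Y(z) = ∑ Y_{n-1} zⁿ = exp(uz) W(z)`. Conjugation by `exp(uz)` turns the recursion into
`∂_x (D-1) W = z([X̄, W] - u ∂_x W - u_1 D W) + z² (P - u u_1) W` (`recursionOperator_twist`), and
for `P = u u_1` alone its solution is simply `W = -θ_1`. Condition (b) says that `P_s` with `s ≥ 1`
contains neither `u` nor `u_1` (`IsDRType.partialU_eq_zero`). By homogeneity `P_s` is then a
combination, with constant coefficients, of the finitely many monomials of weight `s+1` in `u_2,
u_3, …`, and the undifferentiated `u` disappears from the twisted recursion.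

A density is `∂_x A + o θ_0` for exactly one pair `(A, o)`, while `D-1` is diagonal on monomials and
kills only constants at `ε⁰`. In degree one these are the multiples of `θ_1`, and they are
normalized away by a factor that is a series in `z` (`IsDRType.exists_isTwistedSol`). Hence `W` is
determined step by step, and the next coefficient exists exactly when the obstruction `o` vanishes.
The coefficients of `o` are polynomials in the coefficients of `P`.

Necessity. Give every `u_k` the level `t` and `ε` the level one. If two equations differ only from
some level on, so do their obstructions (`IsTwistedSol.obs_mem_pol`); therefore the low coefficients
of the obstruction of a truncated model of a DR equation vanish. Only the obstruction to `W_4` is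
needed. Let `t ≤ 9` be the least order with a nonzero quasilinear coefficient and rescale `ε` so
that this coefficient is one; the part of lowest level is `u u_1 + ε^t u_{t+1}`. For `t ≥ 3` this
part is already obstructed. For `t = 1` an induction on the level shows that the next unknown
coefficients enter linearly and have to vanish, so nothing is left beyond `ε u_2`. For `t = 2` the
same induction kills the odd orders; the full obstructions through orders eight and ten then fix the
coefficients of orders six and eight up to the free parameters.

Sufficiency. For the family the recursion is run with symbolic parameters: no obstruction occurs,
and `W_n` vanishes through `ε⁹` for two consecutive `n`, after which it stays zero
(`IsApproxSol.isDRTypeUpTo`). For the Burgers equation there is a closed formula, `Y(z) =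
-exp(sinh(Cεz∂_x)/(Cε∂_x) u) · exp(-Cεz∂_x) θ_1`, on which `D-1` acts as `z d/dz`.

The finite calculations are integer arithmetic on lists, with monomials encoded by prime
factorizations, evaluated by `decide +kernel`. `isApproxSol_of_run` shows that the lists compute the
twisted recursion, and `eq_zero_of_solves` that the elimination of parameters is sound. -/

namespace DRHierarchy
open Finset.HasAntidiagonal (antidiagonal)

noncomputable section

/-! ### Evolutionary derivations -/

/-- The derivation `∑ T_k ∂/∂u_k`. -/
def evo (T : ℕ → DiffPoly) : Derivation ℂ DiffPoly DiffPoly :=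
  T 0 • partialU 0 +
    (MvPolynomial.mkDerivation (PowerSeries ℂ) (fun i : ℕ => T (i + 1))).restrictScalars ℂ

theorem dx_eq_evo : dx = evo fun k => u (k + 1) := rfl

theorem countU_eq_evo : countU = evo u := rfl

@[simp] theorem evo_C (T : ℕ → DiffPoly) (a : PowerSeries ℂ) :
    evo T (MvPolynomial.C a) = T 0 * MvPolynomial.C (PowerSeries.derivative ℂ a) := by
  simp [evo, partialU, dCoeff_C]

@[simp] theorem evo_X (T : ℕ → DiffPoly) (i : ℕ) : evo T (MvPolynomial.X i) = T (i + 1) := by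
  simp [evo, partialU, dCoeff_X]

@[simp] theorem evo_u (T : ℕ → DiffPoly) (k : ℕ) : evo T (u k) = T k := by
  rcases k with _ | k
  · simp [u]
  · exact evo_X T k

@[simp] theorem dx_u (k : ℕ) : dx (u k) = u (k + 1) := by rw [dx_eq_evo, evo_u]

@[simp] theorem countU_u (k : ℕ) : countU (u k) = u k := by rw [countU_eq_evo, evo_u]

theorem evo_add (T T' : ℕ → DiffPoly) : evo (T + T') = evo T + evo T' :=
  derivation_ext' (fun a => by simp [add_mul]) (fun i => by simp)

theorem evo_smul (f : DiffPoly) (T : ℕ → DiffPoly) : evo (f • T) = f • evo T :=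
  derivation_ext' (fun a => by simp [mul_assoc]) (fun i => by simp)

/-- A derivation `∑ T_k ∂/∂u_k` commutes with `∂_x` if and only if `T_{k+1} = ∂_x T_k`. -/
theorem evo_dx (T : ℕ → DiffPoly) (hT : ∀ k, T (k + 1) = dx (T k)) (f : DiffPoly) :
    evo T (dx f) = dx (evo T f) := by
  have h : ⁅evo T, dx⁆ = 0 := by
    apply derivation_ext'
    · intro a
      simp [Derivation.commutator_apply, dx_eq_evo, Derivation.leibniz]
      rw [hT]; simp [dx_eq_evo]; ring
    · intro i
      simp [Derivation.commutator_apply, dx_eq_evo]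
      rw [hT (i+1)]; simp [dx_eq_evo]
  have := congrArg (fun D => D f) h
  simpa [Derivation.commutator_apply, sub_eq_zero] using this

theorem derivation_sum_apply {R A : Type*} [CommRing R] [CommRing A] [Algebra R A] {ι : Type*}
    (s : Finset ι) (D : ι → Derivation R A A) (f : A) : (∑ i ∈ s, D i) f = ∑ i ∈ s, D i f := by
  classical
  induction s using Finset.induction_on with
  | empty => simp
  | insert a s ha ih => rw [Finset.sum_insert ha, Finset.sum_insert ha, Derivation.add_apply, ih]

/-- Only finitely many jet variables occur in `f`, and both sides of the second formula are
derivations that agree on these. It passes from derivations given on generators to sums over partial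
derivatives. -/
theorem partialU_bound (f : DiffPoly) : ∃ N, (∀ k, N ≤ k → partialU k f = 0) ∧
    ∀ T, evo T f = ∑ k ∈ Finset.range N, T k * partialU k f := by
  refine ⟨f.vars.sup id + 2, fun k hk => ?_, fun T => ?_⟩
  · obtain ⟨j, rfl⟩ : ∃ j, k = j + 1 := ⟨k - 1, by omega⟩
    refine MvPolynomial.pderiv_eq_zero_of_notMem_vars (fun hj => ?_)
    have : j ≤ f.vars.sup id := Finset.le_sup (f := id) hj
    omega
  · rw [Finset.sum_range_succ', add_comm]
    show T 0 * partialU 0 f + MvPolynomial.mkDerivation (PowerSeries ℂ) _ f = _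
    congr 1
    have h := MvPolynomial.derivation_eqOn_supported (R := PowerSeries ℂ) (A := DiffPoly)
      (D₁ := MvPolynomial.mkDerivation (PowerSeries ℂ) (fun i : ℕ => T (i + 1)))
      (D₂ := ∑ k ∈ Finset.range (f.vars.sup id + 1), T (k + 1) • MvPolynomial.pderiv k)
      (s := {i | i < f.vars.sup id + 1}) (fun i hi => by
        have hi' : i ≤ f.vars.sup id := Nat.lt_succ_iff.mp hi
        rw [Function.comp_apply, Function.comp_apply, MvPolynomial.mkDerivation_X,
          derivation_sum_apply]
        simp [MvPolynomial.pderiv_X, Pi.single_apply]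
        intro hi''; omega)
      (f := f) (by
        rw [MvPolynomial.mem_supported]
        intro i hi
        exact Nat.lt_succ_of_le (Finset.le_sup (f := id) hi))
    rw [h, derivation_sum_apply]
    rfl

/-! ### Operators on densities -/

/-- `∑ T_k ∂/∂u_k` on densities. -/
def evoDens (T : ℕ → DiffPoly) : Dens →ₗ[ℂ] Dens :=
  Finsupp.mapRange.linearMap (evo T).toLinearMap

@[simp] theorem evoDens_apply (T : ℕ → DiffPoly) (G : Dens) (k : ℕ) :
    evoDens T G k = evo T (G k) := rfl

theorem evoDens_smul_apply (T : ℕ → DiffPoly) (f : DiffPoly) (G : Dens) :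
    evoDens T (f • G) = evo T f • G + f • evoDens T G := by
  ext1 k
  simp [Derivation.leibniz, mul_comm, add_comm]

/-- The shift of the odd variables is linear over differential polynomials. -/
theorem shiftDens_smul (f : DiffPoly) (G : Dens) : shiftDens (f • G) = f • shiftDens G := by
  simp [shiftDens, Finsupp.lmapDomain_apply, Finsupp.mapDomain_smul]

theorem shiftDens_single (k : ℕ) (f : DiffPoly) :
    shiftDens (Finsupp.single k f) = Finsupp.single (k + 1) f := by
  simp [shiftDens, Finsupp.mapDomain_single]

theorem shiftDens_apply_succ (G : Dens) (k : ℕ) : shiftDens G (k + 1) = G k :=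
  Finsupp.mapDomain_apply Nat.succ_injective G k

theorem shiftDens_apply_zero (G : Dens) : shiftDens G 0 = 0 :=
  Finsupp.mapDomain_of_notMem_range G 0 (by simp)

theorem dxDens_eq (G : Dens) : dxDens G = evoDens (fun k => u (k + 1)) G + shiftDens G := rfl

theorem dxDens_apply_zero (G : Dens) : dxDens G 0 = dx (G 0) := by
  rw [dxDens_eq, Finsupp.add_apply, shiftDens_apply_zero, add_zero]; rfl

theorem dxDens_apply_succ (G : Dens) (k : ℕ) : dxDens G (k + 1) = dx (G (k + 1)) + G k := by
  rw [dxDens_eq, Finsupp.add_apply, shiftDens_apply_succ]; rfl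

theorem dxDens_smul (f : DiffPoly) (G : Dens) :
    dxDens (f • G) = dx f • G + f • dxDens G := by
  rw [dxDens_eq, dxDens_eq, evoDens_smul_apply, shiftDens_smul, smul_add, add_assoc]; rfl

theorem dxDens_single (k : ℕ) (f : DiffPoly) :
    dxDens (Finsupp.single k f) = Finsupp.single k (dx f) + Finsupp.single (k + 1) f := by
  simp [dxDens, shiftDens, Finsupp.mapDomain_single]

/-- If `∂_x A - o θ_0` vanishes then `A` and `o` vanish. -/
theorem dxDens_injective {A B : Dens} (h : dxDens A = dxDens B) : A = B := by
  rw [← sub_eq_zero, ← map_sub] at h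
  rw [← sub_eq_zero]
  set G := A - B
  -- Descending induction from above the support: the coefficient of `θ_{k+1}` in `∂_x G` is `∂_x
  -- G_{k+1} + G_k`, so `G_{k+1} = 0` forces `G_k = 0`.
  have key : ∀ n k, G.support.sup id + 1 ≤ k + n → G k = 0 := by
    intro n
    induction n with
    | zero =>
      intro k hk
      by_contra hG
      have : k ≤ G.support.sup id := Finset.le_sup (f := id) (Finsupp.mem_support_iff.mpr hG)
      omega
    | succ n ih =>
      intro k hk
      have h1 := dxDens_apply_succ G k
      rw [h, ih (k + 1) (by omega), map_zero, zero_add] at h1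
      exact h1.symm
  ext1 k
  exact key (G.support.sup id + 1) k (by omega)

/-- `∑ T_k ∂/∂u_k - ∑ V_k ∂/∂θ_k` on densities. -/
def act (T : ℕ → DiffPoly) (V : ℕ → Dens) (G : Dens) : Dens :=
  evoDens T G - Finsupp.linearCombination DiffPoly V G

/-- In the form `act` the sequences `T_k`, `V_k` are arbitrary, and the expression is linear in them
over differential polynomials. This allows `u ∂_x` to be subtracted from the flow of `u u_1` later.
-/
theorem bracket₀_eq_act (T : DiffPoly) (U G : Dens) :
    bracket₀ T U G = act (fun k => dx^[k] T) (fun k => dxDens^[k] U) G := by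
  rw [bracket₀, act, Finsupp.linearCombination_apply]
  congr 1
  choose N hN hN' using fun i => partialU_bound (G i)
  have hb : ∀ k, G.support.sup N ≤ k → partialUDens k G = 0 := by
    intro k hk
    ext1 i
    by_cases hi : i ∈ G.support
    · exact hN i k ((Finset.le_sup hi).trans hk)
    · have : G i = 0 := Finsupp.notMem_support_iff.mp hi
      simp [partialUDens, this]
  rw [finsum_eq_sum_of_support_subset (s := Finset.range (G.support.sup N))]
  · ext1 i
    rw [evoDens_apply, hN', Finsupp.finsetSum_apply]
    simp only [Finsupp.smul_apply, smul_eq_mul]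
    by_cases hi : i ∈ G.support
    · refine Finset.sum_subset ?_ ?_ |>.symm
      · exact Finset.range_subset_range.mpr (Finset.le_sup hi)
      · intro k _ hk
        have := hN i k (by simpa using hk)
        simp [partialUDens, this]
    · have : G i = 0 := Finsupp.notMem_support_iff.mp hi
      simp [partialUDens, this]
  · intro k hk
    by_contra h
    exact hk (by simp [hb k (by simpa using h)])

section act
variable (T : ℕ → DiffPoly) (V : ℕ → Dens)

theorem act_add (G H : Dens) : act T V (G + H) = act T V G + act T V H := by
  simp only [act, map_add]; abel

theorem act_sub (G H : Dens) : act T V (G - H) = act T V G - act T V H := by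
  simp only [act, map_sub]; abel

@[simp] theorem act_zero : act T V 0 = 0 := by simp [act]

theorem act_sum {ι : Type*} (s : Finset ι) (G : ι → Dens) :
    act T V (∑ i ∈ s, G i) = ∑ i ∈ s, act T V (G i) := by
  simp only [act, map_sum, Finset.sum_sub_distrib]

theorem act_smul (f : DiffPoly) (G : Dens) :
    act T V (f • G) = evo T f • G + f • act T V G := by
  rw [act, act, evoDens_smul_apply, map_smul, smul_sub]; abel

theorem act_csmul (c : ℂ) (G : Dens) : act T V (c • G) = c • act T V G := by
  have h : c • G = (algebraMap ℂ DiffPoly c) • G := by rw [algebraMap_smul]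
  rw [h, act_smul, Derivation.map_algebraMap, zero_smul, zero_add, algebraMap_smul]

theorem act_neg (G : Dens) : act T V (-G) = -act T V G := by
  rw [← sub_eq_zero, sub_neg_eq_add, ← act_add, neg_add_cancel, act_zero]

theorem act_single (k : ℕ) (f : DiffPoly) :
    act T V (Finsupp.single k f) = Finsupp.single k (evo T f) - f • V k := by
  rw [act, Finsupp.linearCombination_single]
  congr 1
  exact Finsupp.mapRange_single (hf := map_zero (evo T))

theorem act_add_left (T' : ℕ → DiffPoly) (V' : ℕ → Dens) (G : Dens) :
    act (T + T') (V + V') G = act T V G + act T' V' G := by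
  have h1 : evoDens (T + T') G = evoDens T G + evoDens T' G := by
    ext1 k; simp [evo_add]
  have h2 : Finsupp.linearCombination DiffPoly (V + V') G =
      Finsupp.linearCombination DiffPoly V G + Finsupp.linearCombination DiffPoly V' G := by
    simp only [Finsupp.linearCombination_apply, Pi.add_apply, smul_add, Finsupp.sum_add]
  rw [act, act, act, h1, h2]; abel

theorem act_smul_left (f : DiffPoly) (G : Dens) : act (f • T) (f • V) G = f • act T V G := by
  have h1 : evoDens (f • T) G = f • evoDens T G := by
    ext1 k; simp [evo_smul]
  have h2 : Finsupp.linearCombination DiffPoly (f • V) G =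
      f • Finsupp.linearCombination DiffPoly V G := by
    simp only [Finsupp.linearCombination_apply, Pi.smul_apply, Finsupp.smul_sum]
    exact Finsupp.sum_congr fun k _ => smul_comm _ _ _
  rw [act, act, h1, h2, smul_sub]

theorem act_sub_left (T' : ℕ → DiffPoly) (V' : ℕ → Dens) (G : Dens) :
    act (T - T') (V - V') G = act T V G - act T' V' G := by
  rw [eq_sub_iff_add_eq, ← act_add_left, sub_add_cancel, sub_add_cancel]

end act

/-- `∂_x` as an evolutionary action. -/
theorem dxDens_eq_act (G : Dens) :
    dxDens G = act (fun k => u (k + 1)) (fun k => -Finsupp.single (k + 1) 1) G := by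
  induction G using Finsupp.induction_linear with
  | zero => simp
  | add F G hF hG => rw [map_add, act_add, hF, hG]
  | single k f => rw [dxDens_single, act_single, smul_neg, sub_neg_eq_add]; simp; rfl

/-! ### Variational derivatives -/

theorem varU₀_eq_sum {F : Dens} {N : ℕ} (hN : ∀ k, N ≤ k → partialUDens k F = 0) :
    varU₀ F = ∑ k ∈ Finset.range N, ((-dxDens) ^ k) (partialUDens k F) := by
  show ∑ᶠ k : ℕ, ((-dxDens) ^ k) (partialUDens k F) = _
  refine finsum_eq_sum_of_support_subset _ (fun k hk => ?_)
  by_contra h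
  exact hk (by simp [hN k (by simpa using h)])

theorem partialUDens_single (k j : ℕ) (f : DiffPoly) :
    partialUDens k (Finsupp.single j f) = Finsupp.single j (partialU k f) :=
  Finsupp.mapRange_single (hf := map_zero (partialU k))

theorem varU₀_single {f : DiffPoly} {N : ℕ} (hN : ∀ k, N ≤ k → partialU k f = 0) :
    varU₀ (Finsupp.single 0 f) =
      ∑ k ∈ Finset.range N, ((-dxDens) ^ k) (Finsupp.single 0 (partialU k f)) := by
  rw [varU₀_eq_sum (N := N)]
  · simp only [partialUDens_single]
  · intro k hk; rw [partialUDens_single, hN k hk, Finsupp.single_zero]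

theorem partialU_eq_evo (k : ℕ) : partialU k = evo (Pi.single k 1) := by
  rcases k with _ | k
  · exact derivation_ext' (fun a => by simp [partialU, dCoeff_C])
      (fun i => by simp [partialU, dCoeff_X])
  · refine derivation_ext' (fun a => by simp [partialU]) (fun i => ?_)
    simp [partialU, MvPolynomial.pderiv_X, Pi.single_apply]

theorem partialU_u (k j : ℕ) : partialU k (u j) = if j = k then 1 else 0 := by
  rw [partialU_eq_evo, evo_u, Pi.single_apply]

theorem varTheta₀_single_zero (f : DiffPoly) : varTheta₀ (Finsupp.single 0 f) = f := by
  simp [varTheta₀]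

/-- A density is `(δ/δθ) θ_0` up to a total derivative. -/
theorem exists_dxDens_add (F : Dens) : ∃ G, F = dxDens G + Finsupp.single 0 (varTheta₀ F) := by
  induction F using Finsupp.induction_linear with
  | zero => exact ⟨0, by simp⟩
  | add F G hF hG =>
    obtain ⟨F', hF⟩ := hF
    obtain ⟨G', hG⟩ := hG
    refine ⟨F' + G', ?_⟩
    rw [map_add, map_add, Finsupp.single_add]
    nth_rw 1 [hF, hG]
    abel
  | single k f =>
    induction k generalizing f with
    | zero => exact ⟨0, by simp [varTheta₀_single_zero]⟩
    | succ k ih =>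
      obtain ⟨G, hG⟩ := ih (-dx f)
      refine ⟨Finsupp.single k f + G, ?_⟩
      have h : varTheta₀ (Finsupp.single (k + 1) f) = varTheta₀ (Finsupp.single k (-dx f)) := by
        simp only [varTheta₀, Finsupp.lsum_single, pow_succ, Module.End.mul_apply,
          LinearMap.neg_apply, map_neg]
        rfl
      rw [h, map_add, add_assoc, ← hG, dxDens_single, Finsupp.single_neg]
      abel

theorem integral_eq_of_dxDens {F F' : Density} (h : ∀ s, ∃ G, F s = dxDens G + F' s) :
    integral F = integral F' := by
  choose G hG using h
  refine (Submodule.Quotient.eq _).mpr ⟨G, ?_⟩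
  ext1 s
  show dxDens (G s) = F s - F' s
  rw [hG]; abel

theorem varTheta_integral (F : Density) (s : ℕ) : varTheta (integral F) s = varTheta₀ (F s) := rfl

/-- Integration by parts moves all derivatives off the odd variable, so nothing is lost in passing
from a local vector field to its evolutionary equation. -/
theorem ofEquation_varTheta (X : LocalVectorField) : ofEquation (varTheta X) = X := by
  obtain ⟨F, rfl⟩ := Submodule.mkQ_surjective _ X
  exact (integral_eq_of_dxDens fun s => exists_dxDens_add (F s)).symm

theorem varTheta_ofEquation (P : ℕ → DiffPoly) : varTheta (ofEquation P) = P := by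
  ext1 s
  exact varTheta₀_single_zero (P s)

/-- The variational derivative `δ/δu` of `∫ f θ_0 dx`. -/
def euler (f : DiffPoly) : Dens := varU₀ (Finsupp.single 0 f)

theorem varU_ofEquation (P : ℕ → DiffPoly) (s : ℕ) : varU (ofEquation P) s = euler (P s) := rfl

/-- The action `[∫ f θ_0 dx, ·]` on densities. -/
def flow (f : DiffPoly) (G : Dens) : Dens :=
  act (fun k => dx^[k] f) (fun k => dxDens^[k] (euler f)) G

theorem bracket_ofEquation (P : ℕ → DiffPoly) (G : Density) (s : ℕ) :
    bracket (ofEquation P) G s = ∑ p ∈ antidiagonal s, flow (P p.1) (G p.2) := by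
  simp only [bracket, varTheta_ofEquation, varU_ofEquation, bracket₀_eq_act]
  rfl

theorem euler_add (f g : DiffPoly) : euler (f + g) = euler f + euler g := by
  rw [euler, Finsupp.single_add, map_add]; rfl

theorem euler_csmul (c : ℂ) (f : DiffPoly) : euler (c • f) = c • euler f := by
  rw [euler, ← Finsupp.smul_single, map_smul]; rfl

theorem iterate_dx_csmul (k : ℕ) (c : ℂ) (f : DiffPoly) : dx^[k] (c • f) = c • dx^[k] f := by
  induction k with
  | zero => rfl
  | succ k ih => rw [Function.iterate_succ_apply', ih, Derivation.map_smul, Function.iterate_succ_apply']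

theorem iterate_dxDens_csmul (k : ℕ) (c : ℂ) (f : Dens) :
    dxDens^[k] (c • f) = c • dxDens^[k] f := by
  induction k with
  | zero => rfl
  | succ k ih => rw [Function.iterate_succ_apply', ih, map_smul, Function.iterate_succ_apply']

theorem flow_add_left (f g : DiffPoly) (G : Dens) : flow (f + g) G = flow f G + flow g G := by
  rw [flow, flow, flow, ← act_add_left, euler_add]
  congr 1
  · ext1 k; exact iterate_map_add dx k f g
  · ext1 k; exact iterate_map_add dxDens k _ _

theorem flow_csmul_left (c : ℂ) (f : DiffPoly) (G : Dens) : flow (c • f) G = c • flow f G := by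
  have h : c • flow f G = (algebraMap ℂ DiffPoly c) • flow f G := by rw [algebraMap_smul]
  rw [h, flow, flow, ← act_smul_left, euler_csmul]
  congr 1
  · ext1 k
    rw [iterate_dx_csmul, Pi.smul_apply, algebraMap_smul DiffPoly c (dx^[k] f)]
  · ext1 k
    rw [iterate_dxDens_csmul, Pi.smul_apply, algebraMap_smul DiffPoly c (dxDens^[k] (euler f))]

theorem flow_zero_left (G : Dens) : flow 0 G = 0 := by
  have := flow_csmul_left 0 0 G
  simpa using this

theorem flow_sub_left (f g : DiffPoly) (G : Dens) : flow (f - g) G = flow f G - flow g G := by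
  rw [eq_sub_iff_add_eq, ← flow_add_left, sub_add_cancel]

theorem flow_smul (f h : DiffPoly) (G : Dens) :
    flow f (h • G) = evo (fun k => dx^[k] f) h • G + h • flow f G := act_smul _ _ _ _

theorem neg_dxDens_pow_two (F : Dens) : ((-dxDens) ^ 2) F = dxDens (dxDens F) := by
  simp [pow_two]

/-- The variational derivative of `u u_1 θ_0`. -/
theorem euler_u_mul_u_one : euler (u 0 * u 1) = -Finsupp.single 1 (u 0) := by
  rw [euler, varU₀_single (N := 2)]
  · simp [Finset.sum_range_succ, Derivation.leibniz, partialU_u, dxDens_single]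
  · intro k hk
    simp only [Derivation.leibniz, partialU_u]
    rw [if_neg (by omega), if_neg (by omega)]; simp

end
end DRHierarchy

namespace DRHierarchy
open Finset.HasAntidiagonal (antidiagonal)

noncomputable section

/-! ### Removing the undifferentiated variable from the recursion -/

/-- `D - 1` at order `n` in the dispersion parameter. -/
def dm (n : ℕ) : Dens →ₗ[ℂ] Dens := evoDens u + (n : ℂ) • LinearMap.id

theorem dm_apply (n : ℕ) (G : Dens) : dm n G = evoDens u G + (n : ℂ) • G := rfl

theorem dMinusOne_apply (F : Density) (s : ℕ) : dMinusOne F s = dm s (F s) := by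
  show evoDens u (F s) + F s + (s : ℂ) • F s - F s = _
  rw [dm_apply]; abel

theorem dm_smul (n : ℕ) (f : DiffPoly) (G : Dens) :
    dm n (f • G) = countU f • G + f • dm n G := by
  rw [dm_apply, dm_apply, evoDens_smul_apply, smul_add, smul_comm f (n : ℂ) G, countU_eq_evo,
    add_assoc]

theorem dm_succ (n : ℕ) (G : Dens) : dm (n + 1) G = dm n G + G := by
  rw [dm_apply, dm_apply]; push_cast; rw [add_smul, one_smul, add_assoc]

/-- `u^i / i!`. -/
def expU (i : ℕ) : DiffPoly := ((i.factorial : ℂ)⁻¹) • u 0 ^ i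

@[simp] theorem expU_zero : expU 0 = 1 := by simp [expU]

theorem evo_expU_succ (T : ℕ → DiffPoly) (i : ℕ) : evo T (expU (i + 1)) = T 0 * expU i := by
  have h : ((i.factorial : ℂ)) ≠ 0 := by exact_mod_cast i.factorial_ne_zero
  have h' : ((i : ℂ) + 1) ≠ 0 := by exact_mod_cast i.succ_ne_zero
  rw [expU, expU, Derivation.map_smul, Derivation.leibniz_pow, evo_u, Nat.factorial_succ,
    Nat.add_sub_cancel]
  rw [← Nat.cast_smul_eq_nsmul ℂ, smul_smul, smul_eq_mul, mul_smul_comm, mul_comm (T 0)]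
  congr 1
  push_cast
  field_simp

theorem constantCoeff_expU_succ (i : ℕ) :
    PowerSeries.constantCoeff (MvPolynomial.coeff 0 (expU (i + 1))) = 0 := by
  have h : expU (i + 1) = u 0 * (((i + 1).factorial : ℂ)⁻¹ • u 0 ^ i) := by
    rw [expU, pow_succ', mul_smul_comm]
  rw [h, ← MvPolynomial.constantCoeff_eq, map_mul, map_mul]
  simp [u]

theorem isWeightedHomogeneous_expU (i : ℕ) :
    MvPolynomial.IsWeightedHomogeneous (fun i : ℕ => i + 1) (expU i) 0 := by
  have h := (MvPolynomial.isWeightedHomogeneous_C (fun i : ℕ => i + 1)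
    (PowerSeries.X : PowerSeries ℂ)).pow i
  rw [smul_zero] at h
  exact (MvPolynomial.weightedHomogeneousSubmodule (PowerSeries ℂ) _ 0).smul_of_tower_mem _ h

attribute [irreducible] expU

/-- The term of the twisted recursion that involves the density two steps before. -/
def prevTerm (P : ℕ → DiffPoly) (W : ℕ → Density) : ℕ → ℕ → Dens
  | 0, _ => 0
  | n + 1, s => ∑ p ∈ antidiagonal s, P p.1 • W n p.2 - (u 0 * u 1) • W n s

/-- The right-hand side of the twisted recursion. -/
def twistedRhs (P : ℕ → DiffPoly) (W : ℕ → Density) (n s : ℕ) : Dens :=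
  ∑ p ∈ antidiagonal s, flow (P p.1) (W n p.2) - u 0 • dxDens (W n s)
    - u 1 • dm (s + 1) (W n s) + prevTerm P W n s

/-- The twisted recursion operator. -/
def twistedRec (P : ℕ → DiffPoly) (W : ℕ → Density) : ℕ → ℕ → Dens
  | 0, s => dxDens (dm s (W 0 s))
  | n + 1, s => dxDens (dm s (W (n + 1) s)) - twistedRhs P W n s

/-- Multiplication by `exp(u z)`. -/
def twist (W : ℕ → Density) : ℕ → Density := fun n s =>
  ∑ p ∈ antidiagonal n, expU p.1 • W p.2 s

theorem dxDens_dm_expU_one (s : ℕ) (W : Dens) : dxDens (dm s (expU (0 + 1) • W)) =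
    expU (0 + 1) • dxDens (dm s W) + expU 0 • (u 1 • dm (s + 1) W + u 0 • dxDens W) := by
  have h : dx (u 0 * expU 0) = u 1 := by simp
  rw [dm_smul, map_add, countU_eq_evo, dxDens_smul, dxDens_smul, evo_expU_succ, h, dx_eq_evo,
    evo_expU_succ, expU_zero, dm_succ]
  simp only [smul_add, mul_one, one_smul]
  abel

/-- One has `(D-1)(e^{uz} W) = e^{uz}((D-1)W + uz W)`; differentiating gives the three powers of
`z`. The factor `u_1 z` meets `(D-1)W + W`, hence `s + 1` in place of `s`. -/
theorem dxDens_dm_expU_add_two (s i : ℕ) (W : Dens) :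
    dxDens (dm s (expU (i + 1 + 1) • W)) =
    expU (i + 1 + 1) • dxDens (dm s W) + expU (i + 1) • (u 1 • dm (s + 1) W + u 0 • dxDens W)
      + expU i • ((u 0 * u 1) • W) := by
  have h : dx (u 0 * expU (i + 1)) = expU i * (u 0 * u 1) + expU (i + 1) * u 1 := by
    rw [Derivation.leibniz, dx_u, dx_eq_evo, evo_expU_succ, smul_eq_mul, smul_eq_mul]
    ring
  rw [dm_smul, map_add, countU_eq_evo, dxDens_smul, dxDens_smul, evo_expU_succ, h, dx_eq_evo,
    evo_expU_succ, dm_succ, add_smul, mul_smul, mul_smul, mul_comm (u 0) (expU (i + 1)),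
    mul_comm (u (0 + 1)) (expU (i + 1)), mul_smul, mul_smul]
  simp only [smul_add]
  rw [zero_add, mul_smul (expU (i + 1)) (u 1)]
  have key : ∀ {M : Type} [AddCommGroup M] (a b c d e : M),
      a + b + c + (d + e) = e + (d + b + c) + a := by intros; abel
  exact key _ _ _ _ _

/-- Coefficients of `zⁿ` in the conjugated recursion. The bracket differentiates `e^{uz}` along `P`,
which adds `z P W` to the bracket with `W`; together with the `z²` term of `∂_x (D-1)` this leaves
`P - u u_1`, of positive order in `ε` in the cases of interest. -/
theorem recursionOperator_twist (P : ℕ → DiffPoly) (W : ℕ → Density) (n s : ℕ) :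
    recursionOperator (ofEquation P) (twist W) n s =
      ∑ p ∈ antidiagonal n, expU p.1 • twistedRec P W p.2 s := by
  have hdx : ∀ (F : Density), dxDensity (dMinusOne F) s = dxDens (dm s (F s)) := fun F => by
    rw [← dMinusOne_apply]; rfl
  have hflow : ∀ n, bracket (ofEquation P) (twist W n) s =
      ∑ q ∈ antidiagonal n, ∑ p ∈ antidiagonal s,
        flow (P p.1) (expU q.1 • W q.2 p.2) := fun n => by
    rw [bracket_ofEquation, Finset.sum_comm]
    refine Finset.sum_congr rfl fun p _ => ?_
    rw [twist, flow, act_sum]; rfl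
  have hzero : ∀ (f : DiffPoly) G, flow f (expU 0 • G) = expU 0 • flow f G := fun f G => by
    rw [expU_zero, one_smul, one_smul]
  have hsucc : ∀ (f : DiffPoly) i G, flow f (expU (i + 1) • G) =
      expU i • f • G + expU (i + 1) • flow f G := fun f i G => by
    rw [flow_smul, evo_expU_succ, mul_comm, mul_smul]; rfl
  rcases n with _ | n
  · simp [recursionOperator, hdx, twist, twistedRec]
  · show dxDensity (dMinusOne (twist W (n + 1))) s - bracket (ofEquation P) (twist W n) s = _
    rw [hdx, hflow, twist, map_sum, map_sum]
    rcases n with _ | n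
    · simp only [Finset.Nat.sum_antidiagonal_succ, Finset.Nat.antidiagonal_zero,
        Finset.sum_singleton, dxDens_dm_expU_one, twistedRec, twistedRhs, prevTerm]
      simp only [expU_zero, one_smul, zero_add]
      generalize dxDens (dm s (W 1 s)) = A
      generalize expU 1 • dxDens (dm s (W 0 s)) = B
      generalize u 1 • dm (s + 1) (W 0 s) = C
      generalize u 0 • dxDens (W 0 s) = D
      generalize ∑ p ∈ antidiagonal s, flow (P p.1) (W 0 p.2) = E
      abel
    · have e1 : ∑ p ∈ antidiagonal (n + 1 + 1), dxDens (dm s (expU p.1 • W p.2 s)) =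
          ∑ p ∈ antidiagonal (n + 1 + 1), expU p.1 • dxDens (dm s (W p.2 s))
          + ∑ p ∈ antidiagonal (n + 1), expU p.1 •
            (u 1 • dm (s + 1) (W p.2 s) + u 0 • dxDens (W p.2 s))
          + ∑ p ∈ antidiagonal n, expU p.1 • ((u 0 * u 1) • W p.2 s) := by
        simp only [Finset.Nat.sum_antidiagonal_succ, zero_add, dxDens_dm_expU_one,
          dxDens_dm_expU_add_two, Finset.sum_add_distrib, expU_zero, one_smul]
        generalize ∑ x ∈ antidiagonal n, expU (x.1 + 1 + 1) • dxDens (dm s (W x.2 s)) = A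
        generalize ∑ x ∈ antidiagonal n, expU x.1 • (u 0 * u 1) • W x.2 s = B
        generalize ∑ x ∈ antidiagonal n, expU (x.1 + 1) •
          (u 1 • dm (s + 1) (W x.2 s) + u 0 • dxDens (W x.2 s)) = C
        generalize expU 1 • dxDens (dm s (W (n + 1) s)) = D
        generalize u 1 • dm (s + 1) (W (n + 1) s) + u 0 • dxDens (W (n + 1) s) = E
        abel
      have e2 : ∑ q ∈ antidiagonal (n + 1), ∑ p ∈ antidiagonal s,
            flow (P p.1) (expU q.1 • W q.2 p.2) =
          ∑ q ∈ antidiagonal (n + 1), expU q.1 • ∑ p ∈ antidiagonal s, flow (P p.1) (W q.2 p.2)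
          + ∑ q ∈ antidiagonal n, expU q.1 • ∑ p ∈ antidiagonal s, P p.1 • W q.2 p.2 := by
        simp only [Finset.Nat.sum_antidiagonal_succ, hzero, hsucc, Finset.sum_add_distrib,
          Finset.smul_sum]
        exact add_left_comm _ _ _ |>.trans (add_comm _ _)
      have e3 : ∑ p ∈ antidiagonal (n + 1 + 1), expU p.1 • twistedRec P W p.2 s =
          ∑ p ∈ antidiagonal (n + 1 + 1), expU p.1 • dxDens (dm s (W p.2 s))
          - ∑ p ∈ antidiagonal (n + 1), expU p.1 • twistedRhs P W p.2 s := by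
        rw [Finset.Nat.sum_antidiagonal_succ' (n := n + 1),
          Finset.Nat.sum_antidiagonal_succ' (n := n + 1)]
        simp only [twistedRec, smul_sub, Finset.sum_sub_distrib]
        exact (add_sub_assoc _ _ _).symm
      have e4 : ∑ p ∈ antidiagonal (n + 1), expU p.1 • prevTerm P W p.2 s =
          ∑ p ∈ antidiagonal n, expU p.1 • (∑ q ∈ antidiagonal s, P q.1 • W p.2 q.2)
          - ∑ p ∈ antidiagonal n, expU p.1 • ((u 0 * u 1) • W p.2 s) := by
        rw [Finset.Nat.sum_antidiagonal_succ']
        simp only [prevTerm, smul_sub, smul_zero, zero_add, Finset.sum_sub_distrib]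
      have e5 : ∑ p ∈ antidiagonal (n + 1), expU p.1 • twistedRhs P W p.2 s =
          ∑ p ∈ antidiagonal (n + 1), expU p.1 • (∑ q ∈ antidiagonal s, flow (P q.1) (W p.2 q.2))
          - ∑ p ∈ antidiagonal (n + 1), expU p.1 •
            (u 1 • dm (s + 1) (W p.2 s) + u 0 • dxDens (W p.2 s))
          + ∑ p ∈ antidiagonal (n + 1), expU p.1 • prevTerm P W p.2 s := by
        rw [← Finset.sum_sub_distrib, ← Finset.sum_add_distrib]
        refine Finset.sum_congr rfl fun p _ => ?_
        rw [twistedRhs, ← smul_sub, ← smul_add]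
        congr 1
        rw [← sub_sub, sub_right_comm]
      rw [e1, e2, e3, e5, e4]
      generalize ∑ p ∈ antidiagonal (n + 1 + 1), expU p.1 • dxDens (dm s (W p.2 s)) = A
      generalize ∑ p ∈ antidiagonal n, expU p.1 • (u 0 * u 1) • W p.2 s = B
      generalize ∑ x ∈ antidiagonal (n + 1), expU x.1 •
        (u 1 • dm (s + 1) (W x.2 s) + u 0 • dxDens (W x.2 s)) = C
      generalize ∑ p ∈ antidiagonal (n + 1), expU p.1 •
        ∑ q ∈ antidiagonal s, flow (P q.1) (W p.2 q.2) = D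
      generalize ∑ p ∈ antidiagonal n, expU p.1 •
        ∑ q ∈ antidiagonal s, P q.1 • W p.2 q.2 = E
      abel

theorem exists_twist_eq (Y : ℕ → Density) : ∃ W, twist W = Y := by
  let W : ℕ → Density := fun n => Nat.strongRec (motive := fun _ => Density)
    (fun n ih => Y n - ∑ i : Fin n, expU (n - i) • ih i i.2) n
  have hW : ∀ n, W n = Y n - ∑ i : Fin n, expU (n - i) • W i := fun n => Nat.strongRec_eq _ n
  refine ⟨W, funext fun n => funext fun s => ?_⟩
  have h := congrFun (hW n) s
  rw [Pi.sub_apply, Finset.sum_apply, eq_sub_iff_add_eq] at h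
  rw [← h, twist, Finset.Nat.sum_antidiagonal_eq_sum_range_succ (fun i j => expU i • W j s),
    ← Finset.sum_range_reflect, Finset.sum_range_succ, add_comm]
  congr 1
  · simp
  · rw [Finset.sum_range]
    refine Finset.sum_congr rfl fun i _ => ?_
    have h1 : n + 1 - 1 - (i : ℕ) = n - i := by omega
    have h2 : n - (n - (i : ℕ)) = i := by omega
    rw [h1, h2]; rfl

/-- Multiplication by `exp(uz)` is triangular with ones on the diagonal. -/
theorem twistedRec_eq_zero {P : ℕ → DiffPoly} {W : ℕ → Density} {s : ℕ}
    (h : ∀ n, recursionOperator (ofEquation P) (twist W) n s = 0) (n : ℕ) :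
    twistedRec P W n s = 0 := by
  induction n using Nat.strong_induction_on with
  | _ n ih =>
    have h1 := h n
    rw [recursionOperator_twist] at h1
    rcases n with _ | n
    · simpa using h1
    · rw [Finset.Nat.sum_antidiagonal_succ, Finset.sum_eq_zero, add_zero, expU_zero,
        one_smul] at h1
      · exact h1
      · intro p hp
        have := Finset.HasAntidiagonal.mem_antidiagonal.mp hp
        rw [ih p.2 (by omega), smul_zero]

/-! ### Normalization of the recursion -/

/-- Multiplication by a power series in `z` with constant coefficients. -/
def scale (d : ℕ → ℂ) (Y : ℕ → Density) : ℕ → Density := fun n s =>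
  ∑ p ∈ antidiagonal n, d p.1 • Y p.2 s

/-- The recursion is linear over `ℂ[[z]]`. This freedom is spent on normalizing the coefficient of
`θ_1`. -/
theorem recursionOperator_scale (P : ℕ → DiffPoly) (d : ℕ → ℂ) (Y : ℕ → Density) (n s : ℕ) :
    recursionOperator (ofEquation P) (scale d Y) n s =
      ∑ p ∈ antidiagonal n, d p.1 • recursionOperator (ofEquation P) Y p.2 s := by
  have hdx : ∀ (F : Density), dxDensity (dMinusOne F) s = dxDens (dm s (F s)) := fun F => by
    rw [← dMinusOne_apply]; rfl
  rcases n with _ | n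
  · simp [recursionOperator, hdx, scale]
  · have h1 : ∀ (Y : ℕ → Density) n, recursionOperator (ofEquation P) Y (n + 1) s =
        dxDens (dm s (Y (n + 1) s)) - ∑ p ∈ antidiagonal s, flow (P p.1) (Y n p.2) :=
      fun Y n => by rw [← hdx, ← bracket_ofEquation]; rfl
    have h0 : recursionOperator (ofEquation P) Y 0 s = dxDens (dm s (Y 0 s)) := hdx _
    rw [Finset.Nat.sum_antidiagonal_succ', h0, h1 (scale d Y)]
    simp only [h1 Y, smul_sub, Finset.sum_sub_distrib]
    have h2 : scale d Y (n + 1) s = ∑ p ∈ antidiagonal (n + 1), d p.1 • Y p.2 s := rfl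
    rw [h2, map_sum, map_sum, Finset.Nat.sum_antidiagonal_succ', add_sub_assoc]
    simp only [map_smul]
    congr 2
    simp only [Finset.smul_sum]
    rw [Finset.sum_comm]
    refine Finset.sum_congr rfl fun p _ => ?_
    rw [scale, flow, act_sum]
    exact Finset.sum_congr rfl fun q _ => act_csmul _ _ _ _

/-- The coefficient of `θ_k` at `u = u_1 = u_2 = ⋯ = 0`. -/
def constTheta (k : ℕ) : Dens →ₗ[ℂ] ℂ where
  toFun G := PowerSeries.constantCoeff (MvPolynomial.coeff 0 (G k))
  map_add' F G := by simp
  map_smul' c F := by simp [MvPolynomial.coeff_smul]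

theorem constTheta_smul (k : ℕ) (f : DiffPoly) (G : Dens) : constTheta k (f • G) =
    PowerSeries.constantCoeff (MvPolynomial.coeff 0 f) * constTheta k G := by
  simp only [constTheta, LinearMap.coe_mk, AddHom.coe_mk, Finsupp.smul_apply, smul_eq_mul]
  rw [← MvPolynomial.constantCoeff_eq, map_mul, map_mul]

theorem constTheta_twist (k n s : ℕ) (W : ℕ → Density) :
    constTheta k (twist W n s) = constTheta k (W n s) := by
  rw [twist, map_sum]
  rcases n with _ | n
  · simp
  · rw [Finset.Nat.sum_antidiagonal_succ, Finset.sum_eq_zero]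
    · simp
    · intro p _
      rw [constTheta_smul, constantCoeff_expU_succ, zero_mul]

theorem constTheta_eq_zero {Y : Density} (h : HasDegree 1 Y) {k : ℕ} (hk : k ≠ 1) :
    constTheta k (Y 0) = 0 := by
  by_contra h0
  have h1 : MvPolynomial.coeff 0 (Y 0 k) ≠ 0 := fun h2 => h0 (by simp [constTheta, h2])
  have := h 0 k 0 h1
  simp at this
  exact hk this

/-- The solutions of the twisted recursion up to order `N`. -/
structure IsTwistedSol (P : ℕ → DiffPoly) (W : ℕ → Density) : Prop where
  zero : W 0 = -theta 1
  rec_eq : ∀ n s, dxDens (dm s (W (n + 1) s)) = twistedRhs P W n s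
  const : ∀ n k, constTheta k (W (n + 1) 0) = 0

/-- In degree one the kernel of `∂_x (D-1)` consists of the multiples of `θ_1` at `ε⁰`. Dividing
`Y(z)` by the series `c(z)` of its negated constant `θ_1` coefficients removes this ambiguity; `c(0)
= 1` because `Y_{-1} = -θ_1`. Constant coefficients of the other `θ_k` at `ε⁰` are excluded by
homogeneity. -/
theorem IsDRType.exists_isTwistedSol {X : LocalVectorField} (hX : IsDRType X) :
    ∃ W, IsTwistedSol (varTheta X) W := by
  obtain ⟨Y, hdeg, hY0, hrec⟩ := hX.recursion
  set P := varTheta X with hP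
  rw [← ofEquation_varTheta X, ← hP] at hrec
  have hrec' : ∀ n s, recursionOperator (ofEquation P) Y n s = 0 := fun n s => hrec n s le_top
  let c : PowerSeries ℂ := PowerSeries.mk fun n => -constTheta 1 (Y n 0)
  have hc0 : PowerSeries.constantCoeff c = 1 := by
    simp [c, hY0, theta, constTheta]
  have hc : c * c⁻¹ = 1 := PowerSeries.mul_inv_cancel c (by rw [hc0]; exact one_ne_zero)
  let d : ℕ → ℂ := fun n => PowerSeries.coeff n c⁻¹
  have hd0 : d 0 = 1 := by
    simp [d, hc0]
  obtain ⟨W, hW⟩ := exists_twist_eq (scale d Y)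
  have hsol : ∀ n s, twistedRec P W n s = 0 := fun n s => twistedRec_eq_zero (fun n => by
    rw [hW, recursionOperator_scale]
    exact Finset.sum_eq_zero fun p _ => by rw [hrec', smul_zero]) n
  refine ⟨W, ?_, ?_, ?_⟩
  · have h := congrFun hW 0
    ext1 s
    have h := congrFun h s
    simp only [twist, scale, Finset.Nat.antidiagonal_zero, Finset.sum_singleton, expU_zero,
      one_smul, hd0, hY0] at h
    exact h
  · intro n s
    exact sub_eq_zero.mp (hsol (n + 1) s)
  · intro n k
    rw [← constTheta_twist k (n + 1) 0 W, hW, scale, map_sum]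
    simp only [map_smul, smul_eq_mul]
    by_cases hk : k = 1
    · subst hk
      have h := congrArg (PowerSeries.coeff (n + 1)) hc
      rw [mul_comm, PowerSeries.coeff_mul, PowerSeries.coeff_one, if_neg n.succ_ne_zero] at h
      rw [← neg_eq_zero, ← Finset.sum_neg_distrib, ← h]
      refine Finset.sum_congr rfl fun p _ => ?_
      simp [d, c]
    · refine Finset.sum_eq_zero fun p _ => ?_
      rw [constTheta_eq_zero (hdeg _) hk, mul_zero]

end
end DRHierarchy

namespace DRHierarchy
open Finset.HasAntidiagonal (antidiagonal)

noncomputable section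

/-! ### Gradings and filtrations -/

/-- The grading in which `u_k` has level `t + δ k` and `θ_k` has level `δ k` (if `exact`), or the
decreasing filtration by this level. -/
structure Grading where
  t : ℤ
  δ : ℤ
  exact : Prop

namespace Grading
variable (g : Grading)

/-- The level of the monomial with exponents `m` and `i` in `u_1, u_2, …` and `u`. -/
def level (m : ℕ →₀ ℕ) (i : ℕ) : ℤ :=
  g.t * (m.degree + i) + g.δ * (Finsupp.weight (fun i : ℕ => i + 1) m : ℕ)

theorem level_add (m m' : ℕ →₀ ℕ) (i i' : ℕ) :
    g.level (m + m') (i + i') = g.level m i + g.level m' i' := by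
  simp only [level, map_add]; push_cast; ring

theorem level_single (k : ℕ) : g.level (Finsupp.single k 1) 0 = g.t + g.δ * (k + 1) := by
  simp [level, Finsupp.weight_single]

theorem level_zero (i : ℕ) : g.level 0 i = g.t * i := by simp [level]

/-- `z` is the difference of an allowed level and the lower bound. -/
def ok (z : ℤ) : Prop := 0 ≤ z ∧ (g.exact → z = 0)

variable {g} in
theorem ok.add {y z : ℤ} (hy : g.ok y) (hz : g.ok z) : g.ok (y + z) :=
  ⟨by have := hy.1; have := hz.1; omega, fun h => by rw [hy.2 h, hz.2 h, add_zero]⟩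

theorem ok_zero : g.ok 0 := ⟨le_rfl, fun _ => rfl⟩

/-- The differential polynomials of level `c`. -/
def pol (c : ℤ) : Submodule ℂ DiffPoly where
  carrier := {f | ∀ m i, PowerSeries.coeff i (MvPolynomial.coeff m f) ≠ 0 → g.ok (g.level m i - c)}
  add_mem' {f f'} hf hf' m i h := by
    by_contra h0
    have h1 := not_imp_comm.mp (hf m i) h0
    have h2 := not_imp_comm.mp (hf' m i) h0
    simp [h1, h2] at h
  zero_mem' m i h := by simp at h
  smul_mem' a f hf m i h := hf m i (fun h0 => h (by simp [MvPolynomial.coeff_smul, h0]))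

variable {g} in
theorem pol_mono {c c' : ℤ} (h : g.ok (c - c')) : g.pol c ≤ g.pol c' := fun f hf m i h0 => by
  have := (hf m i h0).add h
  rwa [sub_add_sub_cancel] at this

variable {g} in
theorem mul_mem_pol {c c' d : ℤ} {f f' : DiffPoly} (hf : f ∈ g.pol c) (hf' : f' ∈ g.pol c')
    (h : g.ok (c + c' - d)) : f * f' ∈ g.pol d := by
  intro m i h0
  rw [MvPolynomial.coeff_mul, map_sum] at h0
  obtain ⟨p, hp, h0⟩ := Finset.exists_ne_zero_of_sum_ne_zero h0
  rw [PowerSeries.coeff_mul] at h0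
  obtain ⟨q, hq, h0⟩ := Finset.exists_ne_zero_of_sum_ne_zero h0
  have h1 := hf p.1 q.1 (left_ne_zero_of_mul h0)
  have h2 := hf' p.2 q.2 (right_ne_zero_of_mul h0)
  have h3 := (h1.add h2).add h
  rw [← Finset.HasAntidiagonal.mem_antidiagonal.mp hp,
    ← Finset.HasAntidiagonal.mem_antidiagonal.mp hq, level_add]
  convert h3 using 1
  ring

theorem u_mem_pol (k : ℕ) : u k ∈ g.pol (g.t + g.δ * k) := by
  intro m i h0
  rcases k with _ | k
  · simp only [u] at h0
    rw [MvPolynomial.coeff_C] at h0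
    split_ifs at h0 with hm
    · rw [PowerSeries.coeff_X] at h0
      have hi : i = 1 := by by_contra hi; simp [hi] at h0
      rw [← hm, hi, level_zero]
      simpa using g.ok_zero
    · simp at h0
  · simp only [u] at h0
    rw [MvPolynomial.coeff_X] at h0
    split_ifs at h0 with hm
    · rw [PowerSeries.coeff_one] at h0
      have hi : i = 0 := by by_contra hi; simp [hi] at h0
      rw [← hm, hi, level_single]
      push_cast
      rw [sub_self]
      exact g.ok_zero
    · simp at h0

theorem partialU_mem_pol {c d : ℤ} {f : DiffPoly} (hf : f ∈ g.pol c) (k : ℕ)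
    (h : g.ok (c - (g.t + g.δ * k) - d)) : partialU k f ∈ g.pol d := by
  intro m i h0
  rcases k with _ | k
  · change PowerSeries.coeff i (MvPolynomial.coeff m (dCoeffFun f)) ≠ 0 at h0
    rw [coeff_dCoeffFun, PowerSeries.coeff_derivative] at h0
    have h1 := (hf m (i + 1) (left_ne_zero_of_mul h0)).add h
    have h2 := g.level_add m 0 i 1
    rw [add_zero, level_zero] at h2
    rw [h2] at h1
    convert h1 using 1
    push_cast
    ring
  · change PowerSeries.coeff i (MvPolynomial.coeff m (MvPolynomial.pderiv k f)) ≠ 0 at h0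
    rw [MvPolynomial.coeff_pderiv] at h0
    have h3 : PowerSeries.coeff i (MvPolynomial.coeff (m + Finsupp.single k 1) f) ≠ 0 := by
      intro h4
      apply h0
      have : (m k + 1 : PowerSeries ℂ) = PowerSeries.C ((m k : ℂ) + 1) := by simp
      rw [this, PowerSeries.coeff_mul_C, h4, zero_mul]
    have h1 := (hf _ i h3).add h
    have h2 := g.level_add m (Finsupp.single k 1) i 0
    rw [add_zero, level_single] at h2
    rw [h2] at h1
    convert h1 using 1
    push_cast
    ring

variable {g} in
theorem evo_mem_pol {T : ℕ → DiffPoly} {b c d : ℤ} (hT : ∀ k : ℕ, T k ∈ g.pol (g.t + g.δ * k + b))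
    {f : DiffPoly} (hf : f ∈ g.pol c) (h : g.ok (b + c - d)) : evo T f ∈ g.pol d := by
  obtain ⟨N, -, hN⟩ := partialU_bound f
  rw [hN]
  refine Submodule.sum_mem _ fun k _ => mul_mem_pol (hT k)
    (g.partialU_mem_pol hf k (d := c - (g.t + g.δ * k)) (by simpa using g.ok_zero)) ?_
  convert h using 1
  ring

variable {g} in
theorem dx_mem_pol {c d : ℤ} {f : DiffPoly} (hf : f ∈ g.pol c) (h : g.ok (c + g.δ - d)) :
    dx f ∈ g.pol d := by
  refine evo_mem_pol (b := g.δ) (fun k => ?_) hf (by convert h using 1; ring)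
  show u (k + 1) ∈ _
  convert g.u_mem_pol (k + 1) using 2
  push_cast
  ring

variable {g} in
theorem iterate_dx_mem_pol {c : ℤ} {f : DiffPoly} (hf : f ∈ g.pol c) (k : ℕ) :
    dx^[k] f ∈ g.pol (c + g.δ * k) := by
  induction k with
  | zero => simpa using hf
  | succ k ih =>
    rw [Function.iterate_succ_apply']
    refine dx_mem_pol ih ?_
    convert g.ok_zero using 1
    push_cast
    ring

/-- The densities of level `c`. -/
def den (c : ℤ) : Submodule ℂ Dens where
  carrier := {G | ∀ k : ℕ, G k ∈ g.pol (c - g.δ * k)}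
  add_mem' hF hG := fun k => add_mem (hF k) (hG k)
  zero_mem' := fun _ => zero_mem _
  smul_mem' a _ hG := fun k => Submodule.smul_mem _ a (hG k)

variable {g} in
theorem single_mem_den {c d : ℤ} {f : DiffPoly} (k : ℕ) (hf : f ∈ g.pol c)
    (h : g.ok (c + g.δ * k - d)) : Finsupp.single k f ∈ g.den d := by
  intro j
  rw [Finsupp.single_apply]
  split_ifs with hj
  · subst hj
    exact pol_mono (by convert h using 1; ring) hf
  · exact zero_mem _

variable {g} in
theorem smul_mem_den {c c' d : ℤ} {f : DiffPoly} {G : Dens} (hf : f ∈ g.pol c) (hG : G ∈ g.den c')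
    (h : g.ok (c + c' - d)) : f • G ∈ g.den d :=
  fun k => mul_mem_pol hf (hG k) (by convert h using 1; ring)

variable {g} in
theorem dxDens_mem_den {c d : ℤ} {G : Dens} (hG : G ∈ g.den c) (h : g.ok (c + g.δ - d)) :
    dxDens G ∈ g.den d := by
  intro k
  rcases k with _ | k
  · rw [dxDens_apply_zero]
    exact dx_mem_pol (hG 0) (by convert h using 1; push_cast; ring)
  · rw [dxDens_apply_succ]
    refine add_mem (dx_mem_pol (hG _) ?_) (pol_mono ?_ (hG k))
    · convert h using 1; push_cast; ring
    · convert h using 1; push_cast; ring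

variable {g} in
theorem iterate_dxDens_mem_den {c : ℤ} {G : Dens} (hG : G ∈ g.den c) (k : ℕ) :
    dxDens^[k] G ∈ g.den (c + g.δ * k) := by
  induction k with
  | zero => simpa using hG
  | succ k ih =>
    rw [Function.iterate_succ_apply']
    refine dxDens_mem_den ih ?_
    convert g.ok_zero using 1
    push_cast
    ring

theorem neg_dxDens_pow_apply (k : ℕ) (G : Dens) :
    ((-dxDens) ^ k) G = ((-1 : ℂ) ^ k) • dxDens^[k] G := by
  induction k with
  | zero => simp
  | succ k ih =>
    rw [pow_succ', Module.End.mul_apply, ih, Function.iterate_succ_apply', LinearMap.neg_apply,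
      map_smul, pow_succ', mul_smul, neg_one_smul, ← smul_neg]

variable {g} in
theorem euler_mem_den {c : ℤ} {f : DiffPoly} (hf : f ∈ g.pol c) : euler f ∈ g.den (c - g.t) := by
  obtain ⟨N, hN, -⟩ := partialU_bound f
  rw [euler, varU₀_single hN]
  refine Submodule.sum_mem _ fun k _ => ?_
  rw [neg_dxDens_pow_apply]
  refine Submodule.smul_mem _ _ ?_
  have h := iterate_dxDens_mem_den (single_mem_den 0
    (g.partialU_mem_pol hf k (d := c - (g.t + g.δ * k)) (by simpa using g.ok_zero))
    (d := c - (g.t + g.δ * k)) (by simpa using g.ok_zero)) k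
  convert h using 2
  ring

variable {g} in
theorem act_mem_den {T : ℕ → DiffPoly} {V : ℕ → Dens} {b c d : ℤ}
    (hT : ∀ k : ℕ, T k ∈ g.pol (g.t + g.δ * k + b)) (hV : ∀ k : ℕ, V k ∈ g.den (g.δ * k + b))
    {G : Dens} (hG : G ∈ g.den c) (h : g.ok (b + c - d)) : act T V G ∈ g.den d := by
  refine sub_mem (fun k => evo_mem_pol hT (hG k) (by convert h using 1; ring)) ?_
  rw [Finsupp.linearCombination_apply]
  refine Submodule.sum_mem _ fun k _ => smul_mem_den (hG k) (hV k) ?_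
  convert h using 1
  ring

variable {g} in
theorem flow_mem_den {b c d : ℤ} {f : DiffPoly} (hf : f ∈ g.pol b) {G : Dens} (hG : G ∈ g.den c)
    (h : g.ok (b + c - g.t - d)) : flow f G ∈ g.den d := by
  refine act_mem_den (b := b - g.t) (fun k => ?_) (fun k => ?_) hG (by convert h using 1; ring)
  · convert iterate_dx_mem_pol hf k using 2; ring
  · convert iterate_dxDens_mem_den (euler_mem_den hf) k using 2; ring

variable {g} in
theorem dm_mem_den {c : ℤ} (n : ℕ) {G : Dens} (hG : G ∈ g.den c) : dm n G ∈ g.den c := by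
  rw [dm_apply]
  refine add_mem (fun k => evo_mem_pol (b := 0) (fun j => ?_) (hG k) ?_)
    (Submodule.smul_mem _ _ hG)
  · rw [add_zero]; exact g.u_mem_pol j
  · simpa using g.ok_zero

variable {g} in
/-- If `∂_x A + o θ_0` has level `c` then so have `∂_x A` and `o`. -/
theorem mem_den_of_dxDens_add {c : ℤ} {A : Dens} {o : DiffPoly}
    (h : dxDens A + Finsupp.single 0 o ∈ g.den (c + g.δ)) :
    A ∈ g.den c ∧ o ∈ g.pol (c + g.δ) := by
  have hA : A ∈ g.den c := by
    -- Descending induction on `k`, as for injectivity of `∂_x`; the term `o θ_0` does not meet the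
    -- coefficients of `θ_{k+1}`.
    have key : ∀ n k, A.support.sup id + 1 ≤ k + n → A k ∈ g.pol (c - g.δ * k) := by
      intro n
      induction n with
      | zero =>
        intro k hk
        have : A k = 0 := by
          by_contra hG
          have : k ≤ A.support.sup id := Finset.le_sup (f := id) (Finsupp.mem_support_iff.mpr hG)
          omega
        rw [this]; exact zero_mem _
      | succ n ih =>
        intro k hk
        have h1 := h (k + 1)
        rw [Finsupp.add_apply, dxDens_apply_succ, Finsupp.single_eq_of_ne (by omega), add_zero] at h1
        have h2 := dx_mem_pol (ih (k + 1) (by omega)) (d := c - g.δ * k) (by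
          convert g.ok_zero using 1; push_cast; ring)
        have h3 : c + g.δ - g.δ * ((k + 1 : ℕ) : ℤ) = c - g.δ * k := by push_cast; ring
        rw [h3] at h1
        simpa using sub_mem h1 h2
    exact fun k => key (A.support.sup id + 1) k (by omega)
  refine ⟨hA, ?_⟩
  have h1 := h 0
  rw [Finsupp.add_apply, dxDens_apply_zero, Finsupp.single_eq_same] at h1
  have h2 := dx_mem_pol (hA 0) (d := c + g.δ - g.δ * ((0 : ℕ) : ℤ)) (by
    convert g.ok_zero using 1; ring)
  simpa using sub_mem h1 h2

end Grading

/-- `D-1` is diagonal on monomials: its eigenvalue is the number of factors `u_k`, powers of `u`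
included, plus the order in `ε`. It vanishes only for constants at `ε⁰`. -/
theorem coeff_dm (n : ℕ) (G : Dens) (k : ℕ) (m : ℕ →₀ ℕ) (i : ℕ) :
    PowerSeries.coeff i (MvPolynomial.coeff m (dm n G k)) =
      ((i + m.degree + n : ℕ) : ℂ) * PowerSeries.coeff i (MvPolynomial.coeff m (G k)) := by
  have h : ∀ f : DiffPoly, PowerSeries.coeff i (MvPolynomial.coeff m (evo u f)) =
      ((i + m.degree : ℕ) : ℂ) * PowerSeries.coeff i (MvPolynomial.coeff m f) := by
    intro f
    induction f using MvPolynomial.induction_on' with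
    | add p q hp hq => simp only [map_add, MvPolynomial.coeff_add, hp, hq, mul_add]
    | monomial m' a =>
      have h1 : ∀ m' : ℕ →₀ ℕ, evo u (MvPolynomial.monomial m' 1) =
          (m'.degree : ℂ) • MvPolynomial.monomial m' 1 := by
        intro m'
        induction m' using Finsupp.induction_linear with
        | zero => simp
        | add f g hf hg =>
          have h2 : (MvPolynomial.monomial (f + g) 1 : DiffPoly) =
            MvPolynomial.monomial f 1 * MvPolynomial.monomial g 1 := by simp
          rw [h2, Derivation.leibniz, hf, hg, map_add]
          simp only [smul_eq_mul, mul_smul_comm]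
          push_cast
          rw [add_smul, mul_comm (MvPolynomial.monomial g 1), add_comm]
        | single j b =>
          have h2 : (MvPolynomial.monomial (Finsupp.single j b) 1 : DiffPoly) = u (j + 1) ^ b := by
            rw [u, MvPolynomial.X_pow_eq_monomial]
          rw [h2, Derivation.leibniz_pow, evo_u, smul_eq_mul, ← Nat.cast_smul_eq_nsmul ℂ]
          rcases b with _ | b
          · simp
          · rw [Nat.add_sub_cancel, ← pow_succ]; simp
      have h3 : (MvPolynomial.monomial m' a : DiffPoly) =
          MvPolynomial.C a * MvPolynomial.monomial m' 1 := by
        rw [MvPolynomial.C_mul_monomial, mul_one]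
      rw [h3, Derivation.leibniz, evo_C, h1, smul_eq_mul, smul_eq_mul, mul_smul_comm, ← h3]
      have h4 : MvPolynomial.monomial m' 1 * (u 0 * MvPolynomial.C (PowerSeries.derivative ℂ a)) =
          (MvPolynomial.monomial m' (PowerSeries.X * PowerSeries.derivative ℂ a) : DiffPoly) := by
        rw [u, ← map_mul, mul_comm, MvPolynomial.C_mul_monomial, mul_one]
      rw [h4, MvPolynomial.coeff_add, MvPolynomial.coeff_smul, MvPolynomial.coeff_monomial,
        MvPolynomial.coeff_monomial]
      split_ifs with hm
      · subst hm
        rw [map_add, map_smul, smul_eq_mul]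
        rcases i with _ | i
        · simp
        · rw [PowerSeries.coeff_succ_X_mul, PowerSeries.coeff_derivative]
          push_cast
          ring
      · simp
  rw [dm_apply, Finsupp.add_apply, evoDens_apply, MvPolynomial.coeff_add, map_add, h]
  simp [MvPolynomial.coeff_smul, add_mul]

end
end DRHierarchy

namespace DRHierarchy
open Finset.HasAntidiagonal (antidiagonal)

noncomputable section

/-! ### Propagation of levels through the twisted recursion -/

namespace Grading
variable {g : Grading}

/-- Dividing every monomial by a nonzero eigenvalue does not change which monomials occur; `h0`
excludes the only zero eigenvalue. -/
theorem mem_den_of_dm_mem {c : ℤ} {n : ℕ} {G : Dens} (h : dm n G ∈ g.den c)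
    (h0 : n = 0 → ∀ k, constTheta k G = 0) : G ∈ g.den c := by
  intro k m i hk
  refine h k m i ?_
  rw [coeff_dm]
  refine mul_ne_zero ?_ hk
  intro hz
  have hz : i + m.degree + n = 0 := by exact_mod_cast hz
  obtain ⟨⟨rfl, hm⟩, rfl⟩ : (i = 0 ∧ m.degree = 0) ∧ n = 0 := by omega
  rw [Finsupp.degree_eq_zero_iff] at hm
  subst hm
  exact hk (by simpa [constTheta] using h0 rfl k)

theorem u_mul_u_mem_pol : u 0 * u 1 ∈ g.pol (2 * g.t + g.δ) := by
  refine mul_mem_pol (g.u_mem_pol 0) (g.u_mem_pol 1) ?_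
  convert g.ok_zero using 1
  push_cast
  ring

theorem u_smul_dxDens_mem_den {b c : ℤ} (n : ℕ) {G : Dens} (hG : G ∈ g.den b)
    (h : g.ok (g.t + b - c)) :
    u 0 • dxDens G ∈ g.den (c + g.δ) ∧ u 1 • dm n G ∈ g.den (c + g.δ) := by
  constructor
  · refine smul_mem_den (g.u_mem_pol 0) (dxDens_mem_den hG (d := b + g.δ) ?_) ?_
    · simpa using g.ok_zero
    · convert h using 1; push_cast; ring
  · refine smul_mem_den (g.u_mem_pol 1) (dm_mem_den _ hG) ?_
    convert h using 1; push_cast; ring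

/-- The conditions `h1` to `h4` belong to the flow, to `u ∂_x` and `u_1 D`, to the product with `P`,
and to the product with `u u_1`. The same bookkeeping serves the filtration by the number of factors
and the exact grading by weight. -/
theorem twistedRhs_mem_den {p : ℕ → ℤ} {w : ℕ → ℕ → ℤ} {N n : ℕ} {P : ℕ → DiffPoly}
    {W : ℕ → Density} (hP : ∀ a ≤ N, P a ∈ g.pol (p a))
    (hW : ∀ m ≤ n, ∀ s ≤ N, W m s ∈ g.den (w m s))
    (h1 : ∀ a b, a + b ≤ N → g.ok (p a + w n b - g.t - (w (n + 1) (a + b) + g.δ)))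
    (h2 : ∀ s ≤ N, g.ok (g.t + w n s - w (n + 1) s))
    (h3 : ∀ m, n = m + 1 → ∀ a b, a + b ≤ N → g.ok (p a + w m b - (w (n + 1) (a + b) + g.δ)))
    (h4 : ∀ m, n = m + 1 → ∀ s ≤ N, g.ok (2 * g.t + w m s - w (n + 1) s)) {s : ℕ} (hs : s ≤ N) :
    twistedRhs P W n s ∈ g.den (w (n + 1) s + g.δ) := by
  have hu := u_smul_dxDens_mem_den (s + 1) (hW n le_rfl s hs) (h2 s hs)
  refine add_mem (sub_mem (sub_mem (Submodule.sum_mem _ fun q hq => ?_) hu.1) hu.2) ?_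
  · have hq := Finset.HasAntidiagonal.mem_antidiagonal.mp hq
    exact flow_mem_den (hP _ (by omega)) (hW n le_rfl _ (by omega)) (hq ▸ h1 _ _ (by omega))
  · rcases n with _ | n
    · exact zero_mem _
    · refine sub_mem (Submodule.sum_mem _ fun q hq => ?_) ?_
      · have hq := Finset.HasAntidiagonal.mem_antidiagonal.mp hq
        exact smul_mem_den (hP _ (by omega)) (hW n (by omega) _ (by omega))
          (hq ▸ h3 _ rfl _ _ (by omega))
      · refine smul_mem_den u_mul_u_mem_pol (hW n (by omega) s hs) ?_
        convert h4 n rfl s hs using 1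
        ring

theorem flow_sub_flow_mem_den {b b' c c' d : ℤ} {f f' : DiffPoly} {G G' : Dens}
    (hf' : f' ∈ g.pol b) (hf : f - f' ∈ g.pol b') (hG : G ∈ g.den c) (hG' : G - G' ∈ g.den c')
    (h : g.ok (b' + c - g.t - d)) (h' : g.ok (b + c' - g.t - d)) :
    flow f G - flow f' G' ∈ g.den d := by
  have e : flow f G - flow f' G' = flow (f - f') G + flow f' (G - G') := by
    rw [flow_sub_left, flow, flow, flow, flow, act_sub]; exact (sub_add_sub_cancel _ _ _).symm
  rw [e]
  exact add_mem (flow_mem_den hf hG h) (flow_mem_den hf' hG' h')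

theorem smul_sub_smul_mem_den {b b' c c' d : ℤ} {f f' : DiffPoly} {G G' : Dens}
    (hf' : f' ∈ g.pol b) (hf : f - f' ∈ g.pol b') (hG : G ∈ g.den c) (hG' : G - G' ∈ g.den c')
    (h : g.ok (b' + c - d)) (h' : g.ok (b + c' - d)) :
    f • G - f' • G' ∈ g.den d := by
  have e : f • G - f' • G' = (f - f') • G + f' • (G - G') := by
    rw [sub_smul, smul_sub]; exact (sub_add_sub_cancel _ _ _).symm
  rw [e]
  exact add_mem (smul_mem_den hf hG h) (smul_mem_den hf' hG' h')

end Grading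

/-- The filtration by `t` times the number of factors `u_k`. -/
abbrev countFiltration (t : ℤ) : Grading := ⟨t, 0, False⟩

theorem countFiltration_ok {t z : ℤ} (h : 0 ≤ z) : (countFiltration t).ok z := ⟨h, False.elim⟩

/-- The data of an approximate solution of the twisted recursion up to order `N`, with
obstructions `obs`. -/
structure IsApproxSol (J N : ℕ) (P : ℕ → DiffPoly) (W : ℕ → Density) (obs : ℕ → ℕ → DiffPoly) :
    Prop where
  zero : W 0 = -theta 1
  const : ∀ n, n + 1 ≤ J → W (n + 1) 0 = 0
  -- The last step `n = J` only defines an obstruction; no condition is put on `W (J + 1)`.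
  rec_eq : ∀ n ≤ J, ∀ s ≤ N, ∃ A, dxDens A + Finsupp.single 0 (obs n s) = twistedRhs P W n s ∧
    (n + 1 ≤ J → A = dm s (W (n + 1) s))

/-! ### Comparison of a true and an approximate solution -/

section compare
open Grading
variable {t : ℤ} {lam eps : ℕ → ℤ} {J N : ℕ} {P P' : ℕ → DiffPoly} {W W' : ℕ → Density}
  {obs : ℕ → ℕ → DiffPoly}

theorem theta_one_mem_den (s : ℕ) (h0 : lam 0 ≤ 0) :
    (-theta 1) s ∈ (countFiltration t).den (lam s - s) := by
  show -theta 1 s ∈ _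
  refine neg_mem ?_
  rcases s with _ | s
  · show Finsupp.single 1 1 ∈ _
    refine single_mem_den 1 (c := 0) ?_ (countFiltration_ok (by simpa using h0))
    intro m i h
    rw [MvPolynomial.coeff_one] at h
    split_ifs at h with hm
    · rw [PowerSeries.coeff_one] at h
      split_ifs at h with hi
      · rw [← hm, hi, level_zero]; simpa using ok_zero _
      · exact absurd rfl h
    · simp at h
  · have : theta 1 (s + 1) = 0 := by simp [theta]
    rw [this]; exact zero_mem _

/-- Count `ε` with level one. Then `lam s` bounds the excess of `P_s` over the level `2t` of `u
u_1`; every step of the recursion raises the level by `t`, and excesses add up, which is where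
subadditivity enters. -/
theorem IsTwistedSol.mem_den (hW : IsTwistedSol P W)
    (hlam : ∀ a b, a + b ≤ N → lam (a + b) ≤ lam a + lam b) (h0 : lam 0 = 0)
    (hP : ∀ a ≤ N, P a ∈ (countFiltration t).pol (2 * t + lam a - a)) (n : ℕ) :
    ∀ s ≤ N, W n s ∈ (countFiltration t).den (t * n + lam s - s) := by
  induction n using Nat.strong_induction_on with
  | _ n ih =>
    intro s hs
    rcases n with _ | n
    · rw [hW.zero]; simpa using theta_one_mem_den s h0.le
    · have h := twistedRhs_mem_den (n := n) (w := fun n s => t * n + lam s - s) hP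
        (fun m hm => ih m (by omega))
        (fun a b hab => countFiltration_ok (by have := hlam a b hab; push_cast; linarith))
        (fun s hs => countFiltration_ok (by push_cast; linarith))
        (fun m hm a b hab => countFiltration_ok (by
          subst hm; have := hlam a b hab; push_cast; linarith))
        (fun m hm s hs => countFiltration_ok (by subst hm; push_cast; linarith)) hs
      rw [← hW.rec_eq] at h
      refine mem_den_of_dm_mem (n := s) ?_ (fun hs => by subst hs; exact hW.const n)
      refine (mem_den_of_dxDens_add (o := 0) ?_).1
      rw [Finsupp.single_zero, add_zero, add_zero]
      rwa [add_zero] at h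

/-- Each difference of products splits as (error) times (true) plus (model) times (error), so an
excess bounded by `lam` meets one bounded by `eps`. -/
theorem twistedRhs_sub_mem_den {n : ℕ}
    (heps : ∀ a b, a + b ≤ N → eps (a + b) ≤ lam a + eps b) (hle : ∀ a ≤ N, lam a ≤ eps a)
    (hP : ∀ a ≤ N, P a ∈ (countFiltration t).pol (2 * t + lam a - a))
    (hP' : ∀ a ≤ N, P a - P' a ∈ (countFiltration t).pol (2 * t + eps a - a))
    (hW : ∀ m ≤ n, ∀ s ≤ N, W m s ∈ (countFiltration t).den (t * m + lam s - s))
    (hW' : ∀ m ≤ n, ∀ s ≤ N, W m s - W' m s ∈ (countFiltration t).den (t * m + eps s - s))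
    {s : ℕ} (hs : s ≤ N) : twistedRhs P W n s - twistedRhs P' W' n s ∈
      (countFiltration t).den (t * (n + 1 : ℕ) + eps s - s) := by
  have hP'' : ∀ a ≤ N, P' a ∈ (countFiltration t).pol (2 * t + lam a - a) := fun a ha => by
    have := sub_mem (hP a ha) (pol_mono (countFiltration_ok (by
      have := hle a ha; linarith)) (hP' a ha) : P a - P' a ∈ _)
    simpa using this
  have hu := u_smul_dxDens_mem_den (c := t * (n + 1 : ℕ) + eps s - s) (s + 1) (hW' n le_rfl s hs)
    (countFiltration_ok (by push_cast; linarith))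
  rw [add_zero] at hu
  have e : twistedRhs P W n s - twistedRhs P' W' n s =
      ∑ p ∈ antidiagonal s, (flow (P p.1) (W n p.2) - flow (P' p.1) (W' n p.2))
      - u 0 • dxDens (W n s - W' n s) - u 1 • dm (s + 1) (W n s - W' n s)
      + (prevTerm P W n s - prevTerm P' W' n s) := by
    rw [twistedRhs, twistedRhs, Finset.sum_sub_distrib, map_sub, map_sub, smul_sub, smul_sub]
    have key : ∀ {M : Type} [AddCommGroup M] (a b c d a' b' c' d' : M),
      a - b - c + d - (a' - b' - c' + d') = a - a' - (b - b') - (c - c') + (d - d') := by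
      intros; abel
    exact key _ _ _ _ _ _ _ _
  rw [e]
  refine add_mem (sub_mem (sub_mem (Submodule.sum_mem _ fun q hq => ?_) hu.1) hu.2) ?_
  · have hq := Finset.HasAntidiagonal.mem_antidiagonal.mp hq
    subst hq
    refine flow_sub_flow_mem_den (hP'' _ (by omega)) (hP' _ (by omega)) (hW n le_rfl _ (by omega))
      (hW' n le_rfl _ (by omega)) (countFiltration_ok ?_) (countFiltration_ok ?_)
    · have := heps q.2 q.1 (by omega); rw [add_comm q.2] at this; push_cast; linarith
    · have := heps q.1 q.2 (by omega); push_cast; linarith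
  · rcases n with _ | n
    · simp [prevTerm]
    · have e : prevTerm P W (n + 1) s - prevTerm P' W' (n + 1) s =
          ∑ p ∈ antidiagonal s, (P p.1 • W n p.2 - P' p.1 • W' n p.2)
          - (u 0 * u 1) • (W n s - W' n s) := by
        rw [prevTerm, prevTerm, Finset.sum_sub_distrib, smul_sub]
        exact sub_sub_sub_comm _ _ _ _
      rw [e]
      refine sub_mem (Submodule.sum_mem _ fun q hq => ?_) ?_
      · have hq := Finset.HasAntidiagonal.mem_antidiagonal.mp hq
        subst hq
        refine smul_sub_smul_mem_den (hP'' _ (by omega)) (hP' _ (by omega))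
          (hW n (by omega) _ (by omega)) (hW' n (by omega) _ (by omega)) (countFiltration_ok ?_) (countFiltration_ok ?_)
        · have := heps q.2 q.1 (by omega); rw [add_comm q.2] at this; push_cast; linarith
        · have := heps q.1 q.2 (by omega); push_cast; linarith
      · refine smul_mem_den u_mul_u_mem_pol (hW' n (by omega) s hs) (countFiltration_ok ?_)
        push_cast; linarith

theorem IsTwistedSol.sub_mem_den (hW : IsTwistedSol P W) (hW' : IsApproxSol J N P' W' obs)
    (hlam : ∀ a b, a + b ≤ N → lam (a + b) ≤ lam a + lam b) (h0 : lam 0 = 0)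
    (heps : ∀ a b, a + b ≤ N → eps (a + b) ≤ lam a + eps b) (hle : ∀ a ≤ N, lam a ≤ eps a)
    (hP : ∀ a ≤ N, P a ∈ (countFiltration t).pol (2 * t + lam a - a))
    (hP' : ∀ a ≤ N, P a - P' a ∈ (countFiltration t).pol (2 * t + eps a - a)) (n : ℕ)
    (hn : n ≤ J) :
    ∀ s ≤ N, W n s - W' n s ∈ (countFiltration t).den (t * n + eps s - s) := by
  induction n using Nat.strong_induction_on with
  | _ n ih =>
    intro s hs
    rcases n with _ | n
    · rw [hW.zero, hW'.zero, sub_self]; exact zero_mem _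
    · have h := twistedRhs_sub_mem_den heps hle hP hP'
        (fun m _ => hW.mem_den hlam h0 hP m) (fun m hm => ih m (by omega) (by omega)) hs (n := n)
      obtain ⟨A, hA, hA'⟩ := hW'.rec_eq n (by omega) s hs
      rw [← hW.rec_eq, ← hA, hA' hn] at h
      refine mem_den_of_dm_mem (n := s) ?_ (fun hs => ?_)
      · refine (mem_den_of_dxDens_add (o := -obs n s) ?_).1
        rw [add_zero, Finsupp.single_neg, map_sub, map_sub, ← sub_eq_add_neg, sub_sub]
        exact h
      · subst hs
        intro k
        rw [hW'.const n (by omega), sub_zero]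
        exact hW.const n k

/-- The true solution is unobstructed and the decomposition `∂_x A + o θ_0` respects levels, so the
obstruction of the model lies as high as its error. All necessary conditions beyond homogeneity and
(b) come from here. -/
theorem IsTwistedSol.obs_mem_pol (hW : IsTwistedSol P W) (hW' : IsApproxSol J N P' W' obs)
    (hlam : ∀ a b, a + b ≤ N → lam (a + b) ≤ lam a + lam b) (h0 : lam 0 = 0)
    (heps : ∀ a b, a + b ≤ N → eps (a + b) ≤ lam a + eps b) (hle : ∀ a ≤ N, lam a ≤ eps a)
    (hP : ∀ a ≤ N, P a ∈ (countFiltration t).pol (2 * t + lam a - a))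
    (hP' : ∀ a ≤ N, P a - P' a ∈ (countFiltration t).pol (2 * t + eps a - a)) (n : ℕ)
    (hn : n ≤ J) (s : ℕ) (hs : s ≤ N) :
    obs n s ∈ (countFiltration t).pol (t * (n + 1 : ℕ) + eps s - s) := by
  have h := twistedRhs_sub_mem_den heps hle hP hP'
    (fun m _ => hW.mem_den hlam h0 hP m)
    (fun m hm => hW.sub_mem_den hW' hlam h0 heps hle hP hP' m (by omega)) hs (n := n)
  obtain ⟨A, hA, -⟩ := hW'.rec_eq n hn s hs
  rw [← hW.rec_eq, ← hA] at h
  have h2 := (mem_den_of_dxDens_add (g := countFiltration t) (A := dm s (W (n + 1) s) - A)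
    (o := -obs n s) (c := t * (n + 1 : ℕ) + eps s - s) (by
      rw [add_zero, Finsupp.single_neg, map_sub, ← sub_eq_add_neg, sub_sub]
      exact h)).2
  rw [add_zero] at h2
  simpa using neg_mem h2

end compare

/-! ### Exact solutions give hierarchies -/

theorem hasDegree_iff {d : ℤ} {F : Density} :
    HasDegree d F ↔ ∀ s : ℕ, F s ∈ (⟨0, 1, True⟩ : Grading).den (s + d) := by
  have h : ∀ (s k : ℕ) (m : ℕ →₀ ℕ) (i : ℕ),
      (⟨0, 1, True⟩ : Grading).ok ((⟨0, 1, True⟩ : Grading).level m i - (s + d - 1 * k)) ↔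
      ((Finsupp.weight (fun i : ℕ => i + 1) m : ℕ) : ℤ) + k - s = d := by
    intro s k m i
    simp only [Grading.ok, Grading.level, forall_const]
    omega
  constructor
  · intro hF s k m i h0
    exact (h s k m i).mpr (hF s k m (fun h1 => h0 (by rw [h1, map_zero])))
  · intro hF s k m h0
    obtain ⟨i, hi⟩ : ∃ i, PowerSeries.coeff i (MvPolynomial.coeff m (F s k)) ≠ 0 := by
      by_contra hc
      push Not at hc
      exact h0 (PowerSeries.ext fun i => by simp [hc i])
    exact (h s k m i).mp (hF s k m i hi)

/-- The grading by the weight `∑ k` of the factors `u_k` and `θ_k`. -/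
abbrev weightGrading : Grading := ⟨0, 1, True⟩

theorem weightGrading_ok {z : ℤ} : weightGrading.ok z ↔ z = 0 := by
  simp only [Grading.ok, forall_const]; omega


/-- The variational derivative of `∫ f θ_0 dx` up to second derivatives. -/
theorem euler_eq_add_dxDens_dxDens (f : DiffPoly) : ∃ G : Dens,
    euler f = Finsupp.single 0 (partialU 0 f) - dxDens (Finsupp.single 0 (partialU 1 f))
      + dxDens (dxDens G) ∧
    ∀ c, f ∈ weightGrading.pol c → G ∈ weightGrading.den (c - 2) := by
  obtain ⟨N, hN, -⟩ := partialU_bound f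
  refine ⟨∑ k ∈ Finset.range N, ((-dxDens) ^ k) (Finsupp.single 0 (partialU (k + 2) f)), ?_,
    fun c hf => Submodule.sum_mem _ fun k _ => ?_⟩
  · rw [euler, varU₀_single (N := N + 2) (fun k hk => hN k (by omega)), Finset.sum_range_succ',
      Finset.sum_range_succ', map_sum, map_sum]
    simp only [pow_succ' (-dxDens), Module.End.mul_apply, LinearMap.neg_apply, neg_neg, pow_zero,
      Module.End.one_apply, map_neg]
    have key : ∀ {M : Type} [AddCommGroup M] (a b c : M), a + -b + c = c - b + a := by
      intros; abel
    exact key _ _ _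
  · rw [Grading.neg_dxDens_pow_apply]
    refine Submodule.smul_mem _ _ ?_
    have h := Grading.iterate_dxDens_mem_den (g := weightGrading) (Grading.single_mem_den 0
      (weightGrading.partialU_mem_pol hf (k + 2) (d := c - (k + 2)) (by
        rw [weightGrading_ok]; push_cast; ring))
      (d := c - (k + 2)) (by rw [weightGrading_ok]; push_cast; ring)) k
    convert h using 2
    ring

/-- Modulo `∂_x²` the derivative `δ/δu` of `∫ f θ dx` is `(∂f/∂u) θ - ∂_x((∂f/∂u_1) θ)`. For `s ≥ 1`
condition (b) puts it into the image of `∂_x²`. Applying `δ/δθ`, which kills total derivatives,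
isolates the first term; cancelling one `∂_x` and repeating isolates the second. -/
theorem IsDRType.partialU_eq_zero {X : LocalVectorField} (hX : IsDRType X) {s : ℕ} (hs : s ≠ 0) :
    partialU 0 (varTheta X s) = 0 ∧ partialU 1 (varTheta X s) = 0 := by
  obtain ⟨R, -, hR⟩ := hX.unit
  have h := hR s le_top
  rw [← ofEquation_varTheta X, varU_ofEquation] at h
  have h1 : (-uTheta1 + dxDensity (dxDensity R)) s = dxDens (dxDens (R s)) := by
    have : uTheta1 s = 0 := by simp [uTheta1, hs]
    show -uTheta1 s + dxDens (dxDens (R s)) = _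
    rw [this, neg_zero, zero_add]
  obtain ⟨G, hG, -⟩ := euler_eq_add_dxDens_dxDens (varTheta X s)
  rw [h1, hG] at h
  have h0 : partialU 0 (varTheta X s) = 0 := by
    have := congrArg varTheta₀ h
    simpa [varTheta₀_dxDens, varTheta₀_single_zero] using this
  refine ⟨h0, ?_⟩
  rw [h0, Finsupp.single_zero, zero_sub, ← map_neg, ← map_add] at h
  have h2 := congrArg varTheta₀ (dxDens_injective h)
  simpa [varTheta₀_dxDens, varTheta₀_single_zero] using h2

theorem IsDRType.mem_pol {X : LocalVectorField} (hX : IsDRType X) (s : ℕ) :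
    varTheta X s ∈ weightGrading.pol (s + 1) := by
  obtain ⟨f, hf, rfl⟩ := hX.homogeneous
  rw [varTheta_integral, varTheta₀]
  have hfs := hasDegree_iff.mp hf s
  rw [Finsupp.lsum_apply]
  refine Submodule.sum_mem _ fun k _ => ?_
  have key : ∀ k (p : DiffPoly), ((-dx.toLinearMap : DiffPoly →ₗ[ℂ] DiffPoly) ^ k) p =
      ((-1 : ℂ) ^ k) • dx^[k] p := by
    intro k p
    induction k with
    | zero => simp
    | succ k ih =>
      rw [pow_succ', Module.End.mul_apply, ih, Function.iterate_succ_apply', LinearMap.neg_apply,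
        map_smul, pow_succ', mul_smul, neg_one_smul]
      rfl
  show ((-dx.toLinearMap : DiffPoly →ₗ[ℂ] DiffPoly) ^ k) (f s k) ∈ _
  rw [key]
  refine Submodule.smul_mem _ _ ?_
  convert Grading.iterate_dx_mem_pol (hfs k) k using 2
  ring

/-- Converse of the preceding argument. At `ε⁰` one may take `R = 0`, since `u u_1` already has the
variational derivative `-u θ_1`. -/
theorem euler_mem {P : ℕ → DiffPoly} (hP0 : P 0 = u 0 * u 1)
    (hP : ∀ s : ℕ, P s ∈ weightGrading.pol (s + 1))
    (hP' : ∀ s ≠ 0, partialU 0 (P s) = 0 ∧ partialU 1 (P s) = 0) :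
    ∃ R : Density, HasDegree (-1) R ∧
      ∀ s, varU (ofEquation P) s = (-uTheta1 + dxDensity (dxDensity R)) s := by
  choose G hG hG' using fun s => euler_eq_add_dxDens_dxDens (P s)
  refine ⟨fun s => if s = 0 then 0 else G s, ?_, fun s => ?_⟩
  · rw [hasDegree_iff]
    intro s
    split_ifs
    · exact zero_mem _
    · convert hG' s _ (hP s) using 2
      ring
  · rw [varU_ofEquation]
    have h1 : ∀ R, (-uTheta1 + dxDensity (dxDensity R)) s = -uTheta1 s + dxDens (dxDens (R s)) :=
      fun R => rfl
    rw [h1]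
    by_cases hs : s = 0
    · subst hs
      rw [hP0, euler_u_mul_u_one]
      simp [uTheta1]
    · rw [hG, (hP' s hs).1, (hP' s hs).2, if_neg hs]
      simp [uTheta1, hs]

theorem twist_hasDegree {W : ℕ → Density} (hW : ∀ n, HasDegree 1 (W n)) (n : ℕ) :
    HasDegree 1 (twist W n) := by
  rw [hasDegree_iff]
  intro s
  refine Submodule.sum_mem _ fun p _ => ?_
  refine Grading.smul_mem_den (c := 0) ?_ (hasDegree_iff.mp (hW p.2) s)
    (weightGrading_ok.mpr (by ring))
  intro m i h0
  have := isWeightedHomogeneous_expU p.1 (d := m) (fun h => h0 (by rw [h, map_zero]))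
  rw [weightGrading_ok, Grading.level, this]
  simp

theorem isDRTypeUpTo_of_twistedRec {N : ℕ∞} {P : ℕ → DiffPoly} {W : ℕ → Density}
    (hP0 : P 0 = u 0 * u 1) (hP : ∀ s : ℕ, P s ∈ weightGrading.pol (s + 1))
    (hP' : ∀ s ≠ 0, partialU 0 (P s) = 0 ∧ partialU 1 (P s) = 0)
    (hW0 : W 0 = -theta 1) (hW : ∀ n, HasDegree 1 (W n))
    (hrec : ∀ n s : ℕ, (s : ℕ∞) ≤ N → twistedRec P W n s = 0) :
    IsDRTypeUpTo N (ofEquation P) where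
  homogeneous := by
    refine ⟨_, hasDegree_iff.mpr fun s => ?_, rfl⟩
    exact Grading.single_mem_den 0 (hP s) (weightGrading_ok.mpr (by push_cast; ring))
  recursion := by
    refine ⟨twist W, twist_hasDegree hW, ?_, fun n s hs => ?_⟩
    · ext1 s
      simp only [twist, Finset.Nat.antidiagonal_zero, Finset.sum_singleton, expU_zero, one_smul,
        hW0]
    · rw [recursionOperator_twist]
      exact Finset.sum_eq_zero fun p _ => by rw [hrec _ _ hs, smul_zero]
  unit := by
    obtain ⟨R, hR, hR'⟩ := euler_mem hP0 hP hP'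
    exact ⟨R, hR, fun s _ => hR' s⟩

theorem IsApproxSol.mem_den_weight {J N : ℕ} {P : ℕ → DiffPoly} {W : ℕ → Density}
    {obs : ℕ → ℕ → DiffPoly} (hW : IsApproxSol J N P W obs)
    (hP : ∀ s : ℕ, P s ∈ weightGrading.pol (s + 1))
    (n : ℕ) (hn : n ≤ J) : ∀ s ≤ N, W n s ∈ weightGrading.den (s + 1) := by
  induction n using Nat.strong_induction_on with
  | _ n ih =>
    intro s hs
    rcases n with _ | n
    · rw [hW.zero]
      have h : HasDegree 1 (-theta 1) := by
        intro s k m h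
        have h' : MvPolynomial.coeff m (theta 1 s k) ≠ 0 := fun h0 => h (by
          show MvPolynomial.coeff m (-(theta 1 s k)) = 0
          rw [MvPolynomial.coeff_neg, h0, neg_zero])
        rcases s with _ | s
        · simp only [theta, Pi.single_eq_same, Finsupp.single_apply] at h'
          split_ifs at h' with hk
          · rw [MvPolynomial.coeff_one] at h'
            split_ifs at h' with hm
            · subst hm hk; simp
            · exact absurd rfl h'
          · simp at h'
        · simp [theta] at h'
      exact hasDegree_iff.mp h s
    · have h := Grading.twistedRhs_mem_den (g := weightGrading) (n := n) (N := N)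
        (w := fun n s => s + 1) (fun a _ => hP a)
        (fun m hm => ih m (by omega) (by omega))
        (fun a b _ => weightGrading_ok.mpr (by push_cast; ring))
        (fun s _ => weightGrading_ok.mpr (by ring))
        (fun m _ a b _ => weightGrading_ok.mpr (by push_cast; ring))
        (fun m _ s _ => weightGrading_ok.mpr (by ring)) hs
      obtain ⟨A, hA, hA'⟩ := hW.rec_eq n (by omega) s hs
      rw [← hA, hA' hn] at h
      refine Grading.mem_den_of_dm_mem (n := s) (Grading.mem_den_of_dxDens_add h).1 ?_
      rintro rfl k
      rw [hW.const n (by omega), map_zero]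

/-- The twisted recursion looks back only two steps, so two consecutive zero densities stay zero
forever. A finite unobstructed calculation therefore yields all `Y_d`. -/
theorem IsApproxSol.isDRTypeUpTo {J N : ℕ} {P : ℕ → DiffPoly} {W : ℕ → Density}
    {obs : ℕ → ℕ → DiffPoly} (hW : IsApproxSol (J + 2) N P W obs)
    (hobs : ∀ n ≤ J + 2, ∀ s ≤ N, obs n s = 0) (hWJ : ∀ n, J < n → W n = 0)
    (hWN : ∀ n s, N < s → W n s = 0)
    (hP0 : P 0 = u 0 * u 1) (hP : ∀ s : ℕ, P s ∈ weightGrading.pol (s + 1))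
    (hP' : ∀ s ≠ 0, partialU 0 (P s) = 0 ∧ partialU 1 (P s) = 0) :
    IsDRTypeUpTo N (ofEquation P) := by
  refine isDRTypeUpTo_of_twistedRec (W := W) hP0 hP hP' hW.zero (fun n => ?_) (fun n s hs => ?_)
  · rw [hasDegree_iff]
    intro s
    by_cases hn : J < n
    · rw [hWJ n hn]; exact zero_mem _
    by_cases hs : N < s
    · rw [hWN n s hs]; exact zero_mem _
    exact hW.mem_den_weight hP n (by omega) s (by omega)
  · have hs : s ≤ N := by exact_mod_cast hs
    rcases n with _ | n
    · rw [twistedRec, hW.zero]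
      have h : dm s ((-theta 1) s) = 0 := by
        show dm s (-theta 1 s) = 0
        rw [map_neg, neg_eq_zero]
        rcases s with _ | s
        · rw [dm_apply]
          simp [theta, evoDens]
        · simp [theta]
      rw [h, map_zero]
    · rw [twistedRec]
      by_cases hn : n ≤ J + 1
      · obtain ⟨A, hA, hA'⟩ := hW.rec_eq n (by omega) s hs
        rw [← hA, hobs n (by omega) s hs, hA' (by omega), Finsupp.single_zero, add_zero, sub_self]
      · obtain ⟨n, rfl⟩ : ∃ m, n = m + 1 := ⟨n - 1, by omega⟩
        have h0 : ∀ f, flow f 0 = 0 := fun f => act_zero _ _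
        simp [twistedRhs, prevTerm, hWJ (n + 1) (by omega), hWJ n (by omega),
          hWJ (n + 1 + 1) (by omega), h0]

end
end DRHierarchy

namespace DRHierarchy
open Finset.HasAntidiagonal (antidiagonal)

noncomputable section

/-! ### Monomials encoded by prime factorizations -/

/-- The completely multiplicative function on the natural numbers with value `v p` at primes `p`. -/
def godel {R : Type*} [CommMonoidWithZero R] (v : ℕ → R) (n : ℕ) : R :=
  if n = 0 then 0 else (n.primeFactorsList.map v).prod

section godel
variable {R : Type*} [CommMonoidWithZero R] (v : ℕ → R)

@[simp] theorem godel_zero : godel v 0 = 0 := if_pos rfl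

theorem godel_of_ne {n : ℕ} (h : n ≠ 0) : godel v n = (n.primeFactorsList.map v).prod := if_neg h

@[simp] theorem godel_one : godel v 1 = 1 := by simp [godel]

theorem godel_mul (m n : ℕ) : godel v (m * n) = godel v m * godel v n := by
  rcases eq_or_ne m 0 with rfl | hm
  · simp
  rcases eq_or_ne n 0 with rfl | hn
  · simp
  rw [godel_of_ne v hm, godel_of_ne v hn, godel_of_ne v (mul_ne_zero hm hn), ← List.prod_append,
    ← List.map_append]
  exact ((Nat.perm_primeFactorsList_mul hm hn).map v).prod_eq

theorem godel_prime {p : ℕ} (hp : p.Prime) : godel v p = v p := by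
  rw [godel_of_ne v hp.ne_zero, Nat.primeFactorsList_prime hp]; simp

end godel

/-- The index of the prime `p`, counted from `0`. -/
def primeIndex (p : ℕ) : ℕ := Nat.count Nat.Prime p

/-- The jet variable `u_{i+1}` corresponds to the prime with index `i`. -/
def jet (p : ℕ) : DiffPoly := u (primeIndex p + 1)

theorem nth_primeIndex {p : ℕ} (hp : p.Prime) : Nat.nth Nat.Prime (primeIndex p) = p :=
  Nat.nth_count hp

theorem primeIndex_nth (i : ℕ) : primeIndex (Nat.nth Nat.Prime i) = i :=
  Nat.count_nth_of_infinite Nat.infinite_setOfPred_prime i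

theorem primeIndex_injOn {p q : ℕ} (hp : p.Prime) (hq : q.Prime)
    (h : primeIndex p = primeIndex q) : p = q := by
  rw [← nth_primeIndex hp, h, nth_primeIndex hq]

/-- The exponents of the monomial encoded by `n`. -/
def exponents (n : ℕ) : ℕ →₀ ℕ :=
  (n.primeFactorsList.map fun p => Finsupp.single (primeIndex p) 1).sum

theorem godel_jet {n : ℕ} (hn : n ≠ 0) :
    godel jet n = MvPolynomial.monomial (exponents n) 1 := by
  rw [godel_of_ne _ hn, exponents]
  induction n.primeFactorsList with
  | nil => simp
  | cons p l ih =>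
    rw [List.map_cons, List.prod_cons, ih, List.map_cons, List.sum_cons]
    show MvPolynomial.X _ * _ = _
    rw [MvPolynomial.X, MvPolynomial.monomial_mul, one_mul]

theorem exponents_apply {n p : ℕ} (hp : p.Prime) :
    exponents n (primeIndex p) = n.primeFactorsList.count p := by
  rw [exponents]
  have h : ∀ q ∈ n.primeFactorsList, q.Prime := fun q hq => Nat.prime_of_mem_primeFactorsList hq
  revert h
  induction n.primeFactorsList with
  | nil => simp
  | cons q l ih =>
    intro h
    rw [List.map_cons, List.sum_cons, Finsupp.add_apply, ih (fun q hq => h q (by simp [hq])),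
      List.count_cons, Finsupp.single_apply, add_comm]
    congr 1
    by_cases hq : q = p
    · simp [hq]
    · rw [if_neg, if_neg]
      · simpa using hq
      · exact fun h' => hq (primeIndex_injOn (h q (by simp)) hp h')

theorem exponents_injOn {m n : ℕ} (hm : m ≠ 0) (hn : n ≠ 0) (h : exponents m = exponents n) :
    m = n := by
  refine Nat.eq_of_factorization_eq hm hn fun p => ?_
  by_cases hp : p.Prime
  · rw [← Nat.primeFactorsList_count_eq, ← Nat.primeFactorsList_count_eq, ← exponents_apply hp,
      ← exponents_apply hp, h]
  · simp [Nat.factorization_eq_zero_of_not_prime, hp]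

theorem degree_exponents (n : ℕ) : (exponents n).degree = n.primeFactorsList.length := by
  rw [exponents]
  induction n.primeFactorsList with
  | nil => simp
  | cons q l ih => rw [List.map_cons, List.sum_cons, map_add, ih, List.length_cons]; simp [add_comm]

/-- The sum over the prime factors `p` of `r` of `T_p` times the monomial encoded by `n / p`. -/
def primeSum (T : ℕ → DiffPoly) (n r : ℕ) : DiffPoly :=
  (r.primeFactorsList.map fun p => godel jet (n / p) * T (primeIndex p + 1)).sum

theorem primeSum_mul (T : ℕ → DiffPoly) (n : ℕ) {r s : ℕ} (hr : r ≠ 0) (hs : s ≠ 0) :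
    primeSum T n (r * s) = primeSum T n r + primeSum T n s := by
  rw [primeSum, primeSum, primeSum, ← List.sum_append, ← List.map_append]
  exact ((Nat.perm_primeFactorsList_mul hr hs).map _).sum_eq

theorem primeSum_prime_pow (T : ℕ → DiffPoly) (n : ℕ) {p : ℕ} (hp : p.Prime) (e : ℕ) :
    primeSum T n (p ^ e) = (e : ℂ) • (godel jet (n / p) * T (primeIndex p + 1)) := by
  rw [primeSum, hp.primeFactorsList_pow, List.map_replicate, List.sum_replicate,
    Nat.cast_smul_eq_nsmul]

theorem evo_godel (T : ℕ → DiffPoly) {n : ℕ} (hn : n ≠ 0) :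
    evo T (godel jet n) = primeSum T n n := by
  induction n using Nat.recOnMul with
  | zero => exact absurd rfl hn
  | one => simp [primeSum]
  | prime p hp =>
    rw [godel_prime _ hp, jet, evo_u, primeSum, Nat.primeFactorsList_prime hp]
    simp [Nat.div_self hp.pos]
  | mul a b ha hb =>
    have ha0 := left_ne_zero_of_mul hn
    have hb0 := right_ne_zero_of_mul hn
    rw [godel_mul, Derivation.leibniz, ha ha0, hb hb0, primeSum_mul _ _ ha0 hb0, add_comm]
    simp only [smul_eq_mul, primeSum, ← List.sum_map_mul_left]
    congr 1
    · refine congrArg List.sum (List.map_congr_left fun p hp => ?_)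
      have h := Nat.dvd_of_mem_primeFactorsList hp
      rw [mul_comm a b, Nat.mul_div_assoc b h, godel_mul, mul_assoc]
    · refine congrArg List.sum (List.map_congr_left fun p hp => ?_)
      have h := Nat.dvd_of_mem_primeFactorsList hp
      rw [Nat.mul_div_assoc a h, godel_mul, mul_assoc]

/-! ### Sparse polynomials -/

/-- A polynomial in parameters with integer coefficients; the monomials are encoded by numbers. -/
abbrev Coef := List (ℕ × ℤ)

/-- A differential polynomial whose coefficients are polynomials in parameters. -/
abbrev Poly := List (ℕ × Coef)

/-- A density; the `k`-th entry is the coefficient of `θ_k`. -/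
abbrev DensL := List Poly

/-- A density whose coefficients are unevaluated sums. -/
abbrev DensU := List (List Poly)

/-- Whether an integer is zero. -/
def isZero (c : ℤ) : Bool := match c with
  | Int.ofNat n => Nat.beq n 0
  | Int.negSucc _ => false

/-- A merge of lists by key, with `n` as fuel. When the fuel is exhausted the lists are appended, so
the value is correct without assumptions on order or length. -/
def mergeC (n : ℕ) : Coef → Coef → Coef :=
  Nat.rec (fun a b => a ++ b) (fun _ ih a b =>
    List.rec b (fun x a' _ => List.rec a (fun y b' _ =>
      Bool.rec (Bool.rec (y :: ih a b') (x :: ih a' b) (Nat.ble x.1 y.1))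
        ((fun c => Bool.rec ((x.1, c) :: ih a' b') (ih a' b') (isZero c)) (Int.add x.2 y.2))
        (Nat.beq x.1 y.1)) b) a) n

def addC (a b : Coef) : Coef := mergeC 1000 a b

def smulC (c : ℤ) (a : Coef) : Coef := List.rec [] (fun x _ ih => (x.1, Int.mul c x.2) :: ih) a

def mulC : Coef → Coef → Coef
  | [], _ => []
  | x :: a, b => addC (b.map fun y => (Nat.mul x.1 y.1, Int.mul x.2 y.2)) (mulC a b)

def mergeP : ℕ → Poly → Poly → Poly
  | 0, a, b => a ++ b
  | _ + 1, [], b => b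
  | _ + 1, x :: a, [] => x :: a
  | n + 1, x :: a, y :: b =>
    match Nat.beq x.1 y.1 with
    | true => match addC x.2 y.2 with
      | [] => mergeP n a b
      | c :: l => (x.1, c :: l) :: mergeP n a b
    | false => match Nat.ble x.1 y.1 with
      | true => x :: mergeP n a (y :: b)
      | false => y :: mergeP n (x :: a) b

def mergePairs : List Poly → List Poly
  | a :: b :: l => mergeP 4096 a b :: mergePairs l
  | l => l

def mergeAll : ℕ → List Poly → Poly
  | 0, l => l.flatten
  | _ + 1, [] => []
  | _ + 1, [a] => a
  | n + 1, a :: b :: l => mergeAll n (mergePairs (a :: b :: l))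

def norm (l : List Poly) : Poly := mergeAll 20 l

def mulT (n : ℕ) (c : Coef) (L : Poly) : Poly := L.map fun s => (Nat.mul n s.1, mulC c s.2)

def smulP (c : ℤ) (L : Poly) : Poly := L.map fun s => (s.1, smulC c s.2)

def negP (L : Poly) : Poly := smulP (-1) L

section eval
variable (v : ℕ → ℂ)

def evC (a : Coef) : ℂ := (a.map fun x => (x.2 : ℂ) * godel v x.1).sum

def evP (L : Poly) : DiffPoly := (L.map fun t => evC v t.2 • godel jet t.1).sum

def evU (l : List Poly) : DiffPoly := (l.map (evP v)).sum

def evD : DensL → Dens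
  | [] => 0
  | f :: F => Finsupp.single 0 (evP v f) + shiftDens (evD F)

def evDU : DensU → Dens
  | [] => 0
  | f :: F => Finsupp.single 0 (evU v f) + shiftDens (evDU F)

@[simp] theorem evC_nil : evC v [] = 0 := rfl

@[simp] theorem evC_cons (x : ℕ × ℤ) (a : Coef) :
    evC v (x :: a) = (x.2 : ℂ) * godel v x.1 + evC v a := by simp [evC]

@[simp] theorem evC_append (a b : Coef) : evC v (a ++ b) = evC v a + evC v b := by simp [evC]

@[simp] theorem evP_nil : evP v [] = 0 := rfl

@[simp] theorem evP_cons (x : ℕ × Coef) (a : Poly) :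
    evP v (x :: a) = evC v x.2 • godel jet x.1 + evP v a := by simp [evP]

@[simp] theorem evP_append (a b : Poly) : evP v (a ++ b) = evP v a + evP v b := by simp [evP]

@[simp] theorem evU_nil : evU v [] = 0 := rfl

@[simp] theorem evU_cons (x : Poly) (a : List Poly) : evU v (x :: a) = evP v x + evU v a := by
  simp [evU]

@[simp] theorem evU_append (a b : List Poly) : evU v (a ++ b) = evU v a + evU v b := by simp [evU]

@[simp] theorem evD_nil : evD v [] = 0 := rfl

@[simp] theorem evD_cons (f : Poly) (F : DensL) :
    evD v (f :: F) = Finsupp.single 0 (evP v f) + shiftDens (evD v F) := rfl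

@[simp] theorem evDU_nil : evDU v [] = 0 := rfl

@[simp] theorem evDU_cons (f : List Poly) (F : DensU) :
    evDU v (f :: F) = Finsupp.single 0 (evU v f) + shiftDens (evDU v F) := rfl

theorem isZero_eq {c : ℤ} (h : isZero c = true) : c = 0 := by
  rcases c with n | n
  · simpa [isZero] using h
  · simp [isZero] at h

theorem evC_mergeC (n : ℕ) : ∀ a b, evC v (mergeC n a b) = evC v a + evC v b := by
  induction n with
  | zero => intro a b; exact evC_append v a b
  | succ n ih =>
    intro a b
    rcases a with _ | ⟨x, a⟩
    · show evC v b = _; simp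
    rcases b with _ | ⟨y, b⟩
    · show evC v (x :: a) = _; simp
    have e : mergeC (n + 1) (x :: a) (y :: b) = Bool.rec
      (Bool.rec (y :: mergeC n (x :: a) b) (x :: mergeC n a (y :: b)) (Nat.ble x.1 y.1))
      (Bool.rec ((x.1, Int.add x.2 y.2) :: mergeC n a b) (mergeC n a b)
        (isZero (Int.add x.2 y.2)))
      (Nat.beq x.1 y.1) := rfl
    rw [e]
    cases h : Nat.beq x.1 y.1
    · cases Nat.ble x.1 y.1
      · simp [ih]; ring
      · simp [ih]; ring
    · have hxy : x.1 = y.1 := Nat.eq_of_beq_eq_true h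
      cases h' : isZero (Int.add x.2 y.2)
      · simp [ih, hxy]; ring
      · have h0 : x.2 + y.2 = 0 := isZero_eq h'
        have h1 : (x.2 : ℂ) + y.2 = 0 := by exact_mod_cast h0
        simp only [ih, evC_cons, hxy]
        linear_combination -godel v y.1 * h1

theorem evC_addC (a b : Coef) : evC v (addC a b) = evC v a + evC v b := evC_mergeC v _ a b

theorem evC_smulC (c : ℤ) (a : Coef) : evC v (smulC c a) = c * evC v a := by
  induction a with
  | nil => simp [smulC]
  | cons x a ih =>
    have e : smulC c (x :: a) = (x.1, c * x.2) :: smulC c a := rfl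
    rw [e, evC_cons, ih, evC_cons]
    push_cast
    ring

theorem evC_mulC (a b : Coef) : evC v (mulC a b) = evC v a * evC v b := by
  induction a with
  | nil => simp [mulC]
  | cons x a ih =>
    rw [mulC, evC_addC, ih, evC_cons, add_mul]
    congr 1
    clear ih
    induction b with
    | nil => simp
    | cons y b ih' =>
      rw [List.map_cons, evC_cons, ih', evC_cons]
      show ((x.2 * y.2 : ℤ) : ℂ) * godel v (x.1 * y.1) + _ = _
      rw [godel_mul]
      push_cast
      ring

theorem evP_mergeP (n : ℕ) : ∀ a b, evP v (mergeP n a b) = evP v a + evP v b := by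
  induction n with
  | zero => intro a b; exact evP_append v a b
  | succ n ih =>
    intro a b
    rcases a with _ | ⟨x, a⟩
    · simp [mergeP]
    rcases b with _ | ⟨y, b⟩
    · simp [mergeP]
    rw [mergeP]
    cases h : Nat.beq x.1 y.1
    · cases Nat.ble x.1 y.1
      · simp only [ih, evP_cons]; abel
      · simp only [ih, evP_cons]; abel
    · have hxy : x.1 = y.1 := Nat.eq_of_beq_eq_true h
      have hC := evC_addC v x.2 y.2
      cases h' : addC x.2 y.2 with
      | nil =>
        rw [h', evC_nil] at hC
        simp only [ih, evP_cons, hxy]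
        have : evC v x.2 • godel jet y.1 + evC v y.2 • godel jet y.1 = 0 := by
          rw [← add_smul, ← hC, zero_smul]
        rw [add_add_add_comm, this, zero_add]
      | cons c l =>
        rw [h'] at hC
        simp only [ih, evP_cons, hxy, hC, add_smul]
        abel

theorem evU_mergePairs : ∀ l, evU v (mergePairs l) = evU v l
  | [] => rfl
  | [_] => rfl
  | a :: b :: l => by
    rw [mergePairs, evU_cons, evU_mergePairs l, evP_mergeP, evU_cons, evU_cons, add_assoc]

theorem evP_mergeAll (n : ℕ) : ∀ l, evP v (mergeAll n l) = evU v l := by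
  induction n with
  | zero =>
    intro l
    rw [mergeAll]
    induction l with
    | nil => rfl
    | cons a l ih => rw [List.flatten_cons, evP_append, ih, evU_cons]
  | succ n ih =>
    intro l
    rcases l with _ | ⟨a, _ | ⟨b, l⟩⟩
    · rfl
    · simp [mergeAll]
    · rw [mergeAll, ih, evU_mergePairs]

theorem evP_norm (l : List Poly) : evP v (norm l) = evU v l := evP_mergeAll v _ l

theorem evP_mulT (n : ℕ) (c : Coef) (L : Poly) :
    evP v (mulT n c L) = evC v c • (godel jet n * evP v L) := by
  induction L with
  | nil => simp [mulT]
  | cons x L ih =>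
    have e : mulT n c (x :: L) = (n * x.1, mulC c x.2) :: mulT n c L := rfl
    rw [e, evP_cons, ih, evP_cons, evC_mulC, godel_mul, mul_add, smul_add, mul_smul_comm, smul_smul]

theorem evP_smulP (c : ℤ) (L : Poly) : evP v (smulP c L) = (c : ℂ) • evP v L := by
  induction L with
  | nil => simp [smulP]
  | cons x L ih =>
    have e : smulP c (x :: L) = (x.1, smulC c x.2) :: smulP c L := rfl
    rw [e, evP_cons, ih, evP_cons, evC_smulC, smul_add, smul_smul]

theorem evP_negP (L : Poly) : evP v (negP L) = -evP v L := by
  rw [negP, evP_smulP]; simp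

end eval

end
end DRHierarchy

namespace DRHierarchy
open Finset.HasAntidiagonal (antidiagonal)

noncomputable section

/-! ### Derivations of sparse polynomials -/

/-- A number `e ≤ fuel` such that `p ^ e` divides `n`, the largest one if `fuel` is large. -/
def mult (p : ℕ) : ℕ → ℕ → ℕ
  | 0, _ => 0
  | f + 1, n => match Nat.beq (Nat.mod n p) 0 with
    | true => Nat.succ (mult p f (Nat.div n p))
    | false => 0

/-- Divisibility is all that correctness needs: factors missed for lack of fuel are still accounted
for at the end of each table of primes. -/
theorem pow_mult_dvd (p f n : ℕ) : p ^ mult p f n ∣ n := by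
  induction f generalizing n with
  | zero => simp [mult]
  | succ f ih =>
    rw [mult]
    cases h : Nat.beq (Nat.mod n p) 0
    · simp
    · have hd : p ∣ n := Nat.dvd_of_mod_eq_zero (Nat.eq_of_beq_eq_true h)
      obtain ⟨m, hm⟩ := hd
      rcases Nat.eq_zero_or_pos p with rfl | hp
      · simp at hm; simp [hm]
      · have : Nat.div n p = m := by rw [hm]; exact Nat.mul_div_cancel_left m hp
        show p ^ (mult p f (Nat.div n p) + 1) ∣ n
        rw [this, pow_succ', hm]
        exact Nat.mul_dvd_mul_left p (ih m)

def primes : List ℕ := [2, 3, 5, 7, 11, 13, 17, 19, 23, 29, 31, 37, 41, 43, 47, 53, 59, 61, 67, 71,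
  73, 79, 83, 89, 97]

theorem primes_spec : ∀ i < 25, (primes.getD i 0).Prime ∧ Nat.count Nat.Prime (primes.getD i 0) = i := by
  decide +kernel

/-- The terms of the image of a term under the derivation with values `T_p` at the variable of
the prime `p`, which are looked up in a table. -/
def derivT (slow : ℕ → Poly) (n : ℕ) (c : Coef) : List (ℕ × Poly) → ℕ → List Poly
  | [], r => match Nat.beq r 1 with
    | true => []
    | false => r.primeFactorsList.map fun p => mulT (Nat.div n p) c (slow p)
  | x :: tab, r => match Nat.beq r 1 with
    | true => []
    | false => match mult x.1 30 r with
      | 0 => derivT slow n c tab r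
      | 1 => mulT (Nat.div n x.1) c x.2 :: derivT slow n c tab (Nat.div r x.1)
      | e + 1 => mulT (Nat.div n x.1) (smulC (Int.ofNat (e + 1)) c) x.2 ::
          derivT slow n c tab (Nat.div r (Nat.pow x.1 (e + 1)))

/-- The values of a derivation at the variables, together with a table of the first values. -/
structure Table where
  slow : ℕ → Poly
  tab : List (ℕ × Poly)

def deriv (T : Table) (L : Poly) : List Poly := L.flatMap fun t => derivT T.slow t.1 t.2 T.tab t.1

/-- The table of a function. -/
def mkTable (f : ℕ → Poly) (l : List Poly) : Table := ⟨fun p => f (primeIndex p), List.zip primes l⟩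

def seqK {α : Type} (f : ℕ → α → α) (a : α) : ℕ → α
  | 0 => a
  | k + 1 => f k (seqK f a k)

def iterK {α : Type} (f : ℕ → α → α) : ℕ → ℕ → α → List α
  | 0, _, _ => []
  | n + 1, k, a => a :: iterK f n (k + 1) (f k a)

theorem iterK_eq {α : Type} (f : ℕ → α → α) (a : α) (n k : ℕ) :
    iterK f n k (seqK f a k) = (List.range' k n).map (seqK f a) := by
  induction n generalizing k with
  | zero => rfl
  | succ n ih => rw [iterK, List.range'_succ, List.map_cons, ← ih]; rfl

section eval
variable (v : ℕ → ℂ)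

/-- The table has the values `T`. -/
structure Table.Holds (tb : Table) (T : ℕ → DiffPoly) : Prop where
  slow : ∀ p, p.Prime → evP v (tb.slow p) = T (primeIndex p + 1)
  tab : ∀ x ∈ tb.tab, x.1.Prime ∧ evP v x.2 = T (primeIndex x.1 + 1)

variable {v}

theorem mkTable_holds {f : ℕ → Poly} {l : List Poly} {n : ℕ} {T : ℕ → DiffPoly}
    (hl : l = (List.range n).map f) (hf : ∀ i, evP v (f i) = T (i + 1)) :
    (mkTable f l).Holds v T where
  slow p _ := hf _
  tab x hx := by
    obtain ⟨i, hi, rfl⟩ := List.mem_iff_getElem.mp hx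
    have hi' := hi
    simp only [mkTable, hl, List.length_zip, List.length_map, List.length_range, lt_min_iff] at hi'
    have h1 : i < 25 := hi'.1
    have h := primes_spec i h1
    have e : primes.getD i 0 = primes[i]'hi'.1 := by
      rw [List.getD_eq_getElem?_getD, List.getElem?_eq_getElem hi'.1]; rfl
    rw [e] at h
    simp only [mkTable, List.getElem_zip, hl, List.getElem_map, List.getElem_range]
    refine ⟨h.1, ?_⟩
    rw [primeIndex, h.2, hf]

/-- While `n` stays fixed, `r` carries the prime factors not yet differentiated; peeling off a prime
power splits the Leibniz sum. Primes outside the table reach the slow branch, so no bound on the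
monomials is required. -/
theorem evU_derivT {tb : Table} {T : ℕ → DiffPoly} (hT : tb.Holds v T) (n : ℕ) (c : Coef)
    (r : ℕ) (hr : r ≠ 0) :
    evU v (derivT tb.slow n c tb.tab r) = evC v c • primeSum T n r := by
  obtain ⟨slow, tab⟩ := tb
  have h1 := hT.slow
  have h2 := hT.tab
  simp only at h1 h2 ⊢
  clear hT
  induction tab generalizing r with
  | nil =>
    rw [derivT]
    cases h : Nat.beq r 1
    · have : ∀ l : List ℕ, (∀ p ∈ l, p.Prime) →
          evU v (l.map fun p => mulT (Nat.div n p) c (slow p)) =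
          evC v c • (l.map fun p => godel jet (n / p) * T (primeIndex p + 1)).sum := by
        intro l hl
        induction l with
        | nil => simp
        | cons p l ih =>
          rw [List.map_cons, evU_cons, ih (fun q hq => hl q (by simp [hq])), evP_mulT,
            h1 p (hl p (by simp)), List.map_cons, List.sum_cons, smul_add]
          rfl
      exact this _ fun p hp => Nat.prime_of_mem_primeFactorsList hp
    · rw [Nat.eq_of_beq_eq_true h]; simp [primeSum]
  | cons x tab ih =>
    have hx := h2 x (by simp)
    have ih := fun r hr => ih r hr (fun y hy => h2 y (by simp [hy]))
    rw [derivT]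
    cases h : Nat.beq r 1
    · have hd := pow_mult_dvd x.1 30 r
      have key : ∀ e : ℕ, x.1 ^ e ∣ r → evC v c • primeSum T n r =
          (evC v c * e) • (godel jet (n / x.1) * T (primeIndex x.1 + 1)) +
          evU v (derivT slow n c tab (r / x.1 ^ e)) := by
        rintro e ⟨s, hs⟩
        have hp : x.1 ^ e ≠ 0 := pow_ne_zero _ hx.1.ne_zero
        have hs0 : s ≠ 0 := by rintro rfl; exact hr (by simp [hs])
        rw [hs, Nat.mul_div_cancel_left s (Nat.pos_of_ne_zero hp), ih s hs0,
          primeSum_mul _ _ hp hs0, primeSum_prime_pow _ _ hx.1, smul_add, smul_smul]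
      rcases hm : mult x.1 30 r with _ | _ | e
      · exact ih r hr
      · rw [hm] at hd
        rw [key _ hd, zero_add, pow_one]
        show evP v (mulT (n / x.1) c x.2) + evU v (derivT slow n c tab (r / x.1)) = _
        rw [evP_mulT, hx.2]
        simp
      · rw [hm] at hd
        rw [key _ hd]
        show evP v (mulT (n / x.1) _ x.2) + _ = _
        rw [evP_mulT, hx.2, evC_smulC, mul_comm (evC v c)]
        rfl
    · rw [Nat.eq_of_beq_eq_true h]; simp [primeSum]

theorem evU_derivT_zero (slow : ℕ → Poly) (c : Coef) (tab : List (ℕ × Poly)) (r : ℕ) :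
    evU v (derivT slow 0 c tab r) = 0 := by
  have h0 : ∀ p, Nat.div 0 p = 0 := Nat.zero_div
  induction tab generalizing r with
  | nil =>
    rw [derivT]
    cases Nat.beq r 1
    · show evU v (r.primeFactorsList.map _) = 0
      induction r.primeFactorsList with
      | nil => rfl
      | cons p l ih => rw [List.map_cons, evU_cons, ih, evP_mulT, h0]; simp
    · rfl
  | cons x tab ih =>
    rw [derivT]
    cases Nat.beq r 1
    · rcases mult x.1 30 r with _ | _ | e
      · exact ih r
      · show evP v _ + evU v _ = 0
        rw [ih, evP_mulT, h0]; simp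
      · show evP v _ + evU v _ = 0
        rw [ih, evP_mulT, h0]; simp
    · rfl

theorem evU_deriv {tb : Table} {T : ℕ → DiffPoly} (hT : tb.Holds v T) (L : Poly) :
    evU v (deriv tb L) = evo T (evP v L) := by
  induction L with
  | nil => simp [deriv]
  | cons t L ih =>
    have e : deriv tb (t :: L) = derivT tb.slow t.1 t.2 tb.tab t.1 ++ deriv tb L := rfl
    rw [e, evU_append, ih, evP_cons, map_add]
    congr 1
    rw [Derivation.map_smul]
    rcases eq_or_ne t.1 0 with h | h
    · rw [h, evU_derivT_zero]; simp
    · rw [evU_derivT hT _ _ _ h, evo_godel _ h]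

/-! ### `∂_x` and partial derivatives -/

theorem evP_single (n : ℕ) : evP v [(n, [(1, 1)])] = godel jet n := by simp

theorem godel_jet_nth (i : ℕ) : godel jet (Nat.nth Nat.Prime i) = u (i + 1) := by
  rw [godel_prime _ (Nat.prime_nth_prime i), jet, primeIndex_nth]

/-- The prime with index `i`. -/
def prime (i : ℕ) : ℕ := primes.getD i (Nat.nth Nat.Prime i)

theorem prime_eq (i : ℕ) : prime i = Nat.nth Nat.Prime i := by
  by_cases h : i < 25
  · have h1 := primes_spec i h
    have h2 : prime i = primes.getD i 0 := by
      rw [prime, List.getD_eq_getElem?_getD, List.getD_eq_getElem?_getD,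
        List.getElem?_eq_getElem (show i < primes.length from h)]
      rfl
    rw [h2, ← nth_primeIndex h1.1, primeIndex, h1.2]
  · rw [prime, List.getD_eq_default]
    exact Nat.le_of_not_lt h

def dxTable : Table := mkTable (fun i => [(prime (i + 1), [(1, 1)])])
  ((List.range 24).map fun i => [(prime (i + 1), [(1, 1)])])

theorem dxTable_holds : dxTable.Holds v (fun k => u (k + 1)) :=
  mkTable_holds rfl fun i => by rw [evP_single, prime_eq, godel_jet_nth]

def dxP (L : Poly) : Poly := norm (deriv dxTable L)

theorem evP_dxP (L : Poly) : evP v (dxP L) = dx (evP v L) := by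
  rw [dxP, evP_norm, evU_deriv dxTable_holds]; rfl

def partTable (i : ℕ) : Table := mkTable (fun j => bif Nat.beq i j then [(1, [(1, 1)])] else [])
  ((List.range 25).map fun j => bif Nat.beq i j then [(1, [(1, 1)])] else [])

theorem partTable_holds (i : ℕ) : (partTable i).Holds v (Pi.single (i + 1) 1) :=
  mkTable_holds rfl fun j => by
    rw [Pi.single_apply]
    cases h : Nat.beq i j
    · rw [if_neg]
      · rfl
      · have := Nat.ne_of_beq_eq_false h; omega
    · have := Nat.eq_of_beq_eq_true h
      rw [if_pos (by omega), cond_true, evP_single, godel_one]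

/-! ### Operations on densities -/

def addU : DensU → DensU → DensU
  | [], b => b
  | x :: a, [] => x :: a
  | x :: a, y :: b => (x ++ y) :: addU a b

def normD (F : DensU) : DensL := F.map norm

def toU (F : DensL) : DensU := F.map fun f => [f]

def ddx (F : DensL) : DensL := normD (addU (F.map fun f => deriv dxTable f) ([] :: toU F))

def mulD (P : Poly) (F : DensL) : DensU := F.map fun f => P.map fun t => mulT t.1 t.2 f

theorem evDU_addU : ∀ a b, evDU v (addU a b) = evDU v a + evDU v b
  | [], b => by simp [addU]
  | x :: a, [] => by simp [addU]
  | x :: a, y :: b => by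
    rw [addU, evDU_cons, evDU_addU a b, evU_append, Finsupp.single_add, map_add, evDU_cons,
      evDU_cons]
    abel

theorem evD_normD (F : DensU) : evD v (normD F) = evDU v F := by
  induction F with
  | nil => rfl
  | cons f F ih =>
    show Finsupp.single 0 (evP v (norm f)) + shiftDens (evD v (normD F)) = _
    rw [ih, evP_norm]; rfl

theorem evDU_toU (F : DensL) : evDU v (toU F) = evD v F := by
  induction F with
  | nil => rfl
  | cons f F ih =>
    show Finsupp.single 0 (evU v [f]) + shiftDens (evDU v (toU F)) = _
    rw [ih]; simp

theorem evoDens_shiftDens (T : ℕ → DiffPoly) (G : Dens) :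
    evoDens T (shiftDens G) = shiftDens (evoDens T G) := by
  simp only [evoDens, shiftDens, Finsupp.mapRange.linearMap_apply, Finsupp.lmapDomain_apply]
  exact (Finsupp.mapDomain_mapRange Nat.succ G _ (map_zero _) (map_add _)).symm

theorem evoDens_single (T : ℕ → DiffPoly) (k : ℕ) (f : DiffPoly) :
    evoDens T (Finsupp.single k f) = Finsupp.single k (evo T f) :=
  Finsupp.mapRange_single (hf := map_zero (evo T))

theorem dxDens_shiftDens (G : Dens) : dxDens (shiftDens G) = shiftDens (dxDens G) := by
  rw [dxDens_eq, dxDens_eq, evoDens_shiftDens, map_add]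

theorem evDU_map_deriv {tb : Table} {T : ℕ → DiffPoly} (hT : tb.Holds v T) (F : DensL) :
    evDU v (F.map (deriv tb)) = evoDens T (evD v F) := by
  induction F with
  | nil => simp
  | cons f F ih =>
    rw [List.map_cons, evDU_cons, ih, evU_deriv hT, evD_cons, map_add, evoDens_shiftDens,
      evoDens_single]

theorem evD_ddx (F : DensL) : evD v (ddx F) = dxDens (evD v F) := by
  rw [ddx, evD_normD, evDU_addU, evDU_cons, evU_nil, Finsupp.single_zero, zero_add, evDU_toU,
    dxDens_eq]
  congr 1
  exact evDU_map_deriv dxTable_holds F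

theorem evDU_mulD (P : Poly) (F : DensL) : evDU v (mulD P F) = evP v P • evD v F := by
  have h : ∀ f, evU v (P.map fun t => mulT t.1 t.2 f) = evP v P * evP v f := by
    intro f
    induction P with
    | nil => simp
    | cons t P ih => rw [List.map_cons, evU_cons, ih, evP_mulT, evP_cons, add_mul, smul_mul_assoc]
  induction F with
  | nil => simp [mulD]
  | cons f F ih =>
    show Finsupp.single 0 (evU v _) + shiftDens (evDU v (mulD P F)) = _
    rw [ih, h, evD_cons, smul_add, Finsupp.smul_single, smul_eq_mul, shiftDens_smul]

theorem evD_map_neg (F : DensL) : evD v (F.map negP) = -evD v F := by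
  induction F with
  | nil => simp
  | cons f F ih => rw [List.map_cons, evD_cons, ih, evP_negP, evD_cons, map_neg, neg_add,
      Finsupp.single_neg]

/-! ### The variational derivative -/

/-- `δ/δu` of a differential polynomial in `u_1, …, u_n`. -/
def eulerL (n : ℕ) (P : Poly) : DensL :=
  (List.range n).foldr
    (fun i F => (ddx (normD (addU [deriv (partTable i) P] (toU F)))).map negP) []

def stripAll : List ℕ → ℕ → ℕ
  | [], r => r
  | p :: ps, r => stripAll ps (Nat.div r (Nat.pow p (mult p 30 r)))

/-- Whether the polynomial involves only `u_1, …, u_n`. -/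
def covers (n : ℕ) (P : Poly) : Bool :=
  P.all fun t => Nat.beq (stripAll (primes.take n) t.1) 1

theorem mem_of_stripAll {ps : List ℕ} {r q : ℕ} (hps : ∀ p ∈ ps, p.Prime) (h : stripAll ps r = 1)
    (hq : q.Prime) (hqr : q ∣ r) : q ∈ ps := by
  induction ps generalizing r with
  | nil =>
    rw [stripAll] at h
    subst h
    exact absurd (Nat.dvd_one.mp hqr) hq.one_lt.ne'
  | cons p ps ih =>
    obtain ⟨s, hs⟩ := pow_mult_dvd p 30 r
    have hp : 0 < p ^ mult p 30 r := Nat.pow_pos (hps p (by simp)).pos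
    have e : Nat.div r (Nat.pow p (mult p 30 r)) = s := by
      show r / p ^ mult p 30 r = s
      conv_lhs => rw [hs]
      rw [← hs]
      exact Nat.div_eq_of_eq_mul_right hp hs
    rw [stripAll, e] at h
    rw [hs] at hqr
    rcases (hq.dvd_mul).mp hqr with h1 | h1
    · have := hq.dvd_of_dvd_pow h1
      rw [(Nat.prime_dvd_prime_iff_eq hq (hps p (by simp))).mp this]; simp
    · exact List.mem_cons_of_mem _ (ih (fun p hp => hps p (by simp [hp])) h h1)

theorem partialU_evP_eq_zero {n : ℕ} {P : Poly} (hP : covers n P = true) {k : ℕ}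
    (hk : k = 0 ∨ n < k) : partialU k (evP v P) = 0 := by
  rw [partialU_eq_evo]
  rw [covers, List.all_eq_true] at hP
  induction P with
  | nil => simp
  | cons t P ih =>
    rw [evP_cons, map_add, ih (fun x hx => hP x (by simp [hx])), add_zero, Derivation.map_smul]
    rcases eq_or_ne t.1 0 with h | h
    · rw [h]; simp
    rw [evo_godel _ h, primeSum, List.sum_eq_zero, smul_zero]
    intro x hx
    obtain ⟨p, hp, rfl⟩ := List.mem_map.mp hx
    rw [Pi.single_apply, if_neg, mul_zero]
    intro hpk
    rcases hk with rfl | hk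
    · omega
    have hs : ∀ q ∈ primes.take n, q.Prime ∧ primeIndex q < n := by
      intro q hq
      obtain ⟨i, hi, rfl⟩ := List.mem_iff_getElem.mp hq
      rw [List.length_take] at hi
      have hi' : i < primes.length := lt_of_lt_of_le hi (min_le_right _ _)
      have h := primes_spec i hi'
      rw [List.getD_eq_getElem?_getD, List.getElem?_eq_getElem hi'] at h
      rw [List.getElem_take]
      exact ⟨h.1, by rw [primeIndex]; erw [h.2]; exact lt_of_lt_of_le hi (min_le_left _ _)⟩
    have h1 := mem_of_stripAll (fun q hq => (hs q hq).1)
      (Nat.eq_of_beq_eq_true (hP t (by simp))) (Nat.prime_of_mem_primeFactorsList hp)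
      (Nat.dvd_of_mem_primeFactorsList hp)
    have := (hs p h1).2
    omega

/-- The sum `∑ (-∂_x)^k f_k` is evaluated in Horner form. The term `k = 0` is absent because the
encoded polynomials do not contain `u`. -/
theorem evD_eulerL {n : ℕ} {P : Poly} (hP : covers n P = true) :
    evD v (eulerL n P) = euler (evP v P) := by
  have key : ∀ l : List ℕ, evD v (l.foldr
      (fun i F => (ddx (normD (addU [deriv (partTable i) P] (toU F)))).map negP) []) =
      l.foldr (fun i F => (-dxDens) (Finsupp.single 0 (partialU (i + 1) (evP v P)) + F)) 0 := by
    intro l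
    induction l with
    | nil => rfl
    | cons i l ih =>
      rw [List.foldr_cons, evD_map_neg, evD_ddx, evD_normD, evDU_addU, evDU_toU, ih, evDU_cons,
        evU_deriv (partTable_holds i), evDU_nil, map_zero, add_zero, ← partialU_eq_evo]
      rfl
  have key' : ∀ n a (f : ℕ → Dens), (List.range' a n).foldr (fun i F => (-dxDens) (f i + F)) 0 =
      ∑ k ∈ Finset.range n, ((-dxDens) ^ (k + 1)) (f (a + k)) := by
    intro n
    induction n with
    | zero => intro a f; rfl
    | succ n ih =>
      intro a f
      rw [List.range'_succ, List.foldr_cons, ih, Finset.sum_range_succ', map_add, map_sum, add_comm]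
      congr 1
      · refine Finset.sum_congr rfl fun k _ => ?_
        rw [pow_succ' (-dxDens) (k + 1), Module.End.mul_apply, add_right_comm, add_assoc]
  rw [eulerL, key, List.range_eq_range', key', euler,
    varU₀_single (N := n + 1) (fun k hk => partialU_evP_eq_zero hP (Or.inr hk)),
    Finset.sum_range_succ', partialU_evP_eq_zero hP (Or.inl rfl)]
  simp

end eval

end
end DRHierarchy

namespace DRHierarchy
open Finset.HasAntidiagonal (antidiagonal)

noncomputable section

/-! ### The twisted recursion for sparse polynomials -/

/-- The action of a term of an evolutionary equation on densities. -/
structure Ent where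
  P : Poly
  T : Table
  U : List DensL
  slowU : ℕ → DensL

/-- For `T_k = ∂_x^k(u u_1) - u u_{k+1}` one has `T_{k+1} = ∂_x T_k + u_1 u_{k+1}` with `T_0 = 0`;
the number `2 * prime k` encodes the added monomial. The encoding has no number for `u`, which is
why `u ∂_x` is subtracted before computing. -/
def t0Step (k : ℕ) (T : Poly) : Poly := norm ([(Nat.mul 2 (prime k), [(1, 1)])] :: deriv dxTable T)

/-- For `V_k = ∂_x^k(-u θ_1) + u θ_{k+1}` one has `V_{k+1} = ∂_x V_k - u_1 θ_{k+1}` with `V_0 = 0`.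
-/
def v0Step (k : ℕ) (V : DensL) : DensL :=
  normD (addU (toU (ddx V)) (List.replicate (k + 1) [] ++ [[[(2, [(1, -1)])]]]))

/-- The difference of the flow of `u u_1` and `u ∂_x`. -/
def ent0 (n : ℕ) : Ent where
  P := []
  T := mkTable (fun i => seqK t0Step [] (i + 1)) (iterK t0Step n 1 (t0Step 0 []))
  U := iterK v0Step n 0 []
  slowU := seqK v0Step []

def entP (n : ℕ) (P : Poly) : Ent where
  P := P
  T := mkTable (fun i => seqK (fun _ => dxP) P (i + 1)) (iterK (fun _ => dxP) n 1 (dxP P))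
  U := iterK (fun _ => ddx) n 0 (eulerL n P)
  slowU := seqK (fun _ => ddx) (eulerL n P)

def lin : DensL → List DensL → DensU
  | g :: G, V :: U => match g with
    | [] => lin G U
    | x :: g => addU (mulD (negP (x :: g)) V) (lin G U)
  | _, _ => []

def br (e : Ent) (G : DensL) : DensU :=
  addU (G.map (deriv e.T)) (match Nat.ble G.length e.U.length with
    | true => lin G e.U
    | false => lin G ((List.range G.length).map e.slowU))

def omega : List ℕ → ℕ → ℕ
  | [], r => match Nat.beq r 1 with
    | true => 0
    | false => r.primeFactorsList.length
  | p :: ps, r => match Nat.beq r 1 with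
    | true => 0
    | false => match mult p 30 r with
      | 0 => omega ps r
      | e + 1 => Nat.add (e + 1) (omega ps (Nat.div r (Nat.pow p (e + 1))))

def countD (s n : ℕ) : ℕ := Nat.add (omega primes n) s

structure Sys where
  e0 : Ent
  es : List Ent

def mkSys (n : ℕ) (Ps : List Poly) : Sys := ⟨ent0 n, Ps.map (entP n)⟩

def dTerm (s : ℕ) (W : DensL) : DensU := W.map fun f =>
  [f.map fun t => (Nat.mul 2 t.1, smulC (Int.neg (Int.ofNat (countD (s + 1) t.1))) t.2)]

/-- Densities of step `j` are stored multiplied by `N^j`, which keeps them integral; the densities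
two steps back therefore carry an extra factor `N`. In the product with `P - u u_1` only positive
orders of the equation are left. -/
def rhs (S : Sys) (N : ℕ) (W W' : List DensL) (s : ℕ) : DensU :=
  addU (addU (br S.e0 (W.getD s [])) (dTerm s (W.getD s [])))
    ((List.range s).foldr (fun a F => (fun e : Ent => match e.P with
      | [] => F
      | x :: P => addU (addU (br e (W.getD (s - a - 1) []))
          (mulD (smulP (Int.ofNat N) (x :: P)) (W'.getD (s - a - 1) []))) F)
      (S.es.getD a (entP 0 []))) [])

/-- Division by `∂_x` from the highest `θ_k` downwards. The second component is the pending
coefficient; at the end it is the remainder at `θ_0`, the obstruction. -/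
def dinv (G : DensU) : DensL × Poly :=
  G.foldr (fun g r => (r.2 :: r.1, norm (negP (dxP r.2) :: g))) ([], [])

def divD (N s : ℕ) (F : DensL) : DensL := F.map fun f => f.map fun t =>
  (t.1, smulC (Int.ofNat (Nat.div N (countD s t.1))) t.2)

-- A term of eigenvalue zero is rejected when `N ≠ 0`, because `N mod 0 = N`.
def okD (N s : ℕ) (F : DensL) : Bool := F.all fun f => f.all fun t =>
  Nat.beq (Nat.mod N (countD s t.1)) 0

def dropZeros : DensL → DensL
  | [] => []
  | a :: l => match dropZeros l, a with
    | [], [] => []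
    | l', a => a :: l'

def cell (N s : ℕ) (x : DensL × Poly) : DensL × Poly × Bool :=
  (dropZeros (divD N s x.1), x.2, okD N s x.1)

def step (S : Sys) (N n : ℕ) (W W' : List DensL) : List (DensL × Poly × Bool) :=
  (List.range n).map fun s => cell N s (dinv (rhs S N W W' s))

def run (S : Sys) (N n : ℕ) : ℕ → List DensL → List DensL → List (List (DensL × Poly × Bool))
  | 0, _, _ => []
  | j + 1, W, W' => (fun r => r :: run S N n j (r.map fun x => x.1) W) (step S N n W W')

def W0 : List DensL := [[[], [(1, [(1, -1)])]]]

/-- The densities obtained after `j` steps and before the last step. -/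
def state (S : Sys) (N n : ℕ) : ℕ → List DensL × List DensL
  | 0 => (W0, [])
  | j + 1 => ((step S N n (state S N n j).1 (state S N n j).2).map fun x => x.1, (state S N n j).1)

theorem run_eq (S : Sys) (N n j k : ℕ) : run S N n k (state S N n j).1 (state S N n j).2 =
    (List.range' j k).map fun i => step S N n (state S N n i).1 (state S N n i).2 := by
  induction k generalizing j with
  | zero => rfl
  | succ k ih => rw [List.range'_succ, List.map_cons, ← ih (j + 1)]; rfl

/-- Whether all divisions in the run are exact and the densities start in order one. -/
def okRun (J : ℕ) (r : List (List (DensL × Poly × Bool))) : Bool :=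
  (r.take J).all fun l => l.all (fun x => x.2.2) && (l.getD 0 ([], [], true)).1.isEmpty

/-! ### Correctness of the computed recursion -/

section eval
variable {v : ℕ → ℂ}

theorem range'_one_map {α : Type} (f : ℕ → α) (n : ℕ) :
    (List.range' 1 n).map f = (List.range n).map fun i => f (i + 1) := by
  rw [List.range'_eq_map_range, List.map_map]
  exact List.map_congr_left fun i _ => by simp [add_comm]

/-- The entry represents the action of `T` and `V`. -/
structure Ent.Holds (v : ℕ → ℂ) (e : Ent) (T : ℕ → DiffPoly) (V : ℕ → Dens) : Prop where
  T : e.T.Holds v T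
  U : e.U = (List.range e.U.length).map e.slowU
  slowU : ∀ k, evD v (e.slowU k) = V k

theorem jet_two : godel jet 2 = u 1 := by
  have h : primeIndex 2 = 0 := (primes_spec 0 (by norm_num)).2
  rw [godel_prime _ Nat.prime_two, jet, h]

theorem iterK_zero_eq {α : Type} (f : ℕ → α → α) (a : α) (n : ℕ) :
    iterK f n 0 a = (List.range (iterK f n 0 a).length).map (seqK f a) := by
  have h := iterK_eq f a n 0
  rw [show seqK f a 0 = a from rfl] at h
  rw [h, List.length_map, List.length_range', List.range_eq_range']

theorem evP_t0 (k : ℕ) :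
    evP v (seqK t0Step [] k) = dx^[k] (u 0 * u 1) - u 0 * u (k + 1) := by
  induction k with
  | zero => simp [seqK]
  | succ k ih =>
    have h : godel jet (Nat.mul 2 (prime k)) = u 1 * u (k + 1) := by
      show godel jet (2 * prime k) = _
      rw [godel_mul, jet_two, prime_eq, godel_jet_nth]
    rw [seqK, t0Step, evP_norm, evU_cons, evP_single, h, evU_deriv dxTable_holds, ih,
      ← dx_eq_evo, Function.iterate_succ_apply', map_sub, Derivation.leibniz, dx_u, dx_u]
    simp only [smul_eq_mul]
    ring

theorem evDU_replicate (k : ℕ) (F : DensU) :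
    evDU v (List.replicate k [] ++ F) = shiftDens^[k] (evDU v F) := by
  induction k with
  | zero => rfl
  | succ k ih =>
    rw [List.replicate_succ, List.cons_append, evDU_cons, ih, Function.iterate_succ_apply']
    simp

theorem iterate_shiftDens_single (k j : ℕ) (f : DiffPoly) :
    shiftDens^[k] (Finsupp.single j f) = Finsupp.single (j + k) f := by
  induction k with
  | zero => rfl
  | succ k ih => rw [Function.iterate_succ_apply', ih, shiftDens_single, add_assoc]

theorem evD_v0 (k : ℕ) : evD v (seqK v0Step [] k) =
    dxDens^[k] (euler (u 0 * u 1)) + Finsupp.single (k + 1) (u 0) := by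
  induction k with
  | zero => simp [seqK, euler_u_mul_u_one]
  | succ k ih =>
    have h : evDU v [[[(2, [(1, -1)])]]] = Finsupp.single 0 (-u 1) := by
      simp [evDU, evU, jet_two]
    rw [seqK, v0Step, evD_normD, evDU_addU, evDU_toU, evD_ddx, ih, evDU_replicate, h,
      iterate_shiftDens_single, map_add, dxDens_single, dx_u, Function.iterate_succ_apply',
      zero_add (k + 1), Finsupp.single_neg]
    have key : ∀ {M : Type} [AddCommGroup M] (a b c : M), a + (b + c) + -b = a + c := by
      intros; abel
    exact key _ _ _

theorem ent0_holds (n : ℕ) : (ent0 n).Holds v (fun k => dx^[k] (u 0 * u 1) - u 0 * u (k + 1))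
    (fun k => dxDens^[k] (euler (u 0 * u 1)) + Finsupp.single (k + 1) (u 0)) where
  T := mkTable_holds (n := n) (by
    rw [← range'_one_map (seqK t0Step []), ← iterK_eq]) fun i => evP_t0 _
  U := iterK_zero_eq _ _ _
  slowU := evD_v0

theorem entP_holds (n : ℕ) (P : Poly) (hP : covers n P = true) :
    (entP n P).Holds v (fun k => dx^[k] (evP v P)) (fun k => dxDens^[k] (euler (evP v P))) where
  T := mkTable_holds (n := n) (T := fun k => dx^[k] (evP v P)) (by
      rw [← range'_one_map (seqK (fun _ => dxP) P), ← iterK_eq]) (by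
    intro i
    have h : ∀ i, evP v (seqK (fun _ => dxP) P i) = dx^[i] (evP v P) := by
      intro i
      induction i with
      | zero => rfl
      | succ i ih => rw [seqK, evP_dxP, ih, Function.iterate_succ_apply']
    exact h _)
  U := iterK_zero_eq _ _ _
  slowU k := by
    show evD v (seqK _ _ k) = _
    induction k with
    | zero => exact evD_eulerL hP
    | succ k ih => rw [seqK, evD_ddx, ih, Function.iterate_succ_apply']

theorem linearCombination_shiftDens (V : ℕ → Dens) (G : Dens) :
    Finsupp.linearCombination DiffPoly V (shiftDens G) =
      Finsupp.linearCombination DiffPoly (fun k => V (k + 1)) G := by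
  rw [shiftDens, Finsupp.lmapDomain_apply, Finsupp.linearCombination_mapDomain]
  rfl

theorem evDU_lin (G : DensL) (V : ℕ → Dens) (U : List DensL) (hU : U.map (evD v) =
    (List.range U.length).map V) (hG : G.length ≤ U.length) :
    evDU v (lin G U) = -Finsupp.linearCombination DiffPoly V (evD v G) := by
  induction G generalizing V U with
  | nil => rcases U with _ | ⟨V, U⟩ <;> simp [lin]
  | cons g G ih =>
    rcases U with _ | ⟨V0, U⟩
    · simp at hG
    rw [List.length_cons, List.range_succ_eq_map, List.map_cons, List.map_cons, List.cons.injEq,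
      List.map_map] at hU
    have ih := ih (fun k => V (k + 1)) U hU.2 (by simpa using hG)
    rw [evD_cons, map_add, Finsupp.linearCombination_single, linearCombination_shiftDens, neg_add,
      ← ih, ← hU.1]
    rcases g with _ | ⟨x, g⟩
    · simp [lin]
    · rw [lin, evDU_addU, evDU_mulD, evP_negP, neg_smul]

theorem evDU_br {e : Ent} {T : ℕ → DiffPoly} {V : ℕ → Dens} (he : e.Holds v T V) (G : DensL) :
    evDU v (br e G) = act T V (evD v G) := by
  rw [br, evDU_addU, evDU_map_deriv he.T, act, sub_eq_add_neg]
  congr 1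
  have h : ∀ l : List ℕ, (l.map e.slowU).map (evD v) = l.map V := by
    intro l
    rw [List.map_map]
    exact List.map_congr_left fun k _ => he.slowU k
  cases hb : Nat.ble G.length e.U.length
  · exact evDU_lin _ _ _ (by rw [h]; simp) (by simp)
  · refine evDU_lin _ _ _ ?_ (Nat.le_of_ble_eq_true hb)
    conv_lhs => rw [he.U]
    exact h _

theorem primes_prime : ∀ p ∈ primes, p.Prime := by
  intro p hp
  obtain ⟨i, hi, rfl⟩ := List.mem_iff_getElem.mp hp
  have h := primes_spec i hi
  rw [List.getD_eq_getElem?_getD, List.getElem?_eq_getElem hi] at h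
  exact h.1

theorem omega_eq {ps : List ℕ} (hps : ∀ p ∈ ps, p.Prime) {r : ℕ} (hr : r ≠ 0) :
    omega ps r = r.primeFactorsList.length := by
  induction ps generalizing r with
  | nil =>
    rw [omega]
    cases h : Nat.beq r 1
    · rfl
    · rw [Nat.eq_of_beq_eq_true h]; simp
  | cons p ps ih =>
    have ih := fun r hr => ih (fun q hq => hps q (by simp [hq])) (r := r) hr
    rw [omega]
    cases h : Nat.beq r 1
    · rcases hm : mult p 30 r with _ | e
      · exact ih r hr
      · obtain ⟨s, hs⟩ := pow_mult_dvd p 30 r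
        rw [hm] at hs
        have hp := hps p (by simp)
        have hpe : p ^ (e + 1) ≠ 0 := pow_ne_zero _ hp.ne_zero
        have hs0 : s ≠ 0 := by rintro rfl; exact hr (by simp [hs])
        show e + 1 + omega ps (r / p ^ (e + 1)) = _
        rw [hs, Nat.mul_div_cancel_left s (Nat.pos_of_ne_zero hpe), ih s hs0,
          (Nat.perm_primeFactorsList_mul hpe hs0).length_eq, List.length_append,
          hp.primeFactorsList_pow, List.length_replicate]
    · rw [Nat.eq_of_beq_eq_true h]; simp

theorem countU_godel (n : ℕ) :
    countU (godel jet n) = (omega primes n : ℂ) • godel jet n := by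
  rcases eq_or_ne n 0 with rfl | hn
  · simp
  rw [omega_eq primes_prime hn, countU_eq_evo, evo_godel _ hn, primeSum]
  have h : ∀ p ∈ n.primeFactorsList, godel jet (n / p) * u (primeIndex p + 1) = godel jet n := by
    intro p hp
    have hp' := Nat.prime_of_mem_primeFactorsList hp
    have : u (primeIndex p + 1) = godel jet p := (godel_prime jet hp').symm
    rw [this, ← godel_mul, Nat.div_mul_cancel (Nat.dvd_of_mem_primeFactorsList hp)]
  rw [List.map_congr_left h, List.map_const', List.sum_replicate, Nat.cast_smul_eq_nsmul]

theorem evD_dm (s : ℕ) (F : DensL) : dm s (evD v F) =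
    evD v (F.map fun f => f.map fun t => (t.1, smulC (Int.ofNat (countD s t.1)) t.2)) := by
  have h : ∀ f : Poly, countU (evP v f) + (s : ℂ) • evP v f =
      evP v (f.map fun t => (t.1, smulC (Int.ofNat (countD s t.1)) t.2)) := by
    intro f
    induction f with
    | nil => simp
    | cons t f ih =>
      rw [List.map_cons, evP_cons, evP_cons, ← ih, map_add, Derivation.map_smul, countU_godel,
        evC_smulC, smul_add]
      have : ((Int.ofNat (countD s t.1) : ℤ) : ℂ) = omega primes t.1 + s := by
        simp [countD]
      rw [this, smul_smul, smul_smul, add_add_add_comm, ← add_smul]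
      congr 2
      ring
  induction F with
  | nil => simp
  | cons f F ih =>
    rw [List.map_cons, evD_cons, evD_cons, ← ih, map_add, ← h, dm_apply, evoDens_single,
      dm_apply, dm_apply, evoDens_shiftDens, map_add, map_smul, Finsupp.smul_single,
      ← Finsupp.single_add]
    rfl

theorem evDU_dTerm (s : ℕ) (W : DensL) :
    evDU v (dTerm s W) = -(u 1 • dm (s + 1) (evD v W)) := by
  rw [evD_dm]
  have h : ∀ f : Poly, evP v (f.map fun t =>
        (Nat.mul 2 t.1, smulC (Int.neg (Int.ofNat (countD (s + 1) t.1))) t.2)) =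
      -(u 1 * evP v (f.map fun t => (t.1, smulC (Int.ofNat (countD (s + 1) t.1)) t.2))) := by
    intro f
    induction f with
    | nil => simp
    | cons t f ih =>
      rw [List.map_cons, evP_cons, ih, List.map_cons, evP_cons, evC_smulC, evC_smulC]
      have e1 : godel jet (Nat.mul 2 t.1) = u 1 * godel jet t.1 := by
        rw [← jet_two, ← godel_mul]; rfl
      have e2 : ((Int.neg (Int.ofNat (countD (s + 1) t.1)) : ℤ) : ℂ) =
          -((Int.ofNat (countD (s + 1) t.1) : ℤ) : ℂ) := by
        rw [← Int.cast_neg]; rfl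
      rw [e1, e2, neg_mul, neg_smul, mul_add, mul_smul_comm, neg_add]
  induction W with
  | nil => simp [dTerm]
  | cons f W ih =>
    have e : dTerm s (f :: W) = [f.map fun t =>
      (Nat.mul 2 t.1, smulC (Int.neg (Int.ofNat (countD (s + 1) t.1))) t.2)] :: dTerm s W := rfl
    rw [e, evDU_cons, ih, evU_cons, evU_nil, add_zero, h, List.map_cons, evD_cons, smul_add,
      neg_add, Finsupp.smul_single, Finsupp.single_neg, smul_eq_mul, map_neg,
      shiftDens_smul]

theorem dm_divD {N s : ℕ} {F : DensL} (h : okD N s F = true) :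
    dm s (evD v (divD N s F)) = (N : ℂ) • evD v F := by
  have hf : ∀ f : Poly, (f.all fun t => Nat.beq (Nat.mod N (countD s t.1)) 0) = true →
      evP v ((f.map fun t => (t.1, smulC (Int.ofNat (Nat.div N (countD s t.1))) t.2)).map
        fun t => (t.1, smulC (Int.ofNat (countD s t.1)) t.2)) = (N : ℂ) • evP v f := by
    intro f hf
    induction f with
    | nil => simp
    | cons t f ih =>
      rw [List.all_cons, Bool.and_eq_true] at hf
      rw [List.map_cons, List.map_cons, evP_cons, ih hf.2, evC_smulC, evC_smulC, evP_cons, smul_add,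
        smul_smul, ← mul_assoc]
      have hd : N / countD s t.1 * countD s t.1 = N :=
        Nat.div_mul_cancel (Nat.dvd_of_mod_eq_zero (Nat.eq_of_beq_eq_true hf.1))
      have : ((Int.ofNat (countD s t.1) : ℤ) : ℂ) *
          ((Int.ofNat (Nat.div N (countD s t.1)) : ℤ) : ℂ) = N := by
        conv_rhs => rw [← hd]
        rw [mul_comm]
        push_cast
        rfl
      rw [this]
  rw [evD_dm]
  induction F with
  | nil => simp [divD]
  | cons f F ih =>
    rw [okD, List.all_cons, Bool.and_eq_true] at h
    have ih := ih h.2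
    have e : divD N s (f :: F) = (f.map fun t =>
      (t.1, smulC (Int.ofNat (Nat.div N (countD s t.1))) t.2)) :: divD N s F := rfl
    rw [e, List.map_cons, evD_cons, ih, hf f h.1, evD_cons, smul_add, map_smul, Finsupp.smul_single]

theorem evD_dropZeros (F : DensL) : evD v (dropZeros F) = evD v F := by
  induction F with
  | nil => rfl
  | cons f F ih =>
    have e : dropZeros (f :: F) = (match dropZeros F, f with
      | [], [] => []
      | l', a => a :: l') := rfl
    rw [evD_cons, ← ih, e]
    rcases dropZeros F with _ | ⟨x, l⟩
    · rcases f with _ | ⟨y, f⟩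
      · simp
      · rfl
    · rfl

theorem dinv_spec (G : DensU) :
    dxDens (evD v (dinv G).1) + Finsupp.single 0 (evP v (dinv G).2) = evDU v G := by
  induction G with
  | nil => simp [dinv]
  | cons g G ih =>
    have e : dinv (g :: G) = ((dinv G).2 :: (dinv G).1,
      norm (negP (dxP (dinv G).2) :: g)) := rfl
    rw [e, evD_cons, evDU_cons, ← ih, map_add, dxDens_single, dxDens_shiftDens, evP_norm,
      evU_cons, evP_negP, evP_dxP, map_add, shiftDens_single, Finsupp.single_add,
      Finsupp.single_neg]
    have key : ∀ {M : Type} [AddCommGroup M] (a b c d : M), a + b + c + (-a + d) = d + (c + b) := by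
      intros; abel
    exact key _ _ _ _

/-- The evolutionary equation whose terms of positive order are the polynomials in the list. -/
def eqOf (v : ℕ → ℂ) (Ps : List Poly) : ℕ → DiffPoly
  | 0 => u 0 * u 1
  | s + 1 => evP v (Ps.getD s [])

/-- The densities computed by the run, without the scaling. -/
def seqOf (v : ℕ → ℂ) (S : Sys) (N n : ℕ) (j : ℕ) : Density := fun s =>
  ((N : ℂ) ^ j)⁻¹ • evD v ((state S N n j).1.getD s [])

def obsOf (v : ℕ → ℂ) (N : ℕ) (r : List (List (DensL × Poly × Bool))) (j s : ℕ) : DiffPoly :=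
  ((N : ℂ) ^ j)⁻¹ • evP v ((r.getD j []).getD s ([], [], true)).2.1

theorem evDU_conv {Ps : List Poly} {n : ℕ} (hPs : Ps.all (covers n) = true) (N : ℕ)
    (W W' : List DensL) (s : ℕ) (l : List ℕ) :
    evDU v (l.foldr (fun a F => (fun e : Ent => match e.P with
      | [] => F
      | x :: P => addU (addU (br e (W.getD (s - a - 1) []))
          (mulD (smulP (Int.ofNat N) (x :: P)) (W'.getD (s - a - 1) []))) F)
      ((mkSys n Ps).es.getD a (entP 0 []))) []) =
    (l.map fun a => flow (eqOf v Ps (a + 1)) (evD v (W.getD (s - a - 1) [])) +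
      (N : ℂ) • (eqOf v Ps (a + 1) • evD v (W'.getD (s - a - 1) []))).sum := by
  induction l with
  | nil => rfl
  | cons a l ih =>
    rw [List.foldr_cons, List.map_cons, List.sum_cons, ← ih]
    have he : ∃ m, (mkSys n Ps).es.getD a (entP 0 []) = entP m (Ps.getD a []) ∧
        covers m (Ps.getD a []) = true := by
      rw [mkSys, List.getD_eq_getElem?_getD, List.getD_eq_getElem?_getD, List.getElem?_map]
      rcases h : Ps[a]? with _ | P
      · exact ⟨0, rfl, rfl⟩
      · exact ⟨n, rfl, List.all_eq_true.mp hPs P (List.mem_of_getElem? h)⟩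
    obtain ⟨m, he, hm⟩ := he
    rw [he]
    show evDU v (match Ps.getD a [] with
      | [] => _
      | x :: P => _) = _
    rw [eqOf]
    have hb := evDU_br (entP_holds (v := v) m (Ps.getD a []) hm) (W.getD (s - a - 1) [])
    rcases hP : Ps.getD a [] with _ | ⟨x, P⟩
    · simp [flow_zero_left]
    · rw [evDU_addU, evDU_addU, evDU_mulD, evP_smulP, ← hP, hb, smul_assoc]
      rfl

theorem evDU_rhs {Ps : List Poly} {n : ℕ} (hPs : Ps.all (covers n) = true) (N : ℕ)
    (W W' : List DensL) (s : ℕ) :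
    evDU v (rhs (mkSys n Ps) N W W' s) =
      ∑ p ∈ antidiagonal s, flow (eqOf v Ps p.1) (evD v (W.getD p.2 []))
      - u 0 • dxDens (evD v (W.getD s [])) - u 1 • dm (s + 1) (evD v (W.getD s []))
      + (N : ℂ) • (∑ p ∈ antidiagonal s, eqOf v Ps p.1 • evD v (W'.getD p.2 []) -
        (u 0 * u 1) • evD v (W'.getD s [])) := by
  have h0 : ∀ G, act (fun k => dx^[k] (u 0 * u 1) - u 0 * u (k + 1))
      (fun k => dxDens^[k] (euler (u 0 * u 1)) + Finsupp.single (k + 1) (u 0)) G =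
      flow (u 0 * u 1) G - u 0 • dxDens G := by
    intro G
    rw [dxDens_eq_act, ← act_smul_left, flow, ← act_sub_left]
    congr 1
    ext1 k
    simp
  have h1 : ∀ f : ℕ × ℕ → Dens, ∑ p ∈ antidiagonal s, f p = f (0, s) +
      ((List.range s).map fun a => f (a + 1, s - a - 1)).sum := by
    intro f
    rw [Finset.Nat.sum_antidiagonal_eq_sum_range_succ_mk, Finset.sum_range_succ', add_comm]
    congr 1
  have hsum : ∀ (l : List ℕ) (f : ℕ → Dens),
      (l.map fun a => (N : ℂ) • f a).sum = (N : ℂ) • (l.map f).sum := by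
    intro l f
    induction l with
    | nil => simp
    | cons a l ih => rw [List.map_cons, List.map_cons, List.sum_cons, List.sum_cons, ih, smul_add]
  rw [rhs, evDU_addU, evDU_addU, evDU_conv hPs, mkSys, evDU_br (ent0_holds n), h0, evDU_dTerm,
    h1, h1, List.sum_map_add, hsum]
  have key : ∀ {M : Type} [AddCommGroup M] [Module ℂ M] (a b c d e f : M) (z : ℂ),
      a - b + -c + (d + z • e) = a + d - b - c + z • (f + e - f) := by
    intros; rw [add_sub_cancel_left]; abel
  exact key _ _ _ _ _ _ _

/-- The powers of `N` match: the flow terms carry `N^j`, and the terms two steps back carry `N ·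
N^{j-1}`. -/
theorem seqOf_rec {Ps : List Poly} {n : ℕ} (hPs : Ps.all (covers n) = true) {N : ℕ} (hN : N ≠ 0)
    (m j s : ℕ) :
    evDU v (rhs (mkSys n Ps) N (state (mkSys n Ps) N m j).1 (state (mkSys n Ps) N m j).2 s) =
      (N : ℂ) ^ j • twistedRhs (eqOf v Ps) (seqOf v (mkSys n Ps) N m) j s := by
  have hN' : (N : ℂ) ≠ 0 := by exact_mod_cast hN
  have hW : ∀ j s, evD v ((state (mkSys n Ps) N m j).1.getD s []) =
      (N : ℂ) ^ j • seqOf v (mkSys n Ps) N m j s := by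
    intro j s
    rw [seqOf, smul_inv_smul₀ (pow_ne_zero _ hN')]
  have hflow : ∀ f (c : ℂ) G, flow f (c • G) = c • flow f G := fun f c G => act_csmul _ _ _ _
  have hprev : (N : ℂ) • (∑ p ∈ antidiagonal s,
        eqOf v Ps p.1 • evD v ((state (mkSys n Ps) N m j).2.getD p.2 []) -
        (u 0 * u 1) • evD v ((state (mkSys n Ps) N m j).2.getD s [])) =
      (N : ℂ) ^ j • prevTerm (eqOf v Ps) (seqOf v (mkSys n Ps) N m) j s := by
    rcases j with _ | j
    · simp [state, prevTerm]
    · have hW' : ∀ s, evD v ((state (mkSys n Ps) N m (j + 1)).2.getD s []) =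
        (N : ℂ) ^ j • seqOf v (mkSys n Ps) N m j s := hW j
      simp only [hW', prevTerm, smul_comm _ ((N : ℂ) ^ j) (seqOf v (mkSys n Ps) N m j _)]
      rw [← Finset.smul_sum, ← smul_sub, smul_smul, pow_succ']
  rw [evDU_rhs hPs, twistedRhs, hprev]
  simp only [hW, hflow, map_smul, smul_comm (u 0) ((N : ℂ) ^ j), smul_comm (u 1) ((N : ℂ) ^ j)]
  rw [← Finset.smul_sum, smul_add, smul_sub, smul_sub]

theorem run_getD (S : Sys) (N n k j : ℕ) (hj : j < k) : (run S N n k W0 []).getD j [] =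
    step S N n (state S N n j).1 (state S N n j).2 := by
  have h := run_eq S N n 0 k
  rw [show (state S N n 0).1 = W0 from rfl, show (state S N n 0).2 = [] from rfl] at h
  rw [h, List.getD_eq_getElem?_getD, List.getElem?_map, List.getElem?_range' hj]
  simp

theorem length_run (S : Sys) (N n k : ℕ) : (run S N n k W0 []).length = k := by
  have h := run_eq S N n 0 k
  rw [show (state S N n 0).1 = W0 from rfl, show (state S N n 0).2 = [] from rfl] at h
  rw [h, List.length_map, List.length_range']

theorem state_succ_getD (S : Sys) (N n j s : ℕ) : (state S N n (j + 1)).1.getD s [] =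
    ((step S N n (state S N n j).1 (state S N n j).2).getD s ([], [], true)).1 := by
  rw [state, List.getD_eq_getElem?_getD, List.getD_eq_getElem?_getD, List.getElem?_map]
  rcases (step S N n (state S N n j).1 (state S N n j).2)[s]? with _ | x <;> rfl

theorem getD_of_all {α : Type} {l : List α} {p : α → Bool} {d : α} (h : l.all p = true)
    (hd : p d = true) (i : ℕ) : p (l.getD i d) = true := by
  rw [List.getD_eq_getElem?_getD]
  rcases hi : l[i]? with _ | a
  · exact hd
  · exact List.all_eq_true.mp h a (List.mem_of_getElem? hi)

/-- A run without failures gives an approximate solution of the twisted recursion. -/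
theorem isApproxSol_of_run {Ps : List Poly} {n N m J : ℕ} (hPs : Ps.all (covers n) = true)
    (hN : N ≠ 0) (hrun : okRun J (run (mkSys n Ps) N (m + 1) (J + 1) W0 []) = true) :
    IsApproxSol J m (eqOf v Ps) (seqOf v (mkSys n Ps) N (m + 1))
      (obsOf v N (run (mkSys n Ps) N (m + 1) (J + 1) W0 [])) := by
  have hN' : (N : ℂ) ≠ 0 := by exact_mod_cast hN
  have hr : ∀ j ≤ J, (run (mkSys n Ps) N (m + 1) (J + 1) W0 []).getD j [] =
      step (mkSys n Ps) N (m + 1) (state (mkSys n Ps) N (m + 1) j).1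
        (state (mkSys n Ps) N (m + 1) j).2 := fun j hj => run_getD _ _ _ _ _ (by omega)
  have hcell : ∀ j ≤ J, ∀ s ≤ m, ((run (mkSys n Ps) N (m + 1) (J + 1) W0 []).getD j []).getD s
      ([], [], true) = cell N s (dinv (rhs (mkSys n Ps) N (state (mkSys n Ps) N (m + 1) j).1
        (state (mkSys n Ps) N (m + 1) j).2 s)) := by
    intro j hj s hs
    rw [hr j hj, step, List.getD_eq_getElem?_getD, List.getElem?_map,
      List.getElem?_range (by omega)]
    rfl
  have hstate := state_succ_getD (mkSys n Ps) N (m + 1)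
  have hlen : ∀ j ≤ J, ∀ s ≤ m,
      s < ((run (mkSys n Ps) N (m + 1) (J + 1) W0 []).getD j []).length := by
    intro j hj s hs
    rw [hr j hj, step, List.length_map, List.length_range]
    omega
  have hflags : ∀ j, j + 1 ≤ J →
      ((run (mkSys n Ps) N (m + 1) (J + 1) W0 []).getD j []).all (fun x => x.2.2) = true ∧
      ((((run (mkSys n Ps) N (m + 1) (J + 1) W0 []).getD j []).getD 0 ([], [], true)).1.isEmpty) =
        true := by
    intro j hj
    have hj' : j < (run (mkSys n Ps) N (m + 1) (J + 1) W0 []).length := by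
      rw [length_run]
      omega
    rw [List.getD_eq_getElem?_getD, List.getElem?_eq_getElem hj', ← Bool.and_eq_true]
    exact List.all_eq_true.mp hrun _ (List.mem_take_iff_getElem.mpr ⟨j, by omega, rfl⟩)
  refine ⟨?_, ?_, ?_⟩
  · ext1 s
    rcases s with _ | s
    · simp [seqOf, state, W0, theta, shiftDens_single]
    · have : theta 1 (s + 1) = 0 := by simp [theta]
      show _ = -theta 1 (s + 1)
      rw [this]
      simp [seqOf, state, W0]
  · intro j hj
    have h := hstate j 0
    rw [← hr j (by omega)] at h
    rw [seqOf, h, List.isEmpty_iff.mp (hflags j hj).2]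
    simp
  · intro j hj s hs
    refine ⟨((N : ℂ) ^ j)⁻¹ • evD v (dinv (rhs (mkSys n Ps) N (state (mkSys n Ps) N (m + 1) j).1
        (state (mkSys n Ps) N (m + 1) j).2 s)).1, ?_, fun hj' => ?_⟩
    · rw [obsOf, hcell j hj s hs, map_smul, ← Finsupp.smul_single, ← smul_add]
      rw [show (cell N s (dinv (rhs (mkSys n Ps) N (state (mkSys n Ps) N (m + 1) j).1
        (state (mkSys n Ps) N (m + 1) j).2 s))).2.1 = (dinv (rhs (mkSys n Ps) N
          (state (mkSys n Ps) N (m + 1) j).1 (state (mkSys n Ps) N (m + 1) j).2 s)).2 from rfl,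
        dinv_spec, seqOf_rec hPs hN, inv_smul_smul₀ (pow_ne_zero _ hN')]
    · have hok : okD N s (dinv (rhs (mkSys n Ps) N (state (mkSys n Ps) N (m + 1) j).1
          (state (mkSys n Ps) N (m + 1) j).2 s)).1 = true := by
        have h := List.all_eq_true.mp (hflags j hj').1 _ (List.getElem_mem (hlen j hj s hs))
        have h' := hcell j hj s hs
        rw [List.getD_eq_getElem?_getD, List.getElem?_eq_getElem (hlen j hj s hs)] at h'
        rwa [show ((run (mkSys n Ps) N (m + 1) (J + 1) W0 []).getD j [])[s]'(hlen j hj s hs) = _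
          from h'] at h
      rw [seqOf, map_smul, hstate, ← hr j hj, hcell j hj s hs]
      show _ = _ • dm s (evD v (dropZeros _))
      rw [evD_dropZeros, dm_divD hok, smul_smul, pow_succ]
      congr 1
      field_simp

end eval

end
end DRHierarchy

namespace DRHierarchy
open Finset.HasAntidiagonal (antidiagonal)

noncomputable section

/-! ### The seven-parameter family -/

section scaling
variable {J N : ℕ} {P : ℕ → DiffPoly} {W : ℕ → Density} {obs : ℕ → ℕ → DiffPoly}

theorem flow_pow_smul (l : ℂ) (P : ℕ → DiffPoly) (F : Density) {s : ℕ} :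
    ∀ p ∈ antidiagonal s, flow (l ^ p.1 • P p.1) (l ^ p.2 • F p.2) =
      l ^ s • flow (P p.1) (F p.2) := by
  intro p hp
  rw [flow_csmul_left, show flow (P p.1) (l ^ p.2 • F p.2) = l ^ p.2 • flow (P p.1) (F p.2) from
    act_csmul _ _ _ _, smul_smul, ← pow_add, Finset.HasAntidiagonal.mem_antidiagonal.mp hp]

/-- Rescaling the dispersion parameter. -/
theorem twistedRhs_pow_smul (l : ℂ) (P : ℕ → DiffPoly) (W : ℕ → Density) (n s : ℕ) :
    twistedRhs (fun s => l ^ s • P s) (fun n s => l ^ s • W n s) n s =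
      l ^ s • twistedRhs P W n s := by
  have hprev : prevTerm (fun s => l ^ s • P s) (fun n s => l ^ s • W n s) n s =
      l ^ s • prevTerm P W n s := by
    rcases n with _ | n
    · simp [prevTerm]
    · rw [prevTerm, prevTerm, smul_sub, Finset.smul_sum, smul_comm (l ^ s) (u 0 * u 1) (W n s)]
      congr 1
      refine Finset.sum_congr rfl fun p hp => ?_
      rw [smul_assoc, smul_comm (P p.1), smul_smul, ← pow_add,
        Finset.HasAntidiagonal.mem_antidiagonal.mp hp]
  rw [twistedRhs, twistedRhs, hprev, Finset.sum_congr rfl (flow_pow_smul l P (W n)), map_smul,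
    map_smul, smul_comm (u 0), smul_comm (u 1), ← Finset.smul_sum, smul_add, smul_sub, smul_sub]

theorem neg_theta_pow_smul (l : ℂ) (s : ℕ) : l ^ s • (-theta 1) s = (-theta 1) s := by
  rcases s with _ | s
  · simp
  · have : theta 1 (s + 1) = 0 := by simp [theta]
    show _ • -theta 1 (s + 1) = -theta 1 (s + 1)
    rw [this]; simp

theorem IsApproxSol.pow_smul (h : IsApproxSol J N P W obs) (l : ℂ) :
    IsApproxSol J N (fun s => l ^ s • P s) (fun n s => l ^ s • W n s)
      (fun n s => l ^ s • obs n s) where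
  zero := by
    ext1 s
    rw [h.zero, neg_theta_pow_smul]
  const n hn := by rw [h.const n hn, smul_zero]
  rec_eq n hn s hs := by
    obtain ⟨A, hA, hA'⟩ := h.rec_eq n hn s hs
    refine ⟨l ^ s • A, ?_, fun hn' => by rw [hA' hn', map_smul]⟩
    rw [twistedRhs_pow_smul, ← hA, map_smul, smul_add, Finsupp.smul_single]

theorem IsTwistedSol.pow_smul (h : IsTwistedSol P W) (l : ℂ) :
    IsTwistedSol (fun s => l ^ s • P s) (fun n s => l ^ s • W n s) where
  zero := by
    ext1 s
    rw [h.zero, neg_theta_pow_smul]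
  rec_eq n s := by rw [twistedRhs_pow_smul, ← h.rec_eq, map_smul, map_smul]
  const n k := by simpa using h.const n k

theorem twistedRhs_congr {V W : ℕ → Density} {n : ℕ} (h : ∀ m ≤ n, V m = W m) (s : ℕ) :
    twistedRhs P V n s = twistedRhs P W n s := by
  rcases n with _ | n
  · simp only [twistedRhs, prevTerm, h 0 le_rfl]
  · simp only [twistedRhs, prevTerm, h (n + 1) le_rfl, h n n.le_succ]

/-- Densities after step `J` are unconstrained and may be replaced by zero, as the termination
argument requires. -/
theorem IsApproxSol.truncate (h : IsApproxSol J N P W obs) :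
    IsApproxSol J N P (fun n => if n ≤ J then W n else 0) obs where
  zero := by simp [h.zero]
  const n hn := by simp [hn, h.const n hn]
  rec_eq n hn s hs := by
    obtain ⟨A, hA, hA'⟩ := h.rec_eq n hn s hs
    refine ⟨A, ?_, fun hn' => by rw [if_pos hn', hA' hn']⟩
    rw [hA]
    exact twistedRhs_congr (fun m hm => (if_pos (hm.trans hn)).symm) s

end scaling

section
variable (v : ℕ → ℂ)

theorem godel_prime_mul {R : Type*} [CommMonoidWithZero R] (v : ℕ → R) {p : ℕ} (hp : p.Prime)
    (n : ℕ) : godel v (p * n) = v p * godel v n := by rw [godel_mul, godel_prime v hp]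

theorem jet_prime {p i : ℕ} (h : p = prime i) : godel jet p = u (i + 1) := by
  rw [h, prime_eq, godel_jet_nth]

theorem godel_values : godel v 2 = v 2 ∧ godel v 3 = v 3 ∧ godel v 5 = v 5 ∧ godel v 7 = v 7 ∧
    godel v 11 = v 11 ∧ godel v 13 = v 13 ∧ godel v 4 = v 2 * v 2 ∧ godel v 6 = v 2 * v 3 ∧
    godel v 8 = v 2 * (v 2 * v 2) ∧ godel v 9 = v 3 * v 3 ∧ godel v 10 = v 2 * v 5 ∧
    godel v 12 = v 2 * (v 2 * v 3) ∧ godel v 14 = v 2 * v 7 ∧ godel v 15 = v 3 * v 5 ∧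
    godel v 18 = v 2 * (v 3 * v 3) := by
  have h : ∀ p m n : ℕ, p.Prime → n = p * m → godel v n = v p * godel v m := by
    rintro p m _ hp rfl
    exact godel_prime_mul v hp m
  have h1 : ∀ p : ℕ, p.Prime → godel v p = v p := fun p hp => godel_prime v hp
  have w2 := h1 2 (by norm_num)
  have w3 := h1 3 (by norm_num)
  have w5 := h1 5 (by norm_num)
  have w7 := h1 7 (by norm_num)
  refine ⟨w2, w3, w5, w7, h1 11 (by norm_num), h1 13 (by norm_num), ?_, ?_, ?_, ?_, ?_, ?_, ?_, ?_,
    ?_⟩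
  · rw [h 2 2 4 (by norm_num) rfl, w2]
  · rw [h 2 3 6 (by norm_num) rfl, w3]
  · rw [h 2 4 8 (by norm_num) rfl, h 2 2 4 (by norm_num) rfl, w2]
  · rw [h 3 3 9 (by norm_num) rfl, w3]
  · rw [h 2 5 10 (by norm_num) rfl, w5]
  · rw [h 2 6 12 (by norm_num) rfl, h 2 3 6 (by norm_num) rfl, w3]
  · rw [h 2 7 14 (by norm_num) rfl, w7]
  · rw [h 3 5 15 (by norm_num) rfl, w5]
  · rw [h 2 9 18 (by norm_num) rfl, h 3 3 9 (by norm_num) rfl, w3]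

/-- The terms of positive order of the seven-parameter family at `C₁₁ = 1`. -/
def familyTerms : List Poly := [[],
  -- The number 5 encodes `u_3`. In the coefficients the primes 2, 3, 5, 7, 11, 13 stand for `C₂₁,
  -- C₂₂, C₃₁, C₃₂, C₄₁, C₄₂` divided by 8400, a factor that clears all denominators.
  [(5, [(1, 1)])],
  [],
  [(11, [(2, 8400)]), (15, [(3, 8400)])],
  [],
  [(17, [(3, 2160), (4, 100800000)]), (33, [(5, 8400)]), (35, [(5, 25200), (6, -188160000)]),
    (45, [(7, 8400)])],
  [],
  [(23, [(5, 960), (6, 38976000), (8, 1270080000000)]),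
    (51, [(7, 4725), (9, 40219200), (10, 332640000), (12, -2603664000000)]),
    (65, [(7, 18900), (9, 100396800), (10, 1330560000), (12, -14224896000000)]),
    (77, [(7, 34965), (9, 141825600), (10, 2328480000), (12, -26227152000000)]),
    (99, [(11, 8400)]),
    (105, [(11, 50400), (14, -646800000), (15, -295680000), (18, 2483712000000)]),
    (125, [(11, 16800), (14, -323400000), (15, -147840000), (18, 1241856000000)]),
    (135, [(13, 8400)])]]

/-- Orders `ε⁰, …, ε⁹` and eleven steps. The multiplier 720720 is divisible by all numbers up to 16.
-/
def familyRun : List (List (DensL × Poly × Bool)) :=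
  run (mkSys 9 familyTerms) 720720 10 11 W0 []

set_option maxRecDepth 100000 in
-- Three facts, valid for all parameter values: the divisions are exact, there is no obstruction,
-- and the densities from step nine on vanish through order nine.
theorem familyRun_spec : (okRun 10 familyRun && familyRun.all (fun l => l.all fun x => x.2.1.isEmpty)
    && (familyRun.drop 8).all (fun l => l.all fun x => x.1.isEmpty)) = true := by
  decide +kernel

/-- Replacing `ε` by `lε` reduces the family to `C₁₁ = 1`: a coefficient of order `s` acquires the
factor `l^s`, compensated by the denominators of the parameter values. -/
theorem eqOf_familyTerms {l : ℂ} (hl : l ≠ 0) (C21 C22 C31 C32 C41 C42 : ℂ) (h2 : v 2 = C21 / (8400 * l ^ 4))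
    (h3 : v 3 = C22 / (8400 * l ^ 4)) (h5 : v 5 = C31 / (8400 * l ^ 6))
    (h7 : v 7 = C32 / (8400 * l ^ 6)) (h11 : v 11 = C41 / (8400 * l ^ 8))
    (h13 : v 13 = C42 / (8400 * l ^ 8)) :
    (fun s => l ^ s • eqOf v familyTerms s) = dKdV (l ^ 2) C21 C22 C31 C32 C41 C42 := by
  obtain ⟨w2, w3, w5, w7, w11, w13, v4, v6, v8, v9, v10, v12, v14, v15, v18⟩ := godel_values v
  have j3 : godel jet 3 = u 2 := jet_prime (i := 1) rfl
  have j5 : godel jet 5 = u 3 := jet_prime (i := 2) rfl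
  have j7 : godel jet 7 = u 4 := jet_prime (i := 3) rfl
  have j11 : godel jet 11 = u 5 := jet_prime (i := 4) rfl
  have j13 : godel jet 13 = u 6 := jet_prime (i := 5) rfl
  have j17 : godel jet 17 = u 7 := jet_prime (i := 6) rfl
  have j23 : godel jet 23 = u 9 := jet_prime (i := 8) rfl
  have j9 : godel jet 9 = u 2 ^ 2 := by rw [show 9 = 3 * 3 from rfl, godel_mul, j3]; ring
  have j15 : godel jet 15 = u 2 * u 3 := by rw [show 15 = 3 * 5 from rfl, godel_mul, j3, j5]
  have j33 : godel jet 33 = u 2 * u 5 := by rw [show 33 = 3 * 11 from rfl, godel_mul, j3, j11]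
  have j35 : godel jet 35 = u 3 * u 4 := by rw [show 35 = 5 * 7 from rfl, godel_mul, j5, j7]
  have j45 : godel jet 45 = u 3 * u 2 ^ 2 := by rw [show 45 = 5 * 9 from rfl, godel_mul, j5, j9]
  have j51 : godel jet 51 = u 2 * u 7 := by rw [show 51 = 3 * 17 from rfl, godel_mul, j3, j17]
  have j65 : godel jet 65 = u 3 * u 6 := by rw [show 65 = 5 * 13 from rfl, godel_mul, j5, j13]
  have j77 : godel jet 77 = u 4 * u 5 := by rw [show 77 = 7 * 11 from rfl, godel_mul, j7, j11]
  have j99 : godel jet 99 = u 2 ^ 2 * u 5 := by rw [show 99 = 9 * 11 from rfl, godel_mul, j9, j11]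
  have j105 : godel jet 105 = u 2 * u 3 * u 4 := by
    rw [show 105 = 15 * 7 from rfl, godel_mul, j15, j7]
  have j125 : godel jet 125 = u 3 ^ 3 := by
    rw [show 125 = 5 * (5 * 5) from rfl, godel_mul, godel_mul, j5]; ring
  have j135 : godel jet 135 = u 2 ^ 3 * u 3 := by
    rw [show 135 = 9 * 15 from rfl, godel_mul, j9, j15]; ring
  have hz : ∀ s, 8 ≤ s → eqOf v familyTerms (s + 1) = 0 := by
    intro s hs
    obtain ⟨s, rfl⟩ := Nat.exists_eq_add_of_le hs
    rw [add_comm 8]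
    rfl
  funext s
  by_cases hs : 9 ≤ s
  · obtain ⟨s, rfl⟩ := Nat.exists_eq_add_of_le hs
    rw [show 9 + s = (8 + s) + 1 by omega, hz _ (by omega), smul_zero,
      show 8 + s + 1 = s + 9 by omega]
    rfl
  have hs : s < 9 := by omega
  interval_cases s
  · simp [eqOf, dKdV]
  · simp [eqOf, dKdV, familyTerms]
  · simp [eqOf, dKdV, familyTerms, evP, evC, j5]
  · simp [eqOf, dKdV, familyTerms]
  · simp [eqOf, dKdV, familyTerms, evP, evC, j11, j15, w2, w3, h2, h3, smul_smul]
    congr 2 <;> field_simp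
  · simp [eqOf, dKdV, familyTerms]
  · simp [eqOf, dKdV, familyTerms, evP, evC, smul_smul, j17, j33, j35, j45, w5, v4, v6, w7, w3, h2, h3, h5, h7]
    have key : ∀ {M : Type} [AddCommGroup M] {a b c d a' b' c' d' : M}, a = a' → b = b' → c = c' →
        d = d' → a + (b + (c + d)) = b' + d' + a' + c' := by
      rintro M _ a b c d _ _ _ _ rfl rfl rfl rfl; abel
    refine key ?_ ?_ ?_ ?_ <;> congr 1 <;> field_simp <;> ring
  · simp [eqOf, dKdV, familyTerms]
  · simp [eqOf, dKdV, familyTerms, evP, evC, smul_smul, j23, j51, j65, j77, j99, j105, j125, j135,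
      w5, v6, w7, v8, v9, v10, v12, v14, v15, v18, w11, w13, h2, h3, h5, h7, h11, h13]
    have key : ∀ {M : Type} [AddCommGroup M] {a b c d e f g h a' b' c' d' e' f' g' h' : M},
        a = a' → b = b' → c = c' → d = d' → e = e' → f = f' → g = g' → h = h' →
        a + (b + (c + (d + (e + (f + (g + h)))))) = e' + h' + a' + b' + d' + g' + c' + f' := by
      rintro M _ a b c d e f g h _ _ _ _ _ _ _ _ rfl rfl rfl rfl rfl rfl rfl rfl; abel
    refine key ?_ ?_ ?_ ?_ ?_ ?_ ?_ ?_ <;> congr 1 <;> field_simp <;> ring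

end

end
end DRHierarchy

namespace DRHierarchy
open Finset.HasAntidiagonal (antidiagonal)

noncomputable section

/-! ### The family is of DR type modulo `ε^10` -/

theorem dKdV_induction {p : ℕ → DiffPoly → Prop} (C11 C21 C22 C31 C32 C41 C42 : ℂ)
    (h : ∀ s ∈ [0, 2, 4, 6, 8], p s (dKdV C11 C21 C22 C31 C32 C41 C42 s)) (h0 : ∀ s, p s 0) (s : ℕ) :
    p s (dKdV C11 C21 C22 C31 C32 C41 C42 s) := by
  by_cases hs : s ∈ [0, 2, 4, 6, 8]
  · exact h s hs
  · have : dKdV C11 C21 C22 C31 C32 C41 C42 s = 0 := by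
      simp only [List.mem_cons, List.not_mem_nil, or_false, not_or] at hs
      unfold dKdV
      split <;> simp_all
    rw [this]
    exact h0 s

theorem dKdV_mem_pol (C11 C21 C22 C31 C32 C41 C42 : ℂ) (s : ℕ) :
    dKdV C11 C21 C22 C31 C32 C41 C42 s ∈ weightGrading.pol (s + 1) := by
  have hu : ∀ k : ℕ, u k ∈ weightGrading.pol k := fun k => by
    simpa using Grading.u_mem_pol weightGrading k
  have hmul : ∀ {a b : ℤ} {f g : DiffPoly}, f ∈ weightGrading.pol a → g ∈ weightGrading.pol b →
      f * g ∈ weightGrading.pol (a + b) := fun hf hg =>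
    Grading.mul_mem_pol hf hg (weightGrading_ok.mpr (sub_self _))
  have hs : ∀ {a b : ℤ} (c : ℂ) {f : DiffPoly}, f ∈ weightGrading.pol a → a = b →
      c • f ∈ weightGrading.pol b := fun c f hf h => h ▸ Submodule.smul_mem _ c hf
  revert s
  refine dKdV_induction (p := fun s f => f ∈ weightGrading.pol (s + 1)) _ _ _ _ _ _ _ ?_
    fun s => zero_mem _
  simp only [List.forall_mem_cons, List.not_mem_nil, dKdV]
  refine ⟨?_, ?_, ?_, ?_, ?_, by simp⟩
  · exact hmul (hu 0) (hu 1)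
  · exact hs _ (hu 3) (by norm_num)
  · exact add_mem (hs _ (hu 5) (by norm_num)) (hs _ (hmul (hu 2) (hu 3)) (by norm_num))
  · simp only [pow_two]
    refine add_mem (add_mem (add_mem ?_ ?_) ?_) ?_ <;>
      first
      | exact hs _ (hu _) (by norm_num)
      | exact hs _ (hmul (hu _) (hu _)) (by norm_num)
      | exact hs _ (hmul (hu _) (hmul (hu _) (hu _))) (by norm_num)
  · simp only [pow_succ, pow_zero, one_mul]
    refine add_mem (add_mem (add_mem (add_mem (add_mem (add_mem (add_mem ?_ ?_) ?_) ?_) ?_) ?_) ?_) ?_ <;>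
      first
      | exact hs _ (hu _) (by norm_num)
      | exact hs _ (hmul (hu _) (hu _)) (by norm_num)
      | exact hs _ (hmul (hmul (hu _) (hu _)) (hu _)) (by norm_num)
      | exact hs _ (hmul (hmul (hmul (hu _) (hu _)) (hu _)) (hu _)) (by norm_num)

theorem partialU_dKdV (C11 C21 C22 C31 C32 C41 C42 : ℂ) (s : ℕ) (hs : s ≠ 0) :
    partialU 0 (dKdV C11 C21 C22 C31 C32 C41 C42 s) = 0 ∧
      partialU 1 (dKdV C11 C21 C22 C31 C32 C41 C42 s) = 0 := by
  have hu : ∀ k, partialU 0 (u (k + 2)) = 0 ∧ partialU 1 (u (k + 2)) = 0 := fun k => by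
    simp [partialU_u]
  have h2 := hu 0
  have h3 := hu 1
  have h4 := hu 2
  have h5 := hu 3
  have h6 := hu 4
  have h7 := hu 5
  have h9 := hu 7
  norm_num at h2 h3 h4 h5 h6 h7 h9
  revert hs
  refine dKdV_induction (p := fun s f => s ≠ 0 → partialU 0 f = 0 ∧ partialU 1 f = 0)
    _ _ _ _ _ _ _ ?_ (fun s _ => by simp) s
  simp [dKdV, Derivation.leibniz, Derivation.leibniz_pow, h2, h3, h4, h5, h6, h7, h9]

theorem isDRTypeUpTo_dKdV (C11 C21 C22 C31 C32 C41 C42 : ℂ) (h : C11 ≠ 0) :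
    IsDRTypeUpTo 9 (ofEquation (dKdV C11 C21 C22 C31 C32 C41 C42)) := by
  obtain ⟨l, rfl⟩ : ∃ l : ℂ, l ^ 2 = C11 := IsAlgClosed.exists_pow_nat_eq C11 two_pos
  have hl : l ≠ 0 := by rintro rfl; simp at h
  let v : ℕ → ℂ := fun p => ([0, 0, C21 / (8400 * l ^ 4), C22 / (8400 * l ^ 4), 0,
    C31 / (8400 * l ^ 6), 0, C32 / (8400 * l ^ 6), 0, 0, 0, C41 / (8400 * l ^ 8), 0,
    C42 / (8400 * l ^ 8)] : List ℂ).getD p 0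
  have hrun := familyRun_spec
  rw [Bool.and_eq_true, Bool.and_eq_true] at hrun
  have hsol := ((isApproxSol_of_run (v := v) (n := 9) (m := 9) (J := 10) (N := 720720)
    (Ps := familyTerms) (by decide +kernel) (by norm_num) hrun.1.1).pow_smul l).truncate
  rw [eqOf_familyTerms v hl C21 C22 C31 C32 C41 C42 rfl rfl rfl rfl rfl rfl] at hsol
  have hS : ∀ j < 11, ∀ s, (state (mkSys 9 familyTerms) 720720 10 (j + 1)).1.getD s [] =
      ((familyRun.getD j []).getD s ([], [], true)).1 := fun j hj s => by
    rw [state_succ_getD, ← run_getD _ _ _ 11 _ hj, familyRun]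
  have hW : ∀ n ≤ 10, ∀ s, (state (mkSys 9 familyTerms) 720720 10 n).1.getD s [] = [] →
      seqOf v (mkSys 9 familyTerms) 720720 10 n s = 0 := fun n _ s h => by
    rw [seqOf, h, evD, smul_zero]
  refine hsol.isDRTypeUpTo (J := 8) (fun n hn s hs => ?_) (fun n hn => ?_) (fun n s hs => ?_)
    rfl (dKdV_mem_pol _ _ _ _ _ _ _) (partialU_dKdV _ _ _ _ _ _ _)
  · have h := getD_of_all hrun.1.2 (d := []) rfl n
    have h := getD_of_all h (d := ([], [], true)) rfl s
    rw [obsOf, ← familyRun, List.isEmpty_iff.mp h]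
    simp
  · split_ifs with hn'
    · funext s
      -- Entry `j` of the run produces `W_{j+1}`, so dropping eight entries concerns the indices
      -- from nine on.
      obtain ⟨n, rfl⟩ : ∃ j, n = 8 + j + 1 := ⟨n - 9, by omega⟩
      have h := getD_of_all hrun.2 (d := []) rfl n
      rw [List.getD_eq_getElem?_getD, List.getElem?_drop, ← List.getD_eq_getElem?_getD] at h
      have h := getD_of_all h (d := ([], [], true)) rfl s
      rw [hW _ hn' s (by rw [hS _ (by omega)]; exact List.isEmpty_iff.mp h), smul_zero]
      rfl
    · rfl
  · split_ifs with hn'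
    · show l ^ s • seqOf v (mkSys 9 familyTerms) 720720 10 n s = 0
      rw [hW _ hn' s, smul_zero]
      rcases n with _ | n
      · exact List.getD_eq_default _ _ (by simp [state, W0]; omega)
      · exact List.getD_eq_default _ _ (by simp [state, step]; omega)
    · rfl

end
end DRHierarchy

namespace DRHierarchy
open Finset.HasAntidiagonal (antidiagonal)

noncomputable section

/-! ### Linear algebra over the parameters -/

/-- The coefficient of a row at the key `k`. -/
def coefAt (k : ℕ) : Coef → ℤ
  | [] => 0
  | x :: r => match Nat.beq x.1 k with
    | true => x.2
    | false => coefAt k r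

def gcdC : Coef → ℕ
  | [] => 0
  | x :: r => Nat.gcd x.2.natAbs (gcdC r)

/-- Division of a row by its content. -/
def primitive (r : Coef) : Coef := (fun g : ℕ => match Nat.ble g 1 with
  | true => r
  | false => r.map fun x => (x.1, Int.ediv x.2 (Int.ofNat g))) (gcdC r)

def elim (k : ℕ) (p r : Coef) : Coef := (fun c : ℤ => match isZero c with
  | true => r
  | false => primitive (addC (smulC (coefAt k p) r) (smulC (Int.neg c) p))) (coefAt k r)

/-- A row with the key `k` and the other rows. -/
def pivot (k : ℕ) : List Coef → Option (Coef × List Coef)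
  | [] => none
  | r :: rows => match isZero (coefAt k r) with
    | false => some (r, rows)
    | true => match pivot k rows with
      | none => none
      | some x => some (x.1, r :: x.2)

/-- Gauss–Jordan elimination of the keys in the list. -/
def gauss : List ℕ → List Coef → List Coef → List Coef × List Coef
  | [], done, todo => (done, todo)
  | k :: ks, done, todo => match pivot k todo with
    | none => gauss ks done todo
    | some x => gauss ks (x.1 :: done.map (elim k x.1)) (x.2.map (elim k x.1))

def isSingle (p : ℕ) : Coef → Bool
  | [x] => Nat.beq x.1 p && !isZero x.2
  | _ => false

def dropKeys (ps : List ℕ) (r : Coef) : Coef :=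
  r.filter fun x => ps.all fun p => !Nat.beq (Nat.mod x.1 p) 0

/-- Whether the rows force the parameters in the groups to vanish, one group after the other. -/
def solves : List (List ℕ) → List Coef → Bool
  | [], _ => true
  | g :: gs, rows => (fun x : List Coef × List Coef => g.all (fun p => x.1.any (isSingle p)) &&
      solves gs (x.2.map (dropKeys g))) (gauss g [] rows)

section sound
variable {v : ℕ → ℂ}

theorem isZero_iff {c : ℤ} : isZero c = true ↔ c = 0 := by
  rcases c with n | n
  · simp [isZero]
  · simp [isZero]

theorem evC_primitive {r : Coef} (h : evC v r = 0) : evC v (primitive r) = 0 := by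
  have hg : ∀ r : Coef, ∀ x ∈ r, (gcdC r : ℤ) ∣ x.2 := by
    intro r
    induction r with
    | nil => simp
    | cons y r ih =>
      intro x hx
      rw [gcdC]
      rcases List.mem_cons.mp hx with rfl | hx
      · exact Int.natCast_dvd.mpr (Nat.gcd_dvd_left _ _)
      · exact (Int.natCast_dvd_natCast.mpr (Nat.gcd_dvd_right _ _)).trans (ih x hx)
  show evC v (match Nat.ble (gcdC r) 1 with
    | true => r
    | false => r.map fun x => (x.1, Int.ediv x.2 (Int.ofNat (gcdC r)))) = 0
  rcases hb : Nat.ble (gcdC r) 1 with _ | _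
  · have hg0 : (gcdC r : ℂ) ≠ 0 := by
      have : ¬ gcdC r ≤ 1 := fun h => by rw [Nat.ble_eq_true_of_le h] at hb; simp at hb
      exact_mod_cast (by omega : gcdC r ≠ 0)
    have key : ∀ r' : Coef, (∀ x ∈ r', (gcdC r : ℤ) ∣ x.2) → (gcdC r : ℂ) *
        evC v (r'.map fun x => (x.1, Int.ediv x.2 (Int.ofNat (gcdC r)))) = evC v r' := by
      intro r' hr
      induction r' with
      | nil => simp
      | cons x r' ih =>
        rw [List.map_cons, evC_cons, evC_cons, mul_add, ih fun y hy => hr y (by simp [hy])]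
        obtain ⟨d, hd⟩ := hr x (by simp)
        have hd' : Int.ediv x.2 (Int.ofNat (gcdC r)) * (gcdC r : ℤ) = x.2 :=
          Int.ediv_mul_cancel ⟨d, hd⟩
        have : (x.2 : ℂ) = ((Int.ediv x.2 (Int.ofNat (gcdC r)) : ℤ) : ℂ) * (gcdC r : ℂ) := by
          exact_mod_cast hd'.symm
        rw [this]
        ring
    have h' := key r (hg r)
    rw [h] at h'
    exact (mul_eq_zero.mp h').resolve_left hg0
  · exact h

theorem evC_elim {k : ℕ} {p r : Coef} (hp : evC v p = 0) (hr : evC v r = 0) :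
    evC v (elim k p r) = 0 := by
  show evC v (match isZero (coefAt k r) with
    | true => r
    | false => primitive (addC (smulC (coefAt k p) r) (smulC (Int.neg (coefAt k r)) p))) = 0
  rcases isZero (coefAt k r) with _ | _
  · refine evC_primitive ?_
    rw [evC_addC, evC_smulC, evC_smulC, hp, hr, mul_zero, mul_zero, add_zero]
  · exact hr

theorem pivot_spec {k : ℕ} {rows : List Coef} (h : ∀ r ∈ rows, evC v r = 0) {x : Coef × List Coef}
    (hx : pivot k rows = some x) : evC v x.1 = 0 ∧ ∀ r ∈ x.2, evC v r = 0 := by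
  induction rows generalizing x with
  | nil => simp [pivot] at hx
  | cons r rows ih =>
    rw [pivot] at hx
    have hrows : ∀ r ∈ rows, evC v r = 0 := fun r hr => h r (by simp [hr])
    rcases hz : isZero (coefAt k r) with _ | _
    · simp only [hz, Option.some.injEq] at hx
      subst hx
      exact ⟨h r (by simp), hrows⟩
    · rcases hy : pivot k rows with _ | y
      · simp [hz, hy] at hx
      · simp only [hz, hy, Option.some.injEq] at hx
        subst hx
        obtain ⟨h1, h2⟩ := ih hrows hy
        refine ⟨h1, fun r' hr' => ?_⟩
        rcases List.mem_cons.mp hr' with rfl | hr'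
        · exact h _ (by simp)
        · exact h2 _ hr'

/-- Only soundness matters: row operations preserve vanishing under evaluation. Whether the
elimination succeeds is read off from its output. -/
theorem gauss_spec (ks : List ℕ) {done todo : List Coef} (hd : ∀ r ∈ done, evC v r = 0)
    (ht : ∀ r ∈ todo, evC v r = 0) :
    (∀ r ∈ (gauss ks done todo).1, evC v r = 0) ∧ ∀ r ∈ (gauss ks done todo).2, evC v r = 0 := by
  induction ks generalizing done todo with
  | nil => exact ⟨hd, ht⟩
  | cons k ks ih =>
    rw [gauss]
    rcases hx : pivot k todo with _ | x
    · exact ih hd ht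
    · obtain ⟨h1, h2⟩ := pivot_spec ht hx
      have he : ∀ l : List Coef, (∀ r ∈ l, evC v r = 0) → ∀ r ∈ l.map (elim k x.1), evC v r = 0 := by
        intro l hl r hr
        obtain ⟨r', hr', rfl⟩ := List.mem_map.mp hr
        exact evC_elim h1 (hl r' hr')
      refine ih (fun r hr => ?_) (he _ h2)
      rcases List.mem_cons.mp hr with rfl | hr
      · exact h1
      · exact he _ hd r hr

theorem godel_eq_zero {v : ℕ → ℂ} {p n : ℕ} (hp : p.Prime) (hv : v p = 0) (h : p ∣ n) :
    godel v n = 0 := by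
  obtain ⟨m, rfl⟩ := h
  rw [godel_prime_mul v hp, hv, zero_mul]

theorem evC_dropKeys {ps : List ℕ} (hps : ∀ p ∈ ps, p.Prime) (hv : ∀ p ∈ ps, v p = 0) (r : Coef) :
    evC v (dropKeys ps r) = evC v r := by
  induction r with
  | nil => rfl
  | cons x r ih =>
    rw [dropKeys, List.filter_cons]
    split_ifs with hx
    · rw [evC_cons, evC_cons, ← ih, dropKeys]
    · rw [evC_cons, ← ih, dropKeys]
      simp only [List.all_eq_true, not_forall] at hx
      obtain ⟨p, hp, hx⟩ := hx
      have hx : Nat.mod x.1 p = 0 := by simpa using hx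
      rw [godel_eq_zero (hps p hp) (hv p hp) (Nat.dvd_of_mod_eq_zero hx), mul_zero, zero_add]

/-- A row with the single key `p` reads `c · v p = 0` with `c ≠ 0`. Once a group of parameters is
zero, the monomials divisible by their primes drop out, which can isolate parameters of the next
group. -/
theorem eq_zero_of_solves {gs : List (List ℕ)} (hgs : ∀ g ∈ gs, ∀ p ∈ g, p.Prime) {rows : List Coef}
    (h : solves gs rows = true) (hr : ∀ r ∈ rows, evC v r = 0) : ∀ g ∈ gs, ∀ p ∈ g, v p = 0 := by
  induction gs generalizing rows with
  | nil => simp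
  | cons g gs ih =>
    obtain ⟨h1, h2⟩ := (Bool.and_eq_true _ _).mp h
    have hsp := gauss_spec (v := v) g (done := []) (by simp) hr
    have hg : ∀ p ∈ g, v p = 0 := by
      intro p hp
      obtain ⟨r, hr, hp'⟩ := List.any_eq_true.mp (List.all_eq_true.mp h1 p hp)
      have h0 := hsp.1 r hr
      match r, hp' with
      | [x], hp' =>
        obtain ⟨hx, hx'⟩ := (Bool.and_eq_true _ _).mp hp'
        have hx : x.1 = p := Nat.eq_of_beq_eq_true hx
        have hx' : x.2 ≠ 0 := fun h => by rw [isZero_iff.mpr h] at hx'; simp at hx'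
        rw [evC_cons, evC_nil, add_zero, hx, godel_prime v (hgs g (by simp) p hp)] at h0
        exact (mul_eq_zero.mp h0).resolve_left (by exact_mod_cast hx')
    intro g' hg'
    rcases List.mem_cons.mp hg' with rfl | hg'
    · exact hg
    · refine ih (fun g hg => hgs g (by simp [hg])) h2 (fun r hr => ?_) g' hg'
      obtain ⟨r', hr', rfl⟩ := List.mem_map.mp hr
      rw [evC_dropKeys (hgs g (by simp)) hg]
      exact hsp.2 r' hr'

end sound

/-! ### Coefficients of sparse polynomials -/

/-- Whether the keys are positive and increasing. -/
def increasing : ℕ → Poly → Bool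
  | _, [] => true
  | a, x :: L => Nat.blt a x.1 && increasing x.1 L

section coeff
variable {v : ℕ → ℂ}

/-- The coefficient of the monomial encoded by `n`. -/
def coeffKey (n : ℕ) (f : DiffPoly) : ℂ :=
  PowerSeries.constantCoeff (MvPolynomial.coeff (exponents n) f)

theorem coeffKey_smul_godel (c : ℂ) {n m : ℕ} (hn : n ≠ 0) (hm : m ≠ 0) :
    coeffKey n (c • godel jet m) = if m = n then c else 0 := by
  rw [coeffKey, MvPolynomial.coeff_smul, godel_jet hm, MvPolynomial.coeff_monomial]
  by_cases h : m = n
  · rw [if_pos h, if_pos (by rw [h]), PowerSeries.constantCoeff_smul]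
    simp
  · rw [if_neg h, if_neg fun h' => h (exponents_injOn hm hn h'), smul_zero, map_zero]

theorem lt_of_increasing {a : ℕ} {L : Poly} (h : increasing a L = true) : ∀ x ∈ L, a < x.1 := by
  induction L generalizing a with
  | nil => simp
  | cons y L ih =>
    obtain ⟨h1, h2⟩ := (Bool.and_eq_true _ _).mp h
    have h1 : a < y.1 := Nat.le_of_ble_eq_true h1
    intro x hx
    rcases List.mem_cons.mp hx with rfl | hx
    · exact h1
    · exact h1.trans (ih h2 x hx)

theorem coeffKey_add (n : ℕ) (f g : DiffPoly) : coeffKey n (f + g) = coeffKey n f + coeffKey n g := by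
  simp [coeffKey]

theorem coeffKey_zero (n : ℕ) : coeffKey n 0 = 0 := by simp [coeffKey]

theorem coeffKey_evP_of_lt {n : ℕ} (hn : n ≠ 0) {L : Poly} (h : ∀ x ∈ L, n < x.1) :
    coeffKey n (evP v L) = 0 := by
  induction L with
  | nil => exact coeffKey_zero n
  | cons x L ih =>
    have hx := h x (by simp)
    rw [evP_cons, coeffKey_add, ih fun y hy => h y (by simp [hy]),
      coeffKey_smul_godel _ hn (by omega), if_neg hx.ne', add_zero]

theorem coeffKey_evP {a : ℕ} {L : Poly} (h : increasing a L = true) :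
    ∀ x ∈ L, coeffKey x.1 (evP v L) = evC v x.2 := by
  induction L generalizing a with
  | nil => simp
  | cons y L ih =>
    intro x hx
    have hy := lt_of_increasing h
    obtain ⟨h1, h2⟩ := (Bool.and_eq_true _ _).mp h
    rw [evP_cons, coeffKey_add, coeffKey_smul_godel _ (by have := hy x hx; omega)
      (by have := hy y (by simp); omega)]
    rcases List.mem_cons.mp hx with rfl | hx
    · rw [if_pos rfl, coeffKey_evP_of_lt (by have := hy x (by simp); omega)
        (lt_of_increasing h2), add_zero]
    · rw [if_neg (by have := lt_of_increasing h2 x hx; omega), zero_add, ih h2 x hx]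

end coeff

/-- The coefficients of the obstruction that lie below the threshold. -/
def rowsBelow (t c s : ℕ) (L : Poly) : List Coef :=
  (L.filter fun x => Nat.blt (Nat.add (Nat.mul t (countD 0 x.1)) s) c).map fun x => x.2

/-- Increasing keys encode distinct monomials, so each entry of `L` is a true coefficient. A
monomial of level below the threshold cannot occur in a polynomial of the filtration step. -/
theorem evC_rowsBelow {v : ℕ → ℂ} {t c s : ℕ} {L : Poly} (h : increasing 0 L = true) {z : ℂ}
    (hz : z ≠ 0) (hL : z • evP v L ∈ (countFiltration t).pol (c - s)) :
    ∀ r ∈ rowsBelow t c s L, evC v r = 0 := by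
  intro r hr
  obtain ⟨x, hx, rfl⟩ := List.mem_map.mp hr
  obtain ⟨hx, hlt⟩ := List.mem_filter.mp hx
  have hlt : t * omega primes x.1 + s < c := Nat.le_of_ble_eq_true hlt
  have hx0 : x.1 ≠ 0 := (lt_of_increasing h x hx).ne'
  rw [← coeffKey_evP h x hx]
  by_contra h0
  have h1 := hL (exponents x.1) 0 (by
    rw [MvPolynomial.coeff_smul, map_smul, smul_ne_zero_iff]
    refine ⟨hz, ?_⟩
    rwa [PowerSeries.coeff_zero_eq_constantCoeff_apply])
  rw [omega_eq primes_prime hx0, ← degree_exponents] at hlt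
  have h1 := h1.1
  simp only [Grading.level] at h1
  have : ((t * (exponents x.1).degree + s : ℕ) : ℤ) < c := by exact_mod_cast hlt
  push_cast at this h1
  linarith

end
end DRHierarchy

namespace DRHierarchy
open Finset.HasAntidiagonal (antidiagonal)

noncomputable section

/-! ### Approximate equations and vanishing of parameters -/

/-- The monomials of weight `w` in `u_2, …, u_{k+1}`. -/
def partsUpTo : ℕ → ℕ → List ℕ
  | 0, w => match w with
    | 0 => [1]
    | _ + 1 => []
  | k + 1, w => (List.range (w + 1)).flatMap fun e => match Nat.ble (Nat.mul e (k + 2)) w with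
    | false => []
    | true => (partsUpTo k (Nat.sub w (Nat.mul e (k + 2)))).map fun n =>
        Nat.mul n (Nat.pow (prime (k + 1)) e)

/-- The monomials of weight `w` in `u_2, u_3, …`. -/
def parts (w : ℕ) : List ℕ := partsUpTo w w

/-- The polynomial of weight `w` with the given coefficients. -/
def polyOf (K : ℕ → Coef) (w : ℕ) : Poly :=
  norm ((parts w).map fun n => match K n with
    | [] => []
    | x :: l => [(n, x :: l)])

/-- The terms of orders `1, …, m` of the equation with the given coefficients. -/
def termsOf (K : ℕ → ℕ → Coef) (m : ℕ) : List Poly :=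
  (List.range m).map fun a => polyOf (K (a + 1)) (a + 2)

/-- Entry 3 of the run carries the obstruction to `W_4`, the only one used for necessity. -/
def obsRow (r : List (List (DensL × Poly × Bool))) (s : ℕ) : Poly :=
  ((r.getD 3 []).getD s ([], [], true)).2.1

/-- The common multiple of the degrees that occur in the runs. -/
def scaleN : ℕ := 5354228880

/-- Orders `ε⁰, …, ε^m` are kept. Terms of order at most `m` have weight at most `m + 1`, so they
involve no jets beyond `u_{m+1}`. -/
def runOf (m : ℕ) (Ps : List Poly) : List (List (DensL × Poly × Bool)) :=
  run (mkSys (m + 1) Ps) scaleN (m + 1) 4 W0 []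

/-- Whether the run of order `m` is valid. -/
def okRunOf (m : ℕ) (Ps : List Poly) : Bool :=
  Ps.all (covers (m + 1)) && (okRun 3 (runOf m Ps) &&
    (List.range (m + 1)).all fun s => increasing 0 (obsRow (runOf m Ps) s))

/-- The coefficients below the threshold of the obstructions in the third step. -/
def rowsOf (t : ℕ) (eps : ℕ → ℕ) (m : ℕ) (Ps : List Poly) : List Coef :=
  (List.range (m + 1)).flatMap fun s =>
    rowsBelow t (Nat.add (Nat.mul 4 t) (eps s)) s (obsRow (runOf m Ps) s)

/-- Whether the obstructions below the threshold force the parameters in the groups to vanish, after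
elimination of the parameters in the list `rs`. -/
def vanishes (t : ℕ) (eps : ℕ → ℕ) (m : ℕ) (Ps : List Poly) (rs : List ℕ) (gs : List (List ℕ)) :
    Bool :=
  okRunOf m Ps && solves gs (gauss rs [] (rowsOf t eps m Ps)).2

/-! ### Finiteness of the monomials of a given weight -/

section parts

theorem ne_zero_of_mem_partsUpTo {k w n : ℕ} (h : n ∈ partsUpTo k w) : n ≠ 0 := by
  induction k generalizing w n with
  | zero => rcases w with _ | w <;> simp_all [partsUpTo]
  | succ k ih =>
    obtain ⟨e, -, h⟩ := List.mem_flatMap.mp h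
    rcases hb : Nat.ble (Nat.mul e (k + 2)) w with _ | _
    · have h : n ∈ (match Nat.ble (Nat.mul e (k + 2)) w with
        | false => []
        | true => (partsUpTo k (Nat.sub w (Nat.mul e (k + 2)))).map fun n =>
          Nat.mul n (Nat.pow (prime (k + 1)) e)) := h
      rw [hb] at h
      simp at h
    · rw [hb] at h
      obtain ⟨n, hn, rfl⟩ := List.mem_map.mp h
      refine mul_ne_zero (ih hn) (pow_ne_zero _ ?_)
      rw [prime_eq]
      exact (Nat.prime_nth_prime _).ne_zero

theorem exponents_mul {m n : ℕ} (hm : m ≠ 0) (hn : n ≠ 0) :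
    exponents (m * n) = exponents m + exponents n := by
  have h := godel_mul jet m n
  rw [godel_jet hm, godel_jet hn, godel_jet (mul_ne_zero hm hn), MvPolynomial.monomial_mul,
    one_mul] at h
  exact (MvPolynomial.monomial_left_injective one_ne_zero) h

theorem exponents_one : exponents 1 = 0 := by simp [exponents]

theorem exponents_prime_pow (i e : ℕ) : exponents (prime i ^ e) = Finsupp.single i e := by
  have hp : (prime i).Prime := by rw [prime_eq]; exact Nat.prime_nth_prime _
  induction e with
  | zero => simp [exponents_one]
  | succ e ih =>
    rw [pow_succ, exponents_mul (pow_ne_zero _ hp.ne_zero) hp.ne_zero, ih, exponents,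
      Nat.primeFactorsList_prime hp, List.map_singleton, List.sum_singleton, Finsupp.single_add]
    rw [prime_eq, primeIndex_nth]

theorem exists_mem_partsUpTo {k w : ℕ} {m : ℕ →₀ ℕ} (h0 : m 0 = 0) (hk : ∀ i, k < i → m i = 0)
    (hw : Finsupp.weight (fun i : ℕ => i + 1) m = w) : ∃ n ∈ partsUpTo k w, exponents n = m := by
  induction k generalizing w m with
  | zero =>
    have hm : m = 0 := by
      ext1 i
      rcases i with _ | i
      · exact h0
      · exact hk _ (Nat.succ_pos i)
    subst hm
    rw [map_zero] at hw
    subst hw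
    exact ⟨1, by simp [partsUpTo], exponents_one⟩
  | succ k ih =>
    have hm := Finsupp.erase_add_single (k + 1) m
    have hw' : Finsupp.weight (fun i : ℕ => i + 1) (m.erase (k + 1)) + m (k + 1) * (k + 2) = w := by
      rw [← hw]
      have h := congrArg (Finsupp.weight fun i : ℕ => i + 1) hm
      rwa [map_add, Finsupp.weight_single, smul_eq_mul] at h
    obtain ⟨n, hn, hnm⟩ := ih (m := m.erase (k + 1))
      (w := Finsupp.weight (fun i : ℕ => i + 1) (m.erase (k + 1)))
      (by rw [Finsupp.erase_ne (Nat.succ_ne_zero k).symm, h0]) (fun i hi => by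
        by_cases h : i = k + 1
        · rw [h, Finsupp.erase_same]
        · rw [Finsupp.erase_ne h, hk i (by omega)]) rfl
    refine ⟨n * prime (k + 1) ^ m (k + 1), ?_, ?_⟩
    · refine List.mem_flatMap.mpr ⟨m (k + 1), ?_, ?_⟩
      · have : m (k + 1) ≤ m (k + 1) * (k + 2) := Nat.le_mul_of_pos_right _ (by omega)
        rw [List.mem_range]
        omega
      · have hb : Nat.ble (Nat.mul (m (k + 1)) (k + 2)) w = true :=
          Nat.ble_eq_true_of_le (by show m (k + 1) * (k + 2) ≤ w; omega)
        rw [hb]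
        refine List.mem_map.mpr ⟨n, ?_, rfl⟩
        convert hn using 1
        show partsUpTo k (w - m (k + 1) * (k + 2)) = _
        congr 1
        omega
    · rw [exponents_mul (ne_zero_of_mem_partsUpTo hn) (pow_ne_zero _ (by
        rw [prime_eq]; exact (Nat.prime_nth_prime _).ne_zero)), exponents_prime_pow, hnm, hm]

theorem exists_mem_parts {w : ℕ} {m : ℕ →₀ ℕ} (h0 : m 0 = 0)
    (hw : Finsupp.weight (fun i : ℕ => i + 1) m = w) : ∃ n ∈ parts w, exponents n = m := by
  refine exists_mem_partsUpTo h0 (fun i hi => ?_) hw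
  by_contra h
  have := Finsupp.le_weight_of_ne_zero' (fun i : ℕ => i + 1) h
  rw [hw] at this
  omega

theorem coeffKey_sum (n : ℕ) (hn : n ≠ 0) (l : List ℕ) (hl : ∀ m ∈ l, m ≠ 0) (hd : l.Nodup) (c : ℕ → ℂ) :
    coeffKey n ((l.map fun m => c m • godel jet m).sum) = if n ∈ l then c n else 0 := by
  induction l with
  | nil => simp [coeffKey_zero]
  | cons m l ih =>
    rw [List.nodup_cons] at hd
    rw [List.map_cons, List.sum_cons, coeffKey_add, coeffKey_smul_godel _ hn (hl m (by simp)),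
      ih (fun m hm => hl m (by simp [hm])) hd.2]
    by_cases h : m = n
    · subst h; simp [hd.1]
    · simp [h, Ne.symm h]

theorem coeff_eq_C {f : DiffPoly} (h : partialU 0 f = 0) (m : ℕ →₀ ℕ) :
    MvPolynomial.coeff m f =
      PowerSeries.C (PowerSeries.constantCoeff (MvPolynomial.coeff m f)) := by
  have hd : PowerSeries.derivative ℂ (MvPolynomial.coeff m f) = 0 := by
    rw [← coeff_dCoeffFun]
    exact (congrArg (MvPolynomial.coeff m) h).trans (by simp)
  ext i
  rcases i with _ | i
  · simp
  · have h := congrArg (PowerSeries.coeff i) hd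
    rw [PowerSeries.coeff_derivative, map_zero] at h
    rw [PowerSeries.coeff_C, if_neg i.succ_ne_zero]
    exact (mul_eq_zero.mp h).resolve_right (by exact_mod_cast i.succ_ne_zero)

theorem partialU_zero_godel (n : ℕ) : partialU 0 (godel jet n) = 0 := by
  rcases eq_or_ne n 0 with rfl | hn
  · simp
  rw [godel_jet hn]
  ext1 m
  show MvPolynomial.coeff m (dCoeffFun _) = _
  rw [coeff_dCoeffFun, MvPolynomial.coeff_monomial]
  split_ifs <;> simp

theorem coeff_eq_zero_of_partialU_one {f : DiffPoly} (h : partialU 1 f = 0) {m : ℕ →₀ ℕ}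
    (hm : m 0 ≠ 0) : MvPolynomial.coeff m f = 0 := by
  have h' := congrArg (MvPolynomial.coeff (m - Finsupp.single 0 1)) h
  have h' : MvPolynomial.coeff (m - Finsupp.single 0 1) (MvPolynomial.pderiv 0 f) = 0 := by
    simpa [partialU] using h'
  have hm1 : m - Finsupp.single 0 1 + Finsupp.single 0 1 = m := by
    ext i
    rcases i with _ | i
    · simp; omega
    · simp
  rw [MvPolynomial.coeff_pderiv, hm1] at h'
  refine (mul_eq_zero.mp h').resolve_right fun h => ?_
  have h := congrArg PowerSeries.constantCoeff h
  simp only [map_add, map_natCast, map_one, map_zero] at h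
  exact Nat.cast_add_one_ne_zero _ h

/-- A differential polynomial of weight `w` that does not depend on `u` and `u_1` is a combination
of the monomials in `parts w`. -/
theorem eq_sum_parts {f : DiffPoly} {w : ℕ} (hw : (parts w).Nodup)
    (hf : f ∈ weightGrading.pol w) (h0 : partialU 0 f = 0) (h1 : partialU 1 f = 0) :
    f = ((parts w).map fun n => coeffKey n f • godel jet n).sum := by
  have hS : ∀ l : List ℕ, partialU 0 ((l.map fun n => coeffKey n f • godel jet n).sum) = 0 := by
    intro l
    induction l with
    | nil => simp
    | cons n l ih =>
      rw [List.map_cons, List.sum_cons, map_add, ih, Derivation.map_smul, partialU_zero_godel,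
        smul_zero, add_zero]
  ext1 m
  rw [coeff_eq_C h0, coeff_eq_C (hS _)]
  congr 1
  by_cases hm : ∃ n ∈ parts w, exponents n = m
  · obtain ⟨n, hn, rfl⟩ := hm
    have h := coeffKey_sum n (ne_zero_of_mem_partsUpTo hn) (parts w)
      (fun m hm => ne_zero_of_mem_partsUpTo hm) hw fun n => coeffKey n f
    rw [if_pos hn] at h
    exact h.symm
  · have hf0 : PowerSeries.constantCoeff (MvPolynomial.coeff m f) = 0 := by
      by_contra h
      refine hm (exists_mem_parts ?_ ?_)
      · by_contra h0
        rw [coeff_eq_zero_of_partialU_one h1 h0, map_zero] at h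
        exact h rfl
      · have := weightGrading_ok.mp (hf m 0 (by
          rwa [PowerSeries.coeff_zero_eq_constantCoeff_apply]))
        simp only [Grading.level] at this
        push_cast at this
        have : ((Finsupp.weight (fun i : ℕ => i + 1) m : ℕ) : ℤ) = w := by linarith
        exact_mod_cast this
    have hS0 : ∀ l : List ℕ, (∀ n ∈ l, n ∈ parts w) →
        MvPolynomial.coeff m ((l.map fun n => coeffKey n f • godel jet n).sum) = 0 := by
      intro l hl
      induction l with
      | nil => simp
      | cons n l ih =>
        rw [List.map_cons, List.sum_cons, MvPolynomial.coeff_add,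
          ih fun n hn => hl n (by simp [hn]), MvPolynomial.coeff_smul,
          godel_jet (ne_zero_of_mem_partsUpTo (hl n (by simp))), MvPolynomial.coeff_monomial,
          if_neg fun h => hm ⟨n, hl n (by simp), h⟩, smul_zero, add_zero]
    rw [hf0, hS0 _ fun n hn => hn, map_zero]

end parts

end
end DRHierarchy

/-! ### Reduced solutions and their obstructions -/

namespace DRHierarchy
open Finset.HasAntidiagonal (antidiagonal)

noncomputable section

/-- The largest truncation order needed is `2t = 18`, for a leading term of order `t = 9`; its
monomials have weight 19. -/
theorem nodup_parts : ∀ w < 20, (parts w).Nodup := by decide +kernel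

/-- A solution of the twisted recursion for an equation that deforms the dispersionless Burgers
equation by terms that are combinations of monomials in `u_2, u_3, …`. -/
structure IsReducedSol (P : ℕ → DiffPoly) (W : ℕ → Density) : Prop where
  sol : IsTwistedSol P W
  zero : P 0 = u 0 * u 1
  expand : ∀ s, 1 ≤ s → s < 19 →
    P s = ((parts (s + 1)).map fun n => coeffKey n (P s) • godel jet n).sum

theorem IsDRType.exists_isReducedSol {X : LocalVectorField} (hX : IsDRType X)
    (h0 : varTheta X 0 = u 0 * u 1) : ∃ W, IsReducedSol (varTheta X) W := by
  obtain ⟨W, hW⟩ := hX.exists_isTwistedSol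
  refine ⟨W, hW, h0, fun s hs hs' => ?_⟩
  have h := hX.mem_pol s
  obtain ⟨h1, h2⟩ := hX.partialU_eq_zero (s := s) (by omega)
  exact eq_sum_parts (nodup_parts _ (by omega)) (by exact_mod_cast h) h1 h2

section
variable {P : ℕ → DiffPoly} {W : ℕ → Density} {v : ℕ → ℂ}

theorem coeffKey_smul (n : ℕ) (c : ℂ) (f : DiffPoly) : coeffKey n (c • f) = c * coeffKey n f := by
  simp [coeffKey, MvPolynomial.coeff_smul]

theorem IsReducedSol.pow_smul (h : IsReducedSol P W) (l : ℂ) :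
    IsReducedSol (fun s => l ^ s • P s) (fun n s => l ^ s • W n s) where
  sol := h.sol.pow_smul l
  zero := by simp [h.zero]
  expand s hs hs' := by
    conv_lhs => rw [h.expand s hs hs']
    have : ∀ L : List ℕ, l ^ s • (L.map fun n => coeffKey n (P s) • godel jet n).sum =
        (L.map fun n => coeffKey n (l ^ s • P s) • godel jet n).sum := by
      intro L
      induction L with
      | nil => simp
      | cons n L ih =>
        rw [List.map_cons, List.map_cons, List.sum_cons, List.sum_cons, smul_add, ih, smul_smul,
          coeffKey_smul]
    exact this _

theorem evP_polyOf (K : ℕ → Coef) (w : ℕ) :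
    evP v (polyOf K w) = ((parts w).map fun n => evC v (K n) • godel jet n).sum := by
  rw [polyOf, evP_norm]
  induction parts w with
  | nil => rfl
  | cons n l ih =>
    rw [List.map_cons, evU_cons, ih, List.map_cons, List.sum_cons]
    congr 1
    rcases K n with _ | ⟨x, k⟩ <;> simp

theorem eqOf_termsOf (K : ℕ → ℕ → Coef) {m s : ℕ} (hs : 1 ≤ s) (hm : s ≤ m) :
    eqOf v (termsOf K m) s = ((parts (s + 1)).map fun n => evC v (K s n) • godel jet n).sum := by
  obtain ⟨a, rfl⟩ : ∃ a, s = a + 1 := ⟨s - 1, by omega⟩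
  rw [eqOf, termsOf, List.getD_eq_getElem?_getD, List.getElem?_map, List.getElem?_range (by omega)]
  exact evP_polyOf _ _

theorem godel_jet_mem_pol {n : ℕ} (hn : n ≠ 0) {t c : ℕ} {z : ℤ} (hz : z = c)
    {s : ℕ} (h : c ≤ t * omega primes n + s) :
    godel jet n ∈ (countFiltration t).pol (z - s) := by
  intro m i h0
  rw [godel_jet hn, MvPolynomial.coeff_monomial] at h0
  split_ifs at h0 with hm
  · rw [PowerSeries.coeff_one] at h0
    split_ifs at h0 with hi
    · subst hm hi hz
      refine countFiltration_ok ?_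
      rw [omega_eq primes_prime hn, ← degree_exponents] at h
      simp only [Grading.level]
      have : ((c : ℕ) : ℤ) ≤ t * (exponents n).degree + s := by exact_mod_cast h
      push_cast
      linarith
    · exact absurd rfl h0
  · simp at h0

theorem sum_mem_pol {t c s : ℕ} {z : ℤ} (hz : z = c) {l : List ℕ} (hl : ∀ n ∈ l, n ≠ 0)
    {a : ℕ → ℂ} (h : ∀ n ∈ l, a n ≠ 0 → c ≤ t * omega primes n + s) :
    (l.map fun n => a n • godel jet n).sum ∈ (countFiltration t).pol (z - s) := by
  induction l with
  | nil => exact zero_mem _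
  | cons n l ih =>
    rw [List.map_cons, List.sum_cons]
    refine add_mem ?_ (ih (fun n hn => hl n (by simp [hn])) fun n hn => h n (by simp [hn]))
    by_cases ha : a n = 0
    · rw [ha, zero_smul]; exact zero_mem _
    · exact Submodule.smul_mem _ _ (godel_jet_mem_pol (hl n (by simp)) hz (h n (by simp) ha))

/-- The obstructions for the approximate equation vanish below the threshold. -/
theorem IsReducedSol.evC_rowsOf (h : IsReducedSol P W) {t m : ℕ} (hm : m < 19)
    {lam eps : ℕ → ℕ} {K : ℕ → ℕ → Coef}
    (hlam : ∀ a b, a + b ≤ m → lam (a + b) ≤ lam a + lam b) (hlam0 : lam 0 = 0)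
    (heps : ∀ a b, a + b ≤ m → eps (a + b) ≤ lam a + eps b) (hle : ∀ a, lam a ≤ eps a)
    (h1 : ∀ s, 1 ≤ s → s ≤ m → ∀ n ∈ parts (s + 1), coeffKey n (P s) ≠ 0 →
      2 * t + lam s ≤ t * omega primes n + s)
    (h2 : ∀ s, 1 ≤ s → s ≤ m → ∀ n ∈ parts (s + 1), coeffKey n (P s) ≠ evC v (K s n) →
      2 * t + eps s ≤ t * omega primes n + s)
    (hrun : okRunOf m (termsOf K m) = true) :
    ∀ r ∈ rowsOf t eps m (termsOf K m), evC v r = 0 := by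
  obtain ⟨hcov, hrun⟩ := (Bool.and_eq_true _ _).mp hrun
  obtain ⟨hok, hinc⟩ := (Bool.and_eq_true _ _).mp hrun
  have hsol := isApproxSol_of_run (v := v) (J := 3) hcov (N := scaleN) (by decide) hok
  intro r hr
  obtain ⟨s, hs, hr⟩ := List.mem_flatMap.mp hr
  have hs' : s ≤ m := by have := List.mem_range.mp hs; omega
  refine evC_rowsBelow (z := ((scaleN : ℂ) ^ 3)⁻¹) (List.all_eq_true.mp hinc s hs)
    (inv_ne_zero (pow_ne_zero _ (by exact_mod_cast (by decide : scaleN ≠ 0)))) ?_ r hr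
  have hparts : ∀ s, ∀ n ∈ parts (s + 1), n ≠ 0 := fun s n hn => ne_zero_of_mem_partsUpTo hn
  have huu : u 0 * u 1 ∈ (countFiltration t).pol (2 * t) := by
    refine Grading.mul_mem_pol (Grading.u_mem_pol _ 0) (Grading.u_mem_pol _ 1)
      (countFiltration_ok ?_)
    simp only [zero_mul, add_zero]
    linarith
  have key := IsTwistedSol.obs_mem_pol (t := t) (lam := fun s => (lam s : ℤ))
    (eps := fun s => (eps s : ℤ)) h.sol hsol (fun a b hab => by exact_mod_cast hlam a b hab)
    (by exact_mod_cast hlam0) (fun a b hab => by exact_mod_cast heps a b hab)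
    (fun a _ => by exact_mod_cast hle a) (fun a ha => ?_) (fun a ha => ?_) 3 le_rfl s hs'
  · have e : ((Nat.add (Nat.mul 4 t) (eps s) : ℕ) : ℤ) - s =
        (t : ℤ) * ((3 + 1 : ℕ) : ℤ) + eps s - s := by
      show ((4 * t + eps s : ℕ) : ℤ) - s = _
      push_cast
      ring
    rw [e]
    exact key
  · rcases Nat.eq_zero_or_pos a with rfl | ha0
    · rw [h.zero]; simpa [hlam0] using huu
    · rw [h.expand a ha0 (by omega)]
      exact sum_mem_pol (c := 2 * t + lam a) (by push_cast; ring) (hparts a) (h1 a ha0 ha)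
  · rcases Nat.eq_zero_or_pos a with rfl | ha0
    · rw [h.zero, eqOf, sub_self]; exact zero_mem _
    · rw [h.expand a ha0 (by omega), eqOf_termsOf K ha0 ha]
      have hsub : ∀ l : List ℕ, (l.map fun n => coeffKey n (P a) • godel jet n).sum -
          (l.map fun n => evC v (K a n) • godel jet n).sum =
          (l.map fun n => (coeffKey n (P a) - evC v (K a n)) • godel jet n).sum := by
        intro l
        induction l with
        | nil => simp
        | cons n l ih =>
          simp only [List.map_cons, List.sum_cons]
          rw [← ih, sub_smul]
          abel
      rw [hsub]
      exact sum_mem_pol (c := 2 * t + eps a) (by push_cast; ring) (hparts a)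
        fun n hn hne => h2 a ha0 ha n hn (sub_ne_zero.mp hne)

/-- The parameters in `rs` are auxiliary unknowns. The pivot rows that remove them are discarded,
and the remaining rows are conditions on the groups in `gs`. -/
theorem IsReducedSol.eq_zero_of_vanishes (h : IsReducedSol P W) {t m : ℕ} (hm : m < 19)
    {lam eps : ℕ → ℕ} {K : ℕ → ℕ → Coef}
    (hlam : ∀ a b, a + b ≤ m → lam (a + b) ≤ lam a + lam b) (hlam0 : lam 0 = 0)
    (heps : ∀ a b, a + b ≤ m → eps (a + b) ≤ lam a + eps b) (hle : ∀ a, lam a ≤ eps a)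
    (h1 : ∀ s, 1 ≤ s → s ≤ m → ∀ n ∈ parts (s + 1), coeffKey n (P s) ≠ 0 →
      2 * t + lam s ≤ t * omega primes n + s)
    (h2 : ∀ s, 1 ≤ s → s ≤ m → ∀ n ∈ parts (s + 1), coeffKey n (P s) ≠ evC v (K s n) →
      2 * t + eps s ≤ t * omega primes n + s)
    {rs : List ℕ} {gs : List (List ℕ)} (hgs : ∀ g ∈ gs, ∀ p ∈ g, p.Prime)
    (hrun : vanishes t eps m (termsOf K m) rs gs = true) : ∀ g ∈ gs, ∀ p ∈ g, v p = 0 := by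
  obtain ⟨hok, hsolve⟩ := (Bool.and_eq_true _ _).mp hrun
  exact eq_zero_of_solves hgs hsolve (gauss_spec rs (by simp)
    (h.evC_rowsOf hm hlam hlam0 heps hle h1 h2 hok)).2

end

end
end DRHierarchy

namespace DRHierarchy
open Finset.HasAntidiagonal (antidiagonal)

noncomputable section

/-! ### Filtration levels -/

/-- The monomials of level `c` (with `s + t Ω = c`) in the terms of the orders selected by `q`. -/
def levelKeys (t c m : ℕ) (q : ℕ → Bool) : List (ℕ × ℕ) :=
  (List.range (m + 1)).flatMap fun s => match q s with
    | false => []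
    | true => ((parts (s + 1)).filter fun n =>
        Nat.beq (Nat.add s (Nat.mul t (countD 0 n))) c).map fun n => (s, n)

/-- The position of a monomial in a list. -/
def indexIn (s n : ℕ) : List (ℕ × ℕ) → Option ℕ
  | [] => none
  | x :: L => match Nat.beq x.1 s && Nat.beq x.2 n with
    | true => some 0
    | false => match indexIn s n L with
      | none => none
      | some i => some (i + 1)

/-- The parameter attached to a monomial in a list. -/
def param (L : List (ℕ × ℕ)) (s n : ℕ) : ℕ := match indexIn s n L with
  | none => 0
  | some i => prime i

/-- The equation with leading term `u_{t+1}` in order `t` whose other terms are the monomials in the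
list, with parameters as coefficients. -/
def levelCoef (t : ℕ) (L : List (ℕ × ℕ)) (s n : ℕ) : Coef :=
  match Nat.beq s t && Nat.beq n (prime t) with
  | true => [(1, 1)]
  | false => match indexIn s n L with
    | none => []
    | some i => [(prime i, 1)]

/-- Whether the coefficients in the list with orders at most `S` have to vanish. -/
def levelCheck (t : ℕ) (eps : ℕ → ℕ) (m S : ℕ) (L : List (ℕ × ℕ)) : Bool :=
  vanishes t eps m (termsOf (levelCoef t L) m)
    ((L.filter fun x => !Nat.ble x.1 S).map fun x => param L x.1 x.2)
    [(L.filter fun x => Nat.ble x.1 S).map fun x => param L x.1 x.2]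

/-- The model is `u u_1 + ε^t u_{t+1}`, of pure level `2t`, without parameters. A row with the
single key 1 is a nonzero number that would have to vanish. -/
def leadingCheck (t : ℕ) : Bool :=
  okRunOf (2 * t) (termsOf (levelCoef t []) (2 * t)) &&
    (rowsOf t (fun _ => 1) (2 * t) (termsOf (levelCoef t []) (2 * t))).any (isSingle 1)

/-- At even orders the model is correct only in the leading level. At odd orders the terms start `v`
levels higher and the model includes that level. -/
def levelEps (v s : ℕ) : ℕ := match Nat.mod s 2 with
  | 0 => 1
  | _ => v + 1

def isOdd (s : ℕ) : Bool := Nat.beq (Nat.mod s 2) 1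

set_option maxRecDepth 100000

theorem leadingCheck_spec : ∀ t < 7, leadingCheck (t + 3) = true := by decide +kernel

/-- The unknowns have excess `v` over the level 2 of `u u_1 + ε u_2`. Products of two unknowns have
excess `2v`, above the threshold when `v ≥ 1`, so the conditions are linear. -/
def burgersCheck (v m S : ℕ) : Bool :=
  levelCheck 1 (fun _ => v + 1) m S (levelKeys 1 (v + 2) m (Nat.ble 2))

/-- The unknowns are the terms of odd order with excess `v` over the level 4 of `u u_1 + ε² u_3`. At
odd orders of the obstruction they enter linearly, with coefficients depending only on this leading
part. -/
def kdvCheck (v m S : ℕ) : Bool :=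
  levelCheck 2 (levelEps v) m S (levelKeys 2 (v + 4) m isOdd)

theorem burgersCheck_spec : ∀ v < 11, burgersCheck (v + 1) (v + 3) (v + 3) = true := by
  decide +kernel

/-- A monomial of order at most nine has at most five factors, so its level is at most `14 = 12 +
2`. On this last level the unknowns of orders ten to twelve are eliminated, not shown to vanish. -/
theorem burgersCheck_twelve : burgersCheck 12 12 9 = true := by decide +kernel

theorem kdvCheck_spec : ∀ i < 7, kdvCheck (2 * i + 1) (2 * i + 5) (2 * i + 5) = true := by
  decide +kernel

/-- Likewise the level of a monomial of order at most nine is at most `9 + 2 · 5 = 15 + 4`. -/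
theorem kdvCheck_fifteen : kdvCheck 15 15 9 = true := by decide +kernel

end
end DRHierarchy

namespace DRHierarchy
open Finset.HasAntidiagonal (antidiagonal)

noncomputable section

/-! ### Induction on the filtration level -/

section
variable {P : ℕ → DiffPoly} {W : ℕ → Density}

theorem omega_parts : ∀ s < 19, ∀ n ∈ parts (s + 1),
    1 ≤ omega primes n ∧ 2 * omega primes n ≤ s + 1 ∧ (omega primes n = 1 → n = prime s) := by
  decide +kernel

theorem mem_levelKeys {t c m : ℕ} {q : ℕ → Bool} {s n : ℕ} (hs : s ≤ m) (hq : q s = true)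
    (hn : n ∈ parts (s + 1)) (h : s + t * omega primes n = c) : (s, n) ∈ levelKeys t c m q := by
  refine List.mem_flatMap.mpr ⟨s, by rw [List.mem_range]; omega, ?_⟩
  rw [hq]
  refine List.mem_map.mpr ⟨n, List.mem_filter.mpr ⟨hn, ?_⟩, rfl⟩
  rw [← h]
  exact Nat.beq_refl _

theorem indexIn_of_mem {s n : ℕ} {L : List (ℕ × ℕ)} (h : (s, n) ∈ L) :
    ∃ i, indexIn s n L = some i := by
  induction L with
  | nil => simp at h
  | cons x L ih =>
    rw [indexIn]
    rcases hb : Nat.beq x.1 s && Nat.beq x.2 n with _ | _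
    · have hne : (s, n) ≠ x := by
        rintro rfl
        simp at hb
      obtain ⟨i, hi⟩ := ih ((List.mem_cons.mp h).resolve_left hne)
      exact ⟨i + 1, by rw [hi]⟩
    · exact ⟨0, rfl⟩

theorem getElem?_of_indexIn {s n i : ℕ} {L : List (ℕ × ℕ)} (h : indexIn s n L = some i) :
    L[i]? = some (s, n) := by
  induction L generalizing i with
  | nil => simp [indexIn] at h
  | cons x L ih =>
    rw [indexIn] at h
    rcases hb : Nat.beq x.1 s && Nat.beq x.2 n with _ | _
    · rcases hj : indexIn s n L with _ | j
      · simp [hb, hj] at h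
      · simp only [hb, hj, Option.some.injEq] at h
        subst h
        exact ih hj
    · simp only [hb, Option.some.injEq] at h
      subst h
      rw [Bool.and_eq_true] at hb
      obtain ⟨h1, h2⟩ := hb
      rw [List.getElem?_cons_zero, ← Nat.eq_of_beq_eq_true h1, ← Nat.eq_of_beq_eq_true h2]

/-- The values of the parameters attached to the monomials in a list. -/
def paramVal (P : ℕ → DiffPoly) (L : List (ℕ × ℕ)) (p : ℕ) : ℂ := match L[primeIndex p]? with
  | none => 0
  | some x => coeffKey x.2 (P x.1)

theorem prime_prime (i : ℕ) : (prime i).Prime := by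
  rw [prime_eq]; exact Nat.prime_nth_prime i

theorem paramVal_prime {L : List (ℕ × ℕ)} {s n i : ℕ} (h : indexIn s n L = some i) :
    paramVal P L (prime i) = coeffKey n (P s) := by
  rw [paramVal, prime_eq, primeIndex_nth, getElem?_of_indexIn h]

/-- The parameters of the model take the true coefficients as values, so the model can be wrong only
at monomials it does not contain. -/
theorem evC_levelCoef {t : ℕ} {L : List (ℕ × ℕ)} (hlead : coeffKey (prime t) (P t) = 1) {s n : ℕ}
    (h : coeffKey n (P s) ≠ evC (paramVal P L) (levelCoef t L s n)) :
    ¬(s = t ∧ n = prime t) ∧ coeffKey n (P s) ≠ 0 ∧ (s, n) ∉ L := by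
  rw [levelCoef] at h
  rcases hb : Nat.beq s t && Nat.beq n (prime t) with _ | _
  · have h1 : ¬(s = t ∧ n = prime t) := by
      rintro ⟨rfl, rfl⟩
      simp at hb
    rw [hb] at h
    rcases hi : indexIn s n L with _ | i
    · rw [hi] at h
      refine ⟨h1, h, fun hL => ?_⟩
      obtain ⟨i, hi'⟩ := indexIn_of_mem hL
      rw [hi] at hi'
      simp at hi'
    · rw [hi] at h
      refine absurd ?_ h
      simp [godel_prime _ (prime_prime i), paramVal_prime hi]
  · rw [hb] at h
    rw [Bool.and_eq_true] at hb
    refine absurd ?_ h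
    rw [Nat.eq_of_beq_eq_true hb.1, Nat.eq_of_beq_eq_true hb.2, hlead]
    simp

theorem IsReducedSol.eq_zero_of_levelCheck (h : IsReducedSol P W) {t m S : ℕ} (hm : m < 19)
    (hlead : coeffKey (prime t) (P t) = 1) {lam eps : ℕ → ℕ} {L : List (ℕ × ℕ)}
    (hlam : ∀ a b, a + b ≤ m → lam (a + b) ≤ lam a + lam b) (hlam0 : lam 0 = 0)
    (heps : ∀ a b, a + b ≤ m → eps (a + b) ≤ lam a + eps b) (hle : ∀ a, lam a ≤ eps a)
    (h1 : ∀ s, 1 ≤ s → s ≤ m → ∀ n ∈ parts (s + 1), coeffKey n (P s) ≠ 0 →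
      2 * t + lam s ≤ t * omega primes n + s)
    (h2 : ∀ s, 1 ≤ s → s ≤ m → ∀ n ∈ parts (s + 1), ¬(s = t ∧ n = prime t) →
      coeffKey n (P s) ≠ 0 → (s, n) ∉ L → 2 * t + eps s ≤ t * omega primes n + s)
    (hrun : levelCheck t eps m S L = true) :
    ∀ s n, (s, n) ∈ L → s ≤ S → coeffKey n (P s) = 0 := by
  have hpar : ∀ s n, (s, n) ∈ L → (param L s n).Prime ∧
      paramVal P L (param L s n) = coeffKey n (P s) := by
    intro s n hs
    obtain ⟨i, hi⟩ := indexIn_of_mem hs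
    rw [param, hi]
    exact ⟨prime_prime i, paramVal_prime hi⟩
  have hv := h.eq_zero_of_vanishes hm hlam hlam0 heps hle h1
    (K := levelCoef t L) (v := paramVal P L) (fun s hs hs' n hn hne => by
      obtain ⟨a, b, c⟩ := evC_levelCoef hlead hne
      exact h2 s hs hs' n hn a b c) (by
      intro g hg p hp
      rw [List.mem_singleton] at hg
      subst hg
      obtain ⟨x, hx, rfl⟩ := List.mem_map.mp hp
      exact (hpar x.1 x.2 (List.mem_filter.mp hx).1).1) hrun
  intro s n hs hS
  rw [← (hpar s n hs).2]
  exact hv _ (List.mem_singleton_self _) _ (List.mem_map.mpr ⟨(s, n), List.mem_filter.mpr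
    ⟨hs, Nat.ble_eq_true_of_le hS⟩, rfl⟩)

/-- The leading dispersive term has order one or two. -/
theorem IsReducedSol.false_of_leading (h : IsReducedSol P W) {t : ℕ} (ht : 3 ≤ t) (ht' : t ≤ 9)
    (hlead : coeffKey (prime t) (P t) = 1) (h0 : ∀ s, 1 ≤ s → s < t → coeffKey (prime s) (P s) = 0) :
    False := by
  have hc := leadingCheck_spec (t - 3) (by omega)
  rw [Nat.sub_add_cancel ht] at hc
  obtain ⟨hok, hany⟩ := (Bool.and_eq_true _ _).mp hc
  -- Two or more factors together with `s ≥ 1` exceed the level `2t`. A linear term exceeds it for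
  -- `s > t` and is absent for `s < t` by minimality of `t`.
  have key : ∀ s, 1 ≤ s → s ≤ 2 * t → ∀ n ∈ parts (s + 1), ¬(s = t ∧ n = prime t) →
      coeffKey n (P s) ≠ 0 → 2 * t + 1 ≤ t * omega primes n + s := by
    intro s hs hs' n hn hne hc
    obtain ⟨o1, o2, o3⟩ := omega_parts s (by omega) n hn
    rcases Nat.lt_or_ge 1 (omega primes n) with ho | ho
    · have : t * 2 ≤ t * omega primes n := Nat.mul_le_mul_left t ho
      omega
    · have ho : omega primes n = 1 := by omega
      have hn' := o3 ho
      rw [ho, mul_one]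
      subst hn'
      by_contra hlt
      rcases Nat.lt_or_ge s t with hst | hst
      · exact hc (h0 s hs hst)
      · have : s = t := by omega
        subst this
        exact hne ⟨rfl, rfl⟩
  have hr := h.evC_rowsOf (t := t) (m := 2 * t) (by omega) (lam := fun _ => 0) (eps := fun _ => 1)
    (K := levelCoef t []) (v := paramVal P []) (fun _ _ _ => le_rfl) rfl (fun _ _ _ => by simp)
    (fun _ => zero_le_one) (fun s hs hs' n hn hc => by
      by_cases hst : s = t ∧ n = prime t
      · obtain ⟨o1, -, -⟩ := omega_parts s (by omega) n hn
        have : t * 1 ≤ t * omega primes n := Nat.mul_le_mul_left t o1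
        omega
      · have := key s hs hs' n hn hst hc
        omega) (fun s hs hs' n hn hne => by
      obtain ⟨a, b, -⟩ := evC_levelCoef hlead hne
      exact key s hs hs' n hn a b) hok
  obtain ⟨r, hr', hs⟩ := List.any_eq_true.mp hany
  have h0 := hr r hr'
  match r, hs with
  | [x], hs =>
    obtain ⟨hx, hx'⟩ := (Bool.and_eq_true _ _).mp hs
    have hx : x.1 = 1 := Nat.eq_of_beq_eq_true hx
    have hx' : x.2 ≠ 0 := fun h => by rw [isZero_iff.mpr h] at hx'; simp at hx'
    rw [evC_cons, evC_nil, add_zero, hx, godel_one, mul_one] at h0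
    exact hx' (by exact_mod_cast h0)

/-- If the leading dispersive term has order one, there are no terms of orders `2, …, 9`. -/
theorem IsReducedSol.coeffKey_eq_zero_of_burgers (h : IsReducedSol P W)
    (hlead : coeffKey (prime 1) (P 1) = 1) {s n : ℕ} (hs : 2 ≤ s) (hs' : s ≤ 9)
    (hn : n ∈ parts (s + 1)) : coeffKey n (P s) = 0 := by
  -- One step of the induction: if all terms of order at least two vanish below level `v + 2`, those
  -- on it satisfy linear conditions with only the zero solution in orders at most `S`.
  have step : ∀ v m S, m < 19 → 1 ≤ v → burgersCheck v m S = true →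
      (∀ s, 2 ≤ s → s < 19 → ∀ n ∈ parts (s + 1), s + omega primes n < v + 2 →
        coeffKey n (P s) = 0) →
      ∀ s, 2 ≤ s → s ≤ m → s ≤ S → ∀ n ∈ parts (s + 1), s + omega primes n = v + 2 →
        coeffKey n (P s) = 0 := by
    intro v m S hm hv hc hk s hs hsm hsS n hn hsn
    refine h.eq_zero_of_levelCheck hm hlead (lam := fun _ => 0) (fun _ _ _ => le_rfl) rfl
      (fun _ _ _ => by simp) (fun _ => Nat.zero_le _) (fun s hs hs' n hn hc => ?_)
      (fun s hs hs' n hn hne hc hL => ?_) hc s n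
      (mem_levelKeys hsm (Nat.ble_eq_true_of_le hs) hn (by omega)) hsS
    · obtain ⟨o1, -, -⟩ := omega_parts s (by omega) n hn
      omega
    · obtain ⟨o1, o2, o3⟩ := omega_parts s (by omega) n hn
      rcases Nat.lt_or_ge s 2 with h2 | h2
      · have : s = 1 := by omega
        subst this
        exact absurd ⟨rfl, o3 (by omega)⟩ hne
      · have h3 : ¬ s + omega primes n < v + 2 := fun h => hc (hk s h2 (by omega) n hn h)
        have h4 : s + omega primes n ≠ v + 2 := fun h =>
          hL (mem_levelKeys hs' (Nat.ble_eq_true_of_le h2) hn (by omega))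
        omega
  -- The induction starts at level three, the least value of `s + Ω` when `s ≥ 2` and `Ω ≥ 1`.
  have known : ∀ v, v ≤ 11 → ∀ s, 2 ≤ s → s < 19 → ∀ n ∈ parts (s + 1),
      s + omega primes n < v + 3 → coeffKey n (P s) = 0 := by
    intro v
    induction v with
    | zero =>
      intro _ s hs hs' n hn hlt
      have := (omega_parts s hs' n hn).1
      omega
    | succ v ih =>
      intro hv s hs hs' n hn hlt
      by_cases hlt' : s + omega primes n < v + 3
      · exact ih (by omega) s hs hs' n hn hlt'
      · have := (omega_parts s hs' n hn).1
        exact step (v + 1) (v + 3) (v + 3) (by omega) (by omega) (burgersCheck_spec v (by omega))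
          (fun s hs hs' n hn h => ih (by omega) s hs hs' n hn h) s hs (by omega) (by omega) n hn
          (by omega)
  by_cases hlt : s + omega primes n < 14
  · exact known 11 le_rfl s hs (by omega) n hn hlt
  · have := (omega_parts s (by omega) n hn).2.1
    exact step 12 12 9 (by omega) (by omega) burgersCheck_twelve (known 11 le_rfl) s hs (by omega)
      hs' n hn (by omega)

/-- If the leading dispersive term has order two, the terms of odd orders vanish. -/
theorem IsReducedSol.coeffKey_eq_zero_of_odd (h : IsReducedSol P W)
    (hlead : coeffKey (prime 2) (P 2) = 1) (h1 : coeffKey (prime 1) (P 1) = 0)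
    {s n : ℕ} (hs : s % 2 = 1) (hs' : s ≤ 9) (hn : n ∈ parts (s + 1)) : coeffKey n (P s) = 0 := by
  have hlam : ∀ v s, (levelEps v s = 1 ∧ s % 2 = 0) ∨ (levelEps v s = v + 1 ∧ s % 2 = 1) := by
    intro v s
    have h : s.mod 2 = s % 2 := rfl
    rcases Nat.mod_two_eq_zero_or_one s with hs | hs
    · left; rw [levelEps, h, hs]; simp
    · right; rw [levelEps, h, hs]; simp
  have step : ∀ v m S, m < 19 → 1 ≤ v → kdvCheck v m S = true →
      (∀ s, s % 2 = 1 → s < 19 → ∀ n ∈ parts (s + 1), s + 2 * omega primes n < v + 4 →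
        coeffKey n (P s) = 0) →
      ∀ s, s % 2 = 1 → s ≤ m → s ≤ S → ∀ n ∈ parts (s + 1), s + 2 * omega primes n = v + 4 →
        coeffKey n (P s) = 0 := by
    intro v m S hm hv hc hk s hs hsm hsS n hn hsn
    have hodd : ∀ s, s % 2 = 1 → isOdd s = true := fun s hs => by
      rw [isOdd, show s.mod 2 = s % 2 from rfl, hs]; rfl
    refine h.eq_zero_of_levelCheck hm hlead (lam := fun s => levelEps v s - 1)
      (fun a b _ => ?_) rfl (fun a b _ => ?_) (fun a => Nat.sub_le _ _)
      (fun s hs hs' n hn hc => ?_) (fun s hs hs' n hn hne hc hL => ?_) hc s n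
      (mem_levelKeys hsm (hodd s hs) hn (by omega)) hsS
    · rcases hlam v a with ha | ha <;> rcases hlam v b with hb | hb <;>
        rcases hlam v (a + b) with hab | hab <;> omega
    · rcases hlam v a with ha | ha <;> rcases hlam v b with hb | hb <;>
        rcases hlam v (a + b) with hab | hab <;> omega
    · obtain ⟨o1, o2, o3⟩ := omega_parts s (by omega) n hn
      rcases hlam v s with hs2 | hs2
      · omega
      · have h3 : ¬ s + 2 * omega primes n < v + 4 := fun h => hc (hk s hs2.2 (by omega) n hn h)
        omega
    · obtain ⟨o1, o2, o3⟩ := omega_parts s (by omega) n hn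
      rcases hlam v s with hs2 | hs2
      · by_cases h2 : s = 2
        · subst h2
          exact absurd ⟨rfl, o3 (by omega)⟩ hne
        · omega
      · have h3 : ¬ s + 2 * omega primes n < v + 4 := fun h => hc (hk s hs2.2 (by omega) n hn h)
        have h4 : s + 2 * omega primes n ≠ v + 4 := fun h =>
          hL (mem_levelKeys hs' (hodd s hs2.2) hn (by omega))
        omega
  -- For odd `s` the level `s + 2Ω` is odd, so `v` runs through odd numbers. Below level five only
  -- `ε u_2` remains, whose coefficient is zero by `h1`.
  have known : ∀ i, i ≤ 7 → ∀ s, s % 2 = 1 → s < 19 → ∀ n ∈ parts (s + 1),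
      s + 2 * omega primes n < 2 * i + 5 → coeffKey n (P s) = 0 := by
    intro i
    induction i with
    | zero =>
      intro _ s hs hs' n hn hlt
      obtain ⟨o1, o2, o3⟩ := omega_parts s hs' n hn
      have : s = 1 := by omega
      subst this
      rw [o3 (by omega)]
      exact h1
    | succ i ih =>
      intro hv s hs hs' n hn hlt
      by_cases hlt' : s + 2 * omega primes n < 2 * i + 5
      · exact ih (by omega) s hs hs' n hn hlt'
      · have := (omega_parts s hs' n hn).1
        exact step (2 * i + 1) (2 * i + 5) (2 * i + 5) (by omega) (by omega)
          (kdvCheck_spec i (by omega)) (fun s hs hs' n hn h => ih (by omega) s hs hs' n hn h)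
          s hs (by omega) (by omega) n hn (by omega)
  by_cases hlt : s + 2 * omega primes n < 19
  · exact known 7 le_rfl s hs (by omega) n hn hlt
  · have := (omega_parts s (by omega) n hn).2.1
    exact step 15 15 9 (by omega) (by omega) kdvCheck_fifteen (known 7 le_rfl) s hs (by omega)
      hs' n hn (by omega)

end

end
end DRHierarchy

namespace DRHierarchy
open Finset.HasAntidiagonal (antidiagonal)

noncomputable section

/-! ### The terms of orders six and eight -/

def lookupC (n : ℕ) : Poly → Coef
  | [] => []
  | x :: L => match Nat.beq x.1 n with
    | true => x.2
    | false => lookupC n L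

def listCoef (L : List Poly) (s n : ℕ) : Coef := lookupC n (L.getD (s - 1) [])

/-- The seven-parameter family up to order four, with deviations in order six and arbitrary terms in
order eight. -/
def sixthTerms : List Poly := [[],
  [(5, [(1, 1)])],
  [],
  [(11, [(2, 8400)]), (15, [(3, 8400)])],
  [],
  -- The primes 11 and 13 are the deviations at `u_7` and `u_3 u_4`. The coefficients of `u_2 u_5`
  -- and `u_3 u_2²` define `C₃₁` and `C₃₂` and cannot deviate.
  [(17, [(3, 2160), (4, 100800000), (11, 1)]), (33, [(5, 8400)]),
    (35, [(5, 25200), (6, -188160000), (13, 1)]), (45, [(7, 8400)])],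
  [],
  [(23, [(17, 1)]), (51, [(19, 1)]), (65, [(23, 1)]), (77, [(29, 1)]), (99, [(31, 1)]),
    (105, [(37, 1)]), (125, [(41, 1)]), (135, [(43, 1)])]]

/-- The seven-parameter family up to order six, with deviations in order eight and arbitrary terms in
order ten. -/
def eighthTerms : List Poly := [[],
  [(5, [(1, 1)])],
  [],
  [(11, [(2, 8400)]), (15, [(3, 8400)])],
  [],
  [(17, [(3, 2160), (4, 100800000)]), (33, [(5, 8400)]), (35, [(5, 25200), (6, -188160000)]),
    (45, [(7, 8400)])],
  [],
  -- The primes 17, 19, 23, 29, 31, 37 are the deviations. There is none at `u_2² u_5` and `u_2³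
  -- u_3`, whose coefficients define `C₄₁` and `C₄₂`.
  [(23, [(5, 960), (6, 38976000), (8, 1270080000000), (17, 1)]),
    (51, [(7, 4725), (9, 40219200), (10, 332640000), (12, -2603664000000), (19, 1)]),
    (65, [(7, 18900), (9, 100396800), (10, 1330560000), (12, -14224896000000), (23, 1)]),
    (77, [(7, 34965), (9, 141825600), (10, 2328480000), (12, -26227152000000), (29, 1)]),
    (99, [(11, 8400)]),
    (105, [(11, 50400), (14, -646800000), (15, -295680000), (18, 2483712000000), (31, 1)]),
    (125, [(11, 16800), (14, -323400000), (15, -147840000), (18, 1241856000000), (37, 1)]),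
    (135, [(13, 8400)])],
  [],
  [(31, [(41, 1)]), (69, [(43, 1)]), (95, [(47, 1)]), (119, [(53, 1)]), (143, [(59, 1)]), (153, [(61, 1)]),
    (195, [(67, 1)]), (231, [(71, 1)]), (245, [(73, 1)]), (275, [(79, 1)]), (297, [(83, 1)]),
    (315, [(89, 1)]), (375, [(97, 1)]), (405, [(101, 1)])]]

set_option maxRecDepth 100000

theorem parts_even : (∀ n ∈ parts 3, n ∈ [5]) ∧ (∀ n ∈ parts 5, n ∈ [11, 15]) ∧
    (∀ n ∈ parts 7, n ∈ [17, 33, 35, 45]) ∧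
    (∀ n ∈ parts 9, n ∈ [23, 51, 65, 77, 99, 105, 125, 135]) ∧
    ∀ n ∈ parts 11, n ∈ [31, 69, 95, 119, 143, 153, 195, 231, 245, 275, 297, 315, 375, 405] := by
  decide +kernel

theorem polyOf_familyTerms : ∀ s < 9,
    polyOf (listCoef familyTerms (s + 1)) (s + 2) = familyTerms.getD s [] := by decide +kernel

/-- With `t = 0` and the constant 100 every coefficient of the obstruction lies below the threshold,
at the price that the model must match the equation exactly through order eight. For this reason all
eight coefficients of order eight are unknowns, eliminated first. -/
theorem sixthTerms_spec : vanishes 0 (fun _ => 100) 8 (termsOf (listCoef sixthTerms) 8)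
    [17, 19, 23, 29, 31, 37, 41, 43] [[11], [13]] = true := by decide +kernel

/-- The same with the fourteen coefficients of order ten eliminated first. The deviations are
removed in three rounds, each using the vanishing of the previous ones. -/
theorem eighthTerms_spec : vanishes 0 (fun _ => 100) 10 (termsOf (listCoef eighthTerms) 10)
    [41, 43, 47, 53, 59, 61, 67, 71, 73, 79, 83, 89, 97, 101]
    [[17], [19, 23, 29], [31, 37]] = true := by decide +kernel

end
end DRHierarchy

namespace DRHierarchy
open Finset.HasAntidiagonal (antidiagonal)

noncomputable section

/-! ### Deviations from the seven-parameter family -/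

section
variable {P : ℕ → DiffPoly} {W : ℕ → Density}

/-- The values of the six remaining parameters of the family. -/
def familyVal (P : ℕ → DiffPoly) : ℕ → ℂ
  | 2 => coeffKey 11 (P 4) / 8400
  | 3 => coeffKey 15 (P 4) / 8400
  | 5 => coeffKey 33 (P 6) / 8400
  | 7 => coeffKey 45 (P 6) / 8400
  | 11 => coeffKey 99 (P 8) / 8400
  | 13 => coeffKey 135 (P 8) / 8400
  | _ => 0

/-- The deviation of a coefficient from the seven-parameter family. -/
def deviation (P : ℕ → DiffPoly) (s n : ℕ) : ℂ :=
  coeffKey n (P s) - evC (familyVal P) (listCoef familyTerms s n)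

def sixthVal (P : ℕ → DiffPoly) : ℕ → ℂ
  | 11 => deviation P 6 17
  | 13 => deviation P 6 35
  | 17 => coeffKey 23 (P 8)
  | 19 => coeffKey 51 (P 8)
  | 23 => coeffKey 65 (P 8)
  | 29 => coeffKey 77 (P 8)
  | 31 => coeffKey 99 (P 8)
  | 37 => coeffKey 105 (P 8)
  | 41 => coeffKey 125 (P 8)
  | 43 => coeffKey 135 (P 8)
  | p => familyVal P p

def eighthVal (P : ℕ → DiffPoly) : ℕ → ℂ
  | 17 => deviation P 8 23
  | 19 => deviation P 8 51
  | 23 => deviation P 8 65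
  | 29 => deviation P 8 77
  | 31 => deviation P 8 105
  | 37 => deviation P 8 125
  | 41 => coeffKey 31 (P 10)
  | 43 => coeffKey 69 (P 10)
  | 47 => coeffKey 95 (P 10)
  | 53 => coeffKey 119 (P 10)
  | 59 => coeffKey 143 (P 10)
  | 61 => coeffKey 153 (P 10)
  | 67 => coeffKey 195 (P 10)
  | 71 => coeffKey 231 (P 10)
  | 73 => coeffKey 245 (P 10)
  | 79 => coeffKey 275 (P 10)
  | 83 => coeffKey 297 (P 10)
  | 89 => coeffKey 315 (P 10)
  | 97 => coeffKey 375 (P 10)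
  | 101 => coeffKey 405 (P 10)
  | p => familyVal P p

theorem IsReducedSol.eq_eqOf_familyTerms (h : IsReducedSol P W)
    (hdev : ∀ s, 1 ≤ s → s ≤ 9 → ∀ n ∈ parts (s + 1), deviation P s n = 0) {s : ℕ} (hs : s ≤ 9) :
    P s = eqOf (familyVal P) familyTerms s := by
  rcases s with _ | s
  · exact h.zero
  · rw [h.expand (s + 1) (by omega) (by omega), eqOf, ← polyOf_familyTerms s (by omega), evP_polyOf]
    congr 1
    exact List.map_congr_left fun n hn => by
      rw [sub_eq_zero.mp (hdev (s + 1) (by omega) hs n hn)]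

theorem evC_one (v : ℕ → ℂ) {p : ℕ} (hp : p.Prime) : evC v [(p, 1)] = v p := by
  simp [godel_prime v hp]

/-- Odd orders are zero, order two is normalized, and the two coefficients of order four are
themselves the parameters `C₂₁` and `C₂₂` up to scaling. -/
theorem deviation_low (hlead : coeffKey 5 (P 2) = 1)
    (hodd : ∀ s, s % 2 = 1 → s ≤ 9 → ∀ n ∈ parts (s + 1), coeffKey n (P s) = 0) :
    ∀ s, 1 ≤ s → s ≤ 9 → s ≠ 6 → s ≠ 8 → ∀ n ∈ parts (s + 1), deviation P s n = 0 := by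
  intro s hs hs' h6 h8 n hn
  obtain ⟨p3, p5, -⟩ := parts_even
  obtain ⟨w2, w3, -⟩ := godel_values (familyVal P)
  rw [deviation]
  interval_cases s
  · rw [hodd 1 rfl (by norm_num) n hn, show listCoef familyTerms 1 n = [] from rfl]; simp
  · have := p3 n hn
    simp only [List.mem_singleton] at this
    subst this
    simp [hlead, listCoef, familyTerms, lookupC]
  · rw [hodd 3 rfl (by norm_num) n hn, show listCoef familyTerms 3 n = [] from rfl]; simp
  · have := p5 n hn
    simp only [List.mem_cons, List.not_mem_nil, or_false] at this
    rcases this with rfl | rfl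
    · rw [show listCoef familyTerms 4 11 = [(2, 8400)] from rfl]
      simp [w2, familyVal]
      ring
    · rw [show listCoef familyTerms 4 15 = [(3, 8400)] from rfl]
      simp [w3, familyVal]
      ring
  · rw [hodd 5 rfl (by norm_num) n hn, show listCoef familyTerms 5 n = [] from rfl]; simp
  · exact absurd rfl h6
  · rw [hodd 7 rfl (by norm_num) n hn, show listCoef familyTerms 7 n = [] from rfl]; simp
  · exact absurd rfl h8
  · rw [hodd 9 rfl (by norm_num) n hn, show listCoef familyTerms 9 n = [] from rfl]; simp

/-- With the values `sixthVal` the model reproduces the equation exactly through order eight, so the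
verified elimination applies to its true coefficients. -/
theorem IsReducedSol.deviation_six (h : IsReducedSol P W) (hlead : coeffKey 5 (P 2) = 1)
    (hodd : ∀ s, s % 2 = 1 → s ≤ 9 → ∀ n ∈ parts (s + 1), coeffKey n (P s) = 0) :
    ∀ n ∈ parts 7, deviation P 6 n = 0 := by
  obtain ⟨p3, p5, p7, p9, -⟩ := parts_even
  have h4 := deviation_low hlead hodd 4 (by norm_num) (by norm_num) (by norm_num) (by norm_num)
  have hz := h.eq_zero_of_vanishes (t := 0) (m := 8) (v := sixthVal P) (lam := fun _ => 0)
    (eps := fun _ => 100) (K := listCoef sixthTerms) (by norm_num) (by simp) rfl (by simp) (by simp)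
    (by simp) ?_ (rs := [17, 19, 23, 29, 31, 37, 41, 43]) (gs := [[11], [13]])
    (by norm_num) sixthTerms_spec
  · have h11 : deviation P 6 17 = 0 := hz [11] (by simp) 11 (by simp)
    have h13 : deviation P 6 35 = 0 := hz [13] (by simp) 13 (by simp)
    obtain ⟨w2, w3, w5, w7, -⟩ := godel_values (familyVal P)
    intro n hn
    have := p7 n hn
    simp only [List.mem_cons, List.not_mem_nil, or_false] at this
    rcases this with rfl | rfl | rfl | rfl
    · exact h11
    · rw [deviation, show listCoef familyTerms 6 33 = [(5, 8400)] from rfl]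
      simp [w5, familyVal]
      ring
    · exact h13
    · rw [deviation, show listCoef familyTerms 6 45 = [(7, 8400)] from rfl]
      simp [w7, familyVal]
      ring
  · intro s hs hs' n hn hne
    refine absurd ?_ hne
    obtain ⟨w2, w3, w5, w7, w11, w13, v4, v6, -⟩ := godel_values (familyVal P)
    obtain ⟨x2, x3, x5, x7, x11, x13, y4, y6, -⟩ := godel_values (sixthVal P)
    interval_cases s
    · rw [hodd 1 rfl (by norm_num) n hn, show listCoef sixthTerms 1 n = [] from rfl]; simp
    · have := p3 n hn
      simp only [List.mem_singleton] at this
      subst this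
      rw [show listCoef sixthTerms 2 5 = [(1, 1)] from rfl, hlead]
      simp
    · rw [hodd 3 rfl (by norm_num) n hn, show listCoef sixthTerms 3 n = [] from rfl]; simp
    · have := sub_eq_zero.mp (h4 n hn)
      have hm := p5 n hn
      simp only [List.mem_cons, List.not_mem_nil, or_false] at hm
      rcases hm with rfl | rfl
      · rw [this, show listCoef familyTerms 4 11 = [(2, 8400)] from rfl,
          show listCoef sixthTerms 4 11 = [(2, 8400)] from rfl]
        simp [w2, x2, sixthVal]
      · rw [this, show listCoef familyTerms 4 15 = [(3, 8400)] from rfl,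
          show listCoef sixthTerms 4 15 = [(3, 8400)] from rfl]
        simp [w3, x3, sixthVal]
    · rw [hodd 5 rfl (by norm_num) n hn, show listCoef sixthTerms 5 n = [] from rfl]; simp
    · have hm := p7 n hn
      simp only [List.mem_cons, List.not_mem_nil, or_false] at hm
      rcases hm with rfl | rfl | rfl | rfl
      · rw [show listCoef sixthTerms 6 17 = [(3, 2160), (4, 100800000), (11, 1)] from rfl]
        simp [x3, y4, x11, sixthVal, deviation, show listCoef familyTerms 6 17 =
          [(3, 2160), (4, 100800000)] from rfl, w3, v4]
        ring
      · rw [show listCoef sixthTerms 6 33 = [(5, 8400)] from rfl]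
        simp [x5, sixthVal, familyVal]
        ring
      · rw [show listCoef sixthTerms 6 35 = [(5, 25200), (6, -188160000), (13, 1)] from rfl]
        simp [x5, y6, x13, sixthVal, deviation, show listCoef familyTerms 6 35 =
          [(5, 25200), (6, -188160000)] from rfl, w5, v6]
        ring
      · rw [show listCoef sixthTerms 6 45 = [(7, 8400)] from rfl]
        simp [x7, sixthVal, familyVal]
        ring
    · rw [hodd 7 rfl (by norm_num) n hn, show listCoef sixthTerms 7 n = [] from rfl]; simp
    · have hm := p9 n hn
      simp only [List.mem_cons, List.not_mem_nil, or_false] at hm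
      rcases hm with rfl | rfl | rfl | rfl | rfl | rfl | rfl | rfl
      · rw [show listCoef sixthTerms 8 23 = [(17, 1)] from rfl,
          evC_one _ (by norm_num : Nat.Prime 17)]
        rfl
      · rw [show listCoef sixthTerms 8 51 = [(19, 1)] from rfl,
          evC_one _ (by norm_num : Nat.Prime 19)]
        rfl
      · rw [show listCoef sixthTerms 8 65 = [(23, 1)] from rfl,
          evC_one _ (by norm_num : Nat.Prime 23)]
        rfl
      · rw [show listCoef sixthTerms 8 77 = [(29, 1)] from rfl,
          evC_one _ (by norm_num : Nat.Prime 29)]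
        rfl
      · rw [show listCoef sixthTerms 8 99 = [(31, 1)] from rfl,
          evC_one _ (by norm_num : Nat.Prime 31)]
        rfl
      · rw [show listCoef sixthTerms 8 105 = [(37, 1)] from rfl,
          evC_one _ (by norm_num : Nat.Prime 37)]
        rfl
      · rw [show listCoef sixthTerms 8 125 = [(41, 1)] from rfl,
          evC_one _ (by norm_num : Nat.Prime 41)]
        rfl
      · rw [show listCoef sixthTerms 8 135 = [(43, 1)] from rfl,
          evC_one _ (by norm_num : Nat.Prime 43)]
        rfl

/-- The same one order pair higher: the result for order six makes the model exact through order
ten. Order nine is covered by the vanishing of odd orders. -/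
theorem IsReducedSol.deviation_eight (h : IsReducedSol P W) (hlead : coeffKey 5 (P 2) = 1)
    (hodd : ∀ s, s % 2 = 1 → s ≤ 9 → ∀ n ∈ parts (s + 1), coeffKey n (P s) = 0) :
    ∀ n ∈ parts 9, deviation P 8 n = 0 := by
  obtain ⟨p3, p5, p7, p9, p11⟩ := parts_even
  have h4 := deviation_low hlead hodd 4 (by norm_num) (by norm_num) (by norm_num) (by norm_num)
  have h6 := h.deviation_six hlead hodd
  obtain ⟨w2, w3, w5, w7, w11, w13, v4, v6, v8, v9, v10, v12, v14, v15, v18⟩ := godel_values (familyVal P)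
  obtain ⟨x2, x3, x5, x7, x11, x13, y4, y6, y8, y9, y10, y12, y14, y15, y18⟩ := godel_values (eighthVal P)
  have hz := h.eq_zero_of_vanishes (t := 0) (m := 10) (v := eighthVal P) (lam := fun _ => 0)
    (eps := fun _ => 100) (K := listCoef eighthTerms) (by norm_num) (by simp) rfl (by simp) (by simp)
    (by simp) ?_ (rs := [41, 43, 47, 53, 59, 61, 67, 71, 73, 79, 83, 89, 97, 101])
    (gs := [[17], [19, 23, 29], [31, 37]]) (by norm_num) eighthTerms_spec
  · intro n hn
    have := p9 n hn
    simp only [List.mem_cons, List.not_mem_nil, or_false] at this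
    rcases this with rfl | rfl | rfl | rfl | rfl | rfl | rfl | rfl
    · exact hz [17] (by simp) 17 (by simp)
    · exact hz [19, 23, 29] (by simp) 19 (by simp)
    · exact hz [19, 23, 29] (by simp) 23 (by simp)
    · exact hz [19, 23, 29] (by simp) 29 (by simp)
    · rw [deviation, show listCoef familyTerms 8 99 = [(11, 8400)] from rfl]
      simp [w11, familyVal]
      ring
    · exact hz [31, 37] (by simp) 31 (by simp)
    · exact hz [31, 37] (by simp) 37 (by simp)
    · rw [deviation, show listCoef familyTerms 8 135 = [(13, 8400)] from rfl]
      simp [w13, familyVal]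
      ring
  · intro s hs hs' n hn hne
    refine absurd ?_ hne
    interval_cases s
    · rw [hodd 1 rfl (by norm_num) n hn, show listCoef eighthTerms 1 n = [] from rfl]; simp
    · have := p3 n hn
      simp only [List.mem_singleton] at this
      subst this
      rw [show listCoef eighthTerms 2 5 = [(1, 1)] from rfl, hlead]
      simp
    · rw [hodd 3 rfl (by norm_num) n hn, show listCoef eighthTerms 3 n = [] from rfl]; simp
    · have := sub_eq_zero.mp (h4 n hn)
      have hm := p5 n hn
      simp only [List.mem_cons, List.not_mem_nil, or_false] at hm
      rcases hm with rfl | rfl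
      · rw [this, show listCoef familyTerms 4 11 = [(2, 8400)] from rfl,
          show listCoef eighthTerms 4 11 = [(2, 8400)] from rfl]
        simp [w2, x2, eighthVal]
      · rw [this, show listCoef familyTerms 4 15 = [(3, 8400)] from rfl,
          show listCoef eighthTerms 4 15 = [(3, 8400)] from rfl]
        simp [w3, x3, eighthVal]
    · rw [hodd 5 rfl (by norm_num) n hn, show listCoef eighthTerms 5 n = [] from rfl]; simp
    · have := sub_eq_zero.mp (h6 n hn)
      have hm := p7 n hn
      simp only [List.mem_cons, List.not_mem_nil, or_false] at hm
      rcases hm with rfl | rfl | rfl | rfl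
      · rw [this, show listCoef familyTerms 6 17 = [(3, 2160), (4, 100800000)] from rfl,
          show listCoef eighthTerms 6 17 = [(3, 2160), (4, 100800000)] from rfl]
        simp [w3, v4, x3, y4, eighthVal]
      · rw [this, show listCoef familyTerms 6 33 = [(5, 8400)] from rfl,
          show listCoef eighthTerms 6 33 = [(5, 8400)] from rfl]
        simp [w5, x5, eighthVal]
      · rw [this, show listCoef familyTerms 6 35 = [(5, 25200), (6, -188160000)] from rfl,
          show listCoef eighthTerms 6 35 = [(5, 25200), (6, -188160000)] from rfl]
        simp [w5, v6, x5, y6, eighthVal]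
      · rw [this, show listCoef familyTerms 6 45 = [(7, 8400)] from rfl,
          show listCoef eighthTerms 6 45 = [(7, 8400)] from rfl]
        simp [w7, x7, eighthVal]
    · rw [hodd 7 rfl (by norm_num) n hn, show listCoef eighthTerms 7 n = [] from rfl]; simp
    · have hm := p9 n hn
      simp only [List.mem_cons, List.not_mem_nil, or_false] at hm
      rcases hm with rfl | rfl | rfl | rfl | rfl | rfl | rfl | rfl
      · rw [show listCoef eighthTerms 8 23 = [(5, 960), (6, 38976000), (8, 1270080000000)] ++ [(17, 1)] from rfl, evC_append,
          evC_one _ (by norm_num : Nat.Prime 17)]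
        simp [eighthVal, deviation, show listCoef familyTerms 8 23 =
          [(5, 960), (6, 38976000), (8, 1270080000000)] from rfl, w5, v6, v8, x5, y6, y8]
      · rw [show listCoef eighthTerms 8 51 = [(7, 4725), (9, 40219200), (10, 332640000), (12, -2603664000000)] ++ [(19, 1)] from rfl, evC_append,
          evC_one _ (by norm_num : Nat.Prime 19)]
        simp [eighthVal, deviation, show listCoef familyTerms 8 51 =
          [(7, 4725), (9, 40219200), (10, 332640000), (12, -2603664000000)] from rfl, w7, v9, v10, v12, x7, y9, y10, y12]
      · rw [show listCoef eighthTerms 8 65 = [(7, 18900), (9, 100396800), (10, 1330560000), (12, -14224896000000)] ++ [(23, 1)] from rfl, evC_append,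
          evC_one _ (by norm_num : Nat.Prime 23)]
        simp [eighthVal, deviation, show listCoef familyTerms 8 65 =
          [(7, 18900), (9, 100396800), (10, 1330560000), (12, -14224896000000)] from rfl, w7, v9, v10, v12, x7, y9, y10, y12]
      · rw [show listCoef eighthTerms 8 77 = [(7, 34965), (9, 141825600), (10, 2328480000), (12, -26227152000000)] ++ [(29, 1)] from rfl, evC_append,
          evC_one _ (by norm_num : Nat.Prime 29)]
        simp [eighthVal, deviation, show listCoef familyTerms 8 77 =
          [(7, 34965), (9, 141825600), (10, 2328480000), (12, -26227152000000)] from rfl, w7, v9, v10, v12, x7, y9, y10, y12]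
      · rw [show listCoef eighthTerms 8 99 = [(11, 8400)] from rfl]
        simp [x11, eighthVal, familyVal]
        ring
      · rw [show listCoef eighthTerms 8 105 = [(11, 50400), (14, -646800000), (15, -295680000), (18, 2483712000000)] ++ [(31, 1)] from rfl, evC_append,
          evC_one _ (by norm_num : Nat.Prime 31)]
        simp [eighthVal, deviation, show listCoef familyTerms 8 105 =
          [(11, 50400), (14, -646800000), (15, -295680000), (18, 2483712000000)] from rfl, w11, v14, v15, v18, x11, y14, y15, y18]
      · rw [show listCoef eighthTerms 8 125 = [(11, 16800), (14, -323400000), (15, -147840000), (18, 1241856000000)] ++ [(37, 1)] from rfl, evC_append,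
          evC_one _ (by norm_num : Nat.Prime 37)]
        simp [eighthVal, deviation, show listCoef familyTerms 8 125 =
          [(11, 16800), (14, -323400000), (15, -147840000), (18, 1241856000000)] from rfl, w11, v14, v15, v18, x11, y14, y15, y18]
      · rw [show listCoef eighthTerms 8 135 = [(13, 8400)] from rfl]
        simp [x13, eighthVal, familyVal]
        ring
    · rw [hodd 9 rfl (by norm_num) n hn, show listCoef eighthTerms 9 n = [] from rfl]; simp
    · have hm := p11 n hn
      simp only [List.mem_cons, List.not_mem_nil, or_false] at hm
      rcases hm with rfl | rfl | rfl | rfl | rfl | rfl | rfl | rfl | rfl | rfl | rfl | rfl | rfl | rfl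
      · rw [show listCoef eighthTerms 10 31 = [(41, 1)] from rfl,
          evC_one _ (by norm_num : Nat.Prime 41)]
        rfl
      · rw [show listCoef eighthTerms 10 69 = [(43, 1)] from rfl,
          evC_one _ (by norm_num : Nat.Prime 43)]
        rfl
      · rw [show listCoef eighthTerms 10 95 = [(47, 1)] from rfl,
          evC_one _ (by norm_num : Nat.Prime 47)]
        rfl
      · rw [show listCoef eighthTerms 10 119 = [(53, 1)] from rfl,
          evC_one _ (by norm_num : Nat.Prime 53)]
        rfl
      · rw [show listCoef eighthTerms 10 143 = [(59, 1)] from rfl,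
          evC_one _ (by norm_num : Nat.Prime 59)]
        rfl
      · rw [show listCoef eighthTerms 10 153 = [(61, 1)] from rfl,
          evC_one _ (by norm_num : Nat.Prime 61)]
        rfl
      · rw [show listCoef eighthTerms 10 195 = [(67, 1)] from rfl,
          evC_one _ (by norm_num : Nat.Prime 67)]
        rfl
      · rw [show listCoef eighthTerms 10 231 = [(71, 1)] from rfl,
          evC_one _ (by norm_num : Nat.Prime 71)]
        rfl
      · rw [show listCoef eighthTerms 10 245 = [(73, 1)] from rfl,
          evC_one _ (by norm_num : Nat.Prime 73)]
        rfl
      · rw [show listCoef eighthTerms 10 275 = [(79, 1)] from rfl,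
          evC_one _ (by norm_num : Nat.Prime 79)]
        rfl
      · rw [show listCoef eighthTerms 10 297 = [(83, 1)] from rfl,
          evC_one _ (by norm_num : Nat.Prime 83)]
        rfl
      · rw [show listCoef eighthTerms 10 315 = [(89, 1)] from rfl,
          evC_one _ (by norm_num : Nat.Prime 89)]
        rfl
      · rw [show listCoef eighthTerms 10 375 = [(97, 1)] from rfl,
          evC_one _ (by norm_num : Nat.Prime 97)]
        rfl
      · rw [show listCoef eighthTerms 10 405 = [(101, 1)] from rfl,
          evC_one _ (by norm_num : Nat.Prime 101)]
        rfl

theorem IsReducedSol.eq_family (h : IsReducedSol P W) (hlead : coeffKey (prime 2) (P 2) = 1)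
    (h1 : coeffKey (prime 1) (P 1) = 0) {s : ℕ} (hs : s ≤ 9) :
    P s = eqOf (familyVal P) familyTerms s := by
  have hodd : ∀ s, s % 2 = 1 → s ≤ 9 → ∀ n ∈ parts (s + 1), coeffKey n (P s) = 0 :=
    fun s hs hs' n hn => h.coeffKey_eq_zero_of_odd hlead h1 hs hs' hn
  refine h.eq_eqOf_familyTerms (fun s hs hs' n hn => ?_) hs
  by_cases h6 : s = 6
  · subst h6; exact h.deviation_six hlead hodd n hn
  by_cases h8 : s = 8
  · subst h8; exact h.deviation_eight hlead hodd n hn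
  exact deviation_low hlead hodd s hs hs' h6 h8 n hn

end

end
end DRHierarchy

namespace DRHierarchy
open Finset.HasAntidiagonal (antidiagonal)

noncomputable section

/-! ### Classification -/

theorem IsDRType.quasilinearCoeff_varTheta {X : LocalVectorField} (hX : IsDRType X) {s : ℕ}
    (hs : 1 ≤ s) :
    quasilinearCoeff (varTheta X) s = PowerSeries.C (coeffKey (prime s) (varTheta X s)) := by
  rw [quasilinearCoeff, coeff_eq_C (hX.partialU_eq_zero (by omega : s ≠ 0)).1, coeffKey,
    ← pow_one (prime s), exponents_prime_pow]

theorem IsDRType.quasilinearCoeff_ne_zero {X : LocalVectorField} (hX : IsDRType X) {s : ℕ}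
    (hs : 1 ≤ s) : quasilinearCoeff (varTheta X) s ≠ 0 ↔ coeffKey (prime s) (varTheta X s) ≠ 0 := by
  rw [hX.quasilinearCoeff_varTheta hs, Ne, map_eq_zero_iff _ PowerSeries.C_injective]

section
variable {P : ℕ → DiffPoly} {W : ℕ → Density}

theorem IsReducedSol.eq_zero_of_coeffKey (h : IsReducedSol P W) {s : ℕ} (hs : 1 ≤ s) (hs' : s < 19)
    (hc : ∀ n ∈ parts (s + 1), coeffKey n (P s) = 0) : P s = 0 := by
  rw [h.expand s hs hs']
  refine List.sum_eq_zero fun x hx => ?_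
  obtain ⟨n, hn, rfl⟩ := List.mem_map.mp hx
  rw [hc n hn, zero_smul]

theorem IsReducedSol.eq_burgers (h : IsReducedSol P W) (hlead : coeffKey (prime 1) (P 1) = 1)
    {s : ℕ} (hs : s ≤ 9) : P s = burgers 1 s := by
  rcases s with _ | _ | s
  · exact h.zero
  · have hp : parts 2 = [3] := by decide +kernel
    have hlead' : coeffKey 3 (P 1) = 1 := hlead
    have j3 : godel jet 3 = u 2 := jet_prime (i := 1) rfl
    have := h.expand 1 le_rfl (by norm_num)
    rw [this, hp]
    simp [hlead', j3, burgers]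
  · exact h.eq_zero_of_coeffKey (by omega) (by omega) fun n hn =>
      h.coeffKey_eq_zero_of_burgers hlead (by omega) hs hn

end

/-- The classification of the deformations of the dispersionless Burgers equation of double
ramification type. -/
theorem IsDRType.classification {X : LocalVectorField} (hX : IsDRType X)
    (h0 : varTheta X 0 = u 0 * u 1)
    (hq : (∃ s : ℕ, 1 ≤ s ∧ s ≤ 9 ∧ varTheta X s ≠ 0) →
      ∃ s : ℕ, 1 ≤ s ∧ s ≤ 9 ∧ quasilinearCoeff (varTheta X) s ≠ 0) :
    (∃ C11 C21 C22 C31 C32 C41 C42 : ℂ, C11 ≠ 0 ∧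
      ∀ s : ℕ, s ≤ 9 → varTheta X s = dKdV C11 C21 C22 C31 C32 C41 C42 s) ∨
    ∃ C : ℂ, ∀ s : ℕ, s ≤ 9 → varTheta X s = burgers C s := by
  classical
  by_cases hall : ∀ s : ℕ, 1 ≤ s → s ≤ 9 → varTheta X s = 0
  · refine Or.inr ⟨0, fun s hs => ?_⟩
    rcases s with _ | _ | s
    · exact h0
    · rw [hall 1 le_rfl hs, burgers, zero_smul]
    · simp [hall _ (by omega : 1 ≤ s + 1 + 1) hs, burgers]
  push Not at hall
  have hex := hq hall
  obtain ⟨W, hW⟩ := hX.exists_isReducedSol h0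
  obtain ⟨t, ⟨ht1, ht9, hta⟩, hmin⟩ : ∃ t, (1 ≤ t ∧ t ≤ 9 ∧ quasilinearCoeff (varTheta X) t ≠ 0) ∧
      ∀ s, s < t → ¬(1 ≤ s ∧ s ≤ 9 ∧ quasilinearCoeff (varTheta X) s ≠ 0) :=
    ⟨Nat.find hex, Nat.find_spec hex, fun s hs => Nat.find_min hex hs⟩
  rw [hX.quasilinearCoeff_ne_zero ht1] at hta
  have hlow : ∀ s, 1 ≤ s → s < t → coeffKey (prime s) (varTheta X s) = 0 := by
    intro s hs hst
    by_contra hne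
    exact hmin s hst ⟨hs, by omega, (hX.quasilinearCoeff_ne_zero hs).mpr hne⟩
  -- Replacing `ε` by `lε` makes the first nonzero quasilinear coefficient, a constant by condition
  -- (b), equal to one.
  obtain ⟨l, hl⟩ := IsAlgClosed.exists_pow_nat_eq (coeffKey (prime t) (varTheta X t))⁻¹
    (show 0 < t by omega)
  have hl0 : l ≠ 0 := by
    rintro rfl
    rw [zero_pow (by omega)] at hl
    exact inv_ne_zero hta hl.symm
  have hR := hW.pow_smul l
  have hlead : coeffKey (prime t) (l ^ t • varTheta X t) = 1 := by
    rw [coeffKey_smul, hl, inv_mul_cancel₀ hta]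
  have hlow' : ∀ s, 1 ≤ s → s < t → coeffKey (prime s) (l ^ s • varTheta X s) = 0 := by
    intro s hs hst
    rw [coeffKey_smul, hlow s hs hst, mul_zero]
  have hback : ∀ (s : ℕ) (f : DiffPoly), l ^ s • varTheta X s = f → varTheta X s = l⁻¹ ^ s • f := by
    rintro s f rfl
    rw [smul_smul, ← mul_pow, inv_mul_cancel₀ hl0, one_pow, one_smul]
  obtain rfl | rfl | ht3 : t = 1 ∨ t = 2 ∨ 3 ≤ t := by omega
  · refine Or.inr ⟨l⁻¹, fun s hs => ?_⟩
    rw [hback s _ (hR.eq_burgers hlead hs)]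
    rcases s with _ | _ | s <;> simp [burgers]
  · refine Or.inl ?_
    set v := familyVal fun s => l ^ s • varTheta X s
    have hi : l⁻¹ ≠ 0 := inv_ne_zero hl0
    have key := eqOf_familyTerms v hi (8400 * l⁻¹ ^ 4 * v 2) (8400 * l⁻¹ ^ 4 * v 3)
      (8400 * l⁻¹ ^ 6 * v 5) (8400 * l⁻¹ ^ 6 * v 7) (8400 * l⁻¹ ^ 8 * v 11) (8400 * l⁻¹ ^ 8 * v 13)
      (by field_simp) (by field_simp) (by field_simp) (by field_simp) (by field_simp) (by field_simp)
    exact ⟨_, _, _, _, _, _, _, pow_ne_zero 2 hi, fun s hs =>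
      (hback s _ (hR.eq_family hlead (hlow' 1 le_rfl one_lt_two) hs)).trans (congrFun key s)⟩
  · exact (hR.false_of_leading ht3 ht9 hlead hlow').elim

end
end DRHierarchy

namespace DRHierarchy
open Finset.HasAntidiagonal (antidiagonal)
open PowerSeries (X coeff derivative)

noncomputable section

/-! ### The Burgers hierarchy -/

/-- Coefficientwise extension of a derivation to formal power series. -/
def liftDer (D : Derivation ℂ DiffPoly DiffPoly) :
    Derivation ℂ (PowerSeries DiffPoly) (PowerSeries DiffPoly) :=
  Derivation.mk'
    { toFun := fun f => PowerSeries.mk fun n => D (coeff n f)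
      map_add' := fun f g => by ext1 n; simp
      map_smul' := fun c f => by ext1 n; simp }
    (fun f g => by
      ext1 n
      simp only [LinearMap.coe_mk, AddHom.coe_mk, PowerSeries.coeff_mk, PowerSeries.coeff_mul,
        smul_eq_mul, map_add, map_sum, Derivation.leibniz, Finset.sum_add_distrib]
      congr 1
      exact Finset.sum_equiv (Equiv.prodComm _ _) (fun x => by simp [add_comm]) (fun x _ => rfl))

@[simp] theorem coeff_liftDer (D : Derivation ℂ DiffPoly DiffPoly) (f : PowerSeries DiffPoly) (n : ℕ) :
    coeff n (liftDer D f) = D (coeff n f) :=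
  PowerSeries.coeff_mk n fun n => D (coeff n f)

theorem coeff_derivative_eq_smul (f : PowerSeries DiffPoly) (n : ℕ) :
    coeff n (derivative DiffPoly f) = ((n : ℂ) + 1) • coeff (n + 1) f := by
  rw [PowerSeries.coeff_derivative, Algebra.smul_def, mul_comm]
  simp

theorem derivative_liftDer (D : Derivation ℂ DiffPoly DiffPoly) (f : PowerSeries DiffPoly) :
    derivative DiffPoly (liftDer D f) = liftDer D (derivative DiffPoly f) := by
  ext1 n
  simp [coeff_derivative_eq_smul]

theorem liftDer_X_pow_mul (D : Derivation ℂ DiffPoly DiffPoly) (b : ℕ) (f : PowerSeries DiffPoly) :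
    liftDer D (X ^ b * f) = X ^ b * liftDer D f := by
  ext1 n
  rw [coeff_liftDer, PowerSeries.coeff_X_pow_mul', PowerSeries.coeff_X_pow_mul']
  split_ifs <;> simp

section
variable (C : ℂ)

/-- The coefficients of `exp (-C z)`. -/
def expCoeff (b : ℕ) : ℂ := (-C) ^ b / b.factorial

theorem expCoeff_succ (b : ℕ) : ((b : ℂ) + 1) * expCoeff C (b + 1) = -C * expCoeff C b := by
  have h : ((b : ℂ) + 1) ≠ 0 := by exact_mod_cast b.succ_ne_zero
  have h' : (b.factorial : ℂ) ≠ 0 := by exact_mod_cast b.factorial_ne_zero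
  rw [expCoeff, expCoeff, Nat.factorial_succ, pow_succ]
  push_cast
  field_simp

/-- The coefficient of `z ^ n` in `f(z) exp (-C z ∂_x) θ_{i+1}`, where `∂_x` acts on `θ_{i+1}`
only. -/
def expShift (i : ℕ) (f : PowerSeries DiffPoly) (n : ℕ) : Dens :=
  ∑ b ∈ Finset.range (n + 1), Finsupp.single (b + 1 + i) (expCoeff C b • coeff n (X ^ b * f))

variable {C}

theorem expShift_eq {i n N : ℕ} (hN : n < N) (f : PowerSeries DiffPoly) : expShift C i f n =
    ∑ b ∈ Finset.range N, Finsupp.single (b + 1 + i) (expCoeff C b • coeff n (X ^ b * f)) := by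
  refine Finset.sum_subset (Finset.range_subset_range.mpr hN) fun b _ hb => ?_
  rw [PowerSeries.coeff_X_pow_mul', if_neg (by simpa using hb), smul_zero, Finsupp.single_zero]

theorem expShift_add (i : ℕ) (f g : PowerSeries DiffPoly) (n : ℕ) :
    expShift C i (f + g) n = expShift C i f n + expShift C i g n := by
  simp only [expShift, mul_add, map_add, smul_add, Finsupp.single_add, Finset.sum_add_distrib]

theorem expShift_smul (i : ℕ) (c : ℂ) (f : PowerSeries DiffPoly) (n : ℕ) :
    expShift C i (c • f) n = c • expShift C i f n := by
  simp only [expShift, mul_smul_comm, Finset.smul_sum, Finsupp.smul_single, smul_comm c]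
  simp

theorem dxDens_expShift (i : ℕ) (f : PowerSeries DiffPoly) (n : ℕ) :
    dxDens (expShift C i f n) = expShift C i (liftDer dx f) n + expShift C (i + 1) f n := by
  simp only [expShift, map_sum, dxDens_single, Finset.sum_add_distrib, Derivation.map_smul,
    ← liftDer_X_pow_mul, coeff_liftDer]
  rfl

/-- Product rule for `d/dz` on `f(z) exp(-Cz∂_x) θ_{i+1}`; the exponential contributes `-C ∂_x`,
which raises `i`. -/
theorem succ_smul_expShift (i : ℕ) (f : PowerSeries DiffPoly) (n : ℕ) :
    ((n : ℂ) + 1) • expShift C i f (n + 1) =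
      expShift C i (derivative DiffPoly f) n - C • expShift C (i + 1) f n := by
  have h : ∀ b : ℕ, ((n : ℂ) + 1) • coeff (n + 1) (X ^ b * f) =
      coeff n (X ^ b * derivative DiffPoly f) + (b : ℂ) • coeff n (X ^ (b - 1) * f) := by
    intro b
    rw [← coeff_derivative_eq_smul, Derivation.leibniz, map_add, PowerSeries.derivative_pow,
      ← PowerSeries.coeff_smul]
    congr 2
    rw [PowerSeries.derivative_X, mul_one, smul_eq_mul, mul_comm f, mul_assoc, Nat.cast_smul_eq_nsmul,
      nsmul_eq_mul]
  rw [expShift_eq (N := n + 2) (by omega) (derivative DiffPoly f), expShift, Finset.smul_sum]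
  simp only [Finsupp.smul_single, smul_comm ((n : ℂ) + 1), h, smul_add, Finsupp.single_add,
    Finset.sum_add_distrib]
  rw [sub_eq_add_neg]
  congr 1
  rw [Finset.sum_range_succ']
  simp only [Nat.cast_zero, zero_smul, smul_zero, Finsupp.single_zero, add_zero, Nat.add_sub_cancel,
    smul_smul, Nat.cast_add, Nat.cast_one]
  rw [← neg_smul, expShift, Finset.smul_sum]
  refine Finset.sum_congr rfl fun b _ => ?_
  rw [Finsupp.smul_single, smul_smul, mul_comm, expCoeff_succ, show b + 1 + 1 + i = b + 1 + (i + 1) by omega]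

theorem sum_smul_expShift (i : ℕ) (f g : PowerSeries DiffPoly) (n : ℕ) :
    ∑ p ∈ antidiagonal n, coeff p.1 f • expShift C i g p.2 = expShift C i (f * g) n := by
  have h : ∀ p ∈ antidiagonal n, coeff p.1 f • expShift C i g p.2 =
      ∑ b ∈ Finset.range (n + 1),
        Finsupp.single (b + 1 + i) (expCoeff C b • (coeff p.1 f * coeff p.2 (X ^ b * g))) := by
    intro p hp
    have hp' := Finset.HasAntidiagonal.mem_antidiagonal.mp hp
    rw [expShift_eq (N := n + 1) (by omega), Finset.smul_sum]
    simp only [Finsupp.smul_single, smul_eq_mul, mul_smul_comm]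
  rw [Finset.sum_congr rfl h, Finset.sum_comm, expShift]
  refine Finset.sum_congr rfl fun b _ => ?_
  rw [← Finsupp.single_finsetSum, ← Finset.smul_sum, mul_left_comm, PowerSeries.coeff_mul]

/-! ### The exponentials -/

variable (C) in
/-- `(sinh (C z ∂_x) / C ∂_x) u`. -/
def sinhInt : PowerSeries DiffPoly := PowerSeries.mk fun n =>
  if n % 2 = 1 then (C ^ (n - 1) / n.factorial) • u (n - 1) else 0

variable (C) in
/-- `cosh (C z ∂_x) u`. -/
def coshU : PowerSeries DiffPoly := PowerSeries.mk fun n =>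
  if n % 2 = 1 then 0 else (C ^ n / n.factorial) • u n

theorem factorial_succ_smul (n : ℕ) (c : ℂ) :
    ((n : ℂ) + 1) * (c / (n + 1).factorial) = c / n.factorial := by
  have h : ((n : ℂ) + 1) ≠ 0 := by exact_mod_cast n.succ_ne_zero
  have h' : (n.factorial : ℂ) ≠ 0 := by exact_mod_cast n.factorial_ne_zero
  rw [Nat.factorial_succ]
  push_cast
  field_simp

theorem derivative_sinhInt : derivative DiffPoly (sinhInt C) = coshU C := by
  ext1 n
  rw [coeff_derivative_eq_smul, sinhInt, coshU, PowerSeries.coeff_mk, PowerSeries.coeff_mk]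
  rcases Nat.mod_two_eq_zero_or_one n with h | h
  · rw [if_pos (by omega), if_neg (by omega), smul_smul, factorial_succ_smul, Nat.add_sub_cancel]
  · rw [if_neg (by omega), if_pos h, smul_zero]

theorem derivative_coshU :
    derivative DiffPoly (coshU C) = C ^ 2 • liftDer dx (liftDer dx (sinhInt C)) := by
  ext1 n
  rw [coeff_derivative_eq_smul, PowerSeries.coeff_smul, coeff_liftDer, coeff_liftDer, sinhInt, coshU,
    PowerSeries.coeff_mk, PowerSeries.coeff_mk]
  rcases Nat.mod_two_eq_zero_or_one n with h | h
  · rw [if_pos (by omega), if_neg (by omega), smul_zero]; simp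
  · obtain ⟨n, rfl⟩ : ∃ k, n = k + 1 := ⟨n - 1, by omega⟩
    rw [if_neg (by omega), if_pos h, smul_smul, factorial_succ_smul]
    simp only [Derivation.map_smul, dx_u, smul_smul, Nat.add_sub_cancel]
    congr 1
    ring

theorem derivative_smul_complex (c : ℂ) (f : PowerSeries DiffPoly) :
    derivative DiffPoly (c • f) = c • derivative DiffPoly f := by
  ext1 n
  simp only [coeff_derivative_eq_smul, PowerSeries.coeff_smul, smul_comm c]

variable (C) in
/-- `exp (-C z ∂_x) u`. -/
def expNegU : PowerSeries DiffPoly := coshU C - C • liftDer dx (sinhInt C)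

theorem coeff_expNegU (n : ℕ) : coeff n (expNegU C) = expCoeff C n • u n := by
  rw [expNegU, map_sub, PowerSeries.coeff_smul, coeff_liftDer, sinhInt, coshU,
    PowerSeries.coeff_mk, PowerSeries.coeff_mk, expCoeff]
  rcases Nat.mod_two_eq_zero_or_one n with h | h
  · rw [if_neg (by omega), if_neg (by omega), map_zero, smul_zero, sub_zero,
      Even.neg_pow (Nat.even_iff.mpr h)]
  · obtain ⟨n, rfl⟩ : ∃ k, n = k + 1 := ⟨n - 1, by omega⟩
    rw [if_pos h, if_pos h, zero_sub, Derivation.map_smul, dx_u, smul_smul, ← neg_smul,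
      Odd.neg_pow (Nat.odd_iff.mpr h), Nat.add_sub_cancel, pow_succ]
    congr 1
    ring

theorem derivative_expNegU : derivative DiffPoly (expNegU C) = -(C • liftDer dx (expNegU C)) := by
  rw [expNegU, map_sub, map_sub, derivative_smul_complex, derivative_coshU, derivative_liftDer,
    derivative_sinhInt, Derivation.map_smul, smul_sub, smul_smul, pow_two]
  abel

/-- `C_b ∂_x^b (u θ_1)`. -/
theorem expCoeff_smul_iterate (b : ℕ) :
    expCoeff C b • dxDens^[b] (Finsupp.single 1 (u 0)) = expShift C 0 (expNegU C) b := by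
  induction b with
  | zero =>
    have h := coeff_expNegU (C := C) 0
    simp only [PowerSeries.coeff_zero_eq_constantCoeff] at h
    simp [expShift, h, expCoeff]
  -- The claim is `exp(-Cz∂_x)(u θ_1) = (exp(-Cz∂_x) u)(exp(-Cz∂_x) θ_1)`, multiplicativity of the
  -- exponential of a derivation. Both sides solve `dF/dz = -C ∂_x F`.
  | succ b ih =>
    have hb : ((b : ℂ) + 1) ≠ 0 := by exact_mod_cast b.succ_ne_zero
    refine smul_right_injective Dens hb ?_
    show ((b : ℂ) + 1) • _ = ((b : ℂ) + 1) • _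
    rw [succ_smul_expShift, smul_smul, expCoeff_succ, Function.iterate_succ_apply', ← smul_smul,
      ← map_smul, ih, dxDens_expShift, derivative_expNegU, ← neg_smul, expShift_smul, smul_add,
      neg_smul, neg_smul, sub_eq_add_neg]

/-! ### The flows -/

theorem euler_u_two : euler (u 2) = Finsupp.single 2 1 := by
  rw [euler, varU₀_single (N := 3)]
  · have h1 : dx (1 : DiffPoly) = 0 := Derivation.map_one_eq_zero dx
    simp [Finset.sum_range_succ, partialU_u, neg_dxDens_pow_two, dxDens_single, h1]
  · intro k hk
    rw [partialU_u, if_neg (by omega)]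

theorem iterate_dxDens_single_one (k j : ℕ) :
    dxDens^[k] (Finsupp.single j 1) = Finsupp.single (k + j) 1 := by
  have h1 : dx (1 : DiffPoly) = 0 := Derivation.map_one_eq_zero dx
  induction k with
  | zero => rw [zero_add]; rfl
  | succ k ih =>
    rw [Function.iterate_succ_apply', ih, dxDens_single, h1, Finsupp.single_zero, zero_add]
    congr 1
    omega

theorem flow_u_two_expShift (i : ℕ) (f : PowerSeries DiffPoly) (n : ℕ) :
    flow (u 2) (expShift C i f n) =
      expShift C i (liftDer (evo fun k => dx^[k] (u 2)) f) n - expShift C (i + 2) f n := by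
  rw [flow, expShift, act_sum, expShift, expShift, ← Finset.sum_sub_distrib]
  refine Finset.sum_congr rfl fun b _ => ?_
  rw [act_single, Derivation.map_smul, ← liftDer_X_pow_mul, coeff_liftDer, euler_u_two,
    iterate_dxDens_single_one, Finsupp.smul_single, smul_eq_mul, mul_one]
  rfl

/-- Since `δ/δu` of `u u_1` is `-u θ_1`, the flow sends `θ_{b+1}` to `∂_x^{b+1}(u θ_1)`. Summed
against `exp(-Cz∂_x)` this gives `∂_x` of the product of exponentials, whose two Leibniz terms are
the last two terms. -/
theorem flow_u_mul_u_one_expShift (f : PowerSeries DiffPoly) (n : ℕ) :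
    flow (u 0 * u 1) (expShift C 0 f n) =
      expShift C 0 (liftDer (evo fun k => dx^[k] (u 0 * u 1)) f + f * liftDer dx (expNegU C)) n
        + expShift C 1 (f * expNegU C) n := by
  rw [expShift_add, add_assoc, ← sum_smul_expShift, ← sum_smul_expShift, ← Finset.sum_add_distrib,
    ← Finset.Nat.sum_antidiagonal_swap]
  simp only [Prod.fst_swap, Prod.snd_swap, ← smul_add, ← dxDens_expShift]
  rw [Finset.Nat.sum_antidiagonal_eq_sum_range_succ_mk]
  rw [flow, expShift, act_sum, expShift, ← Finset.sum_add_distrib]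
  refine Finset.sum_congr rfl fun b hb => ?_
  rw [act_single, Derivation.map_smul, ← liftDer_X_pow_mul, coeff_liftDer, sub_eq_add_neg]
  congr 1
  have h : ∀ k G, dxDens^[k] (-G) = -dxDens^[k] G := fun k G => iterate_map_neg dxDens k G
  rw [euler_u_mul_u_one, h, smul_neg, neg_neg, ← expCoeff_smul_iterate, map_smul,
    ← Function.iterate_succ_apply' dxDens, PowerSeries.coeff_X_pow_mul',
    if_pos (Nat.lt_succ_iff.mp (Finset.mem_range.mp hb)), smul_assoc, smul_comm]

end
end
end DRHierarchy

namespace DRHierarchy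
open Finset.HasAntidiagonal (antidiagonal)
open PowerSeries (X coeff derivative)

noncomputable section

/-! ### The recursion for the Burgers equation -/

section
variable {C : ℂ}

theorem evo_iterate_dx (f g : DiffPoly) :
    evo (fun k => dx^[k] f) (dx g) = dx (evo (fun k => dx^[k] f) g) :=
  evo_dx _ (fun _ => Function.iterate_succ_apply' _ _ _) g

theorem liftDer_evo_dx (h : DiffPoly) (f : PowerSeries DiffPoly) :
    liftDer (evo fun k => dx^[k] h) (liftDer dx f) = liftDer dx (liftDer (evo fun k => dx^[k] h) f) := by
  ext1 n
  simp only [coeff_liftDer, evo_iterate_dx]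

/-- The derivative of `(sinh (C z ∂_x) / C ∂_x) u` along the dispersionless Burgers equation. -/
theorem liftDer_u_mul_u_one_sinhInt :
    liftDer (evo fun k => dx^[k] (u 0 * u 1)) (sinhInt C) = coshU C * liftDer dx (sinhInt C) := by
  set E := liftDer (evo fun k => dx^[k] (u 0 * u 1)) with hE
  have comm : ∀ f, E (liftDer dx f) = liftDer dx (E f) := liftDer_evo_dx _
  -- The difference `S` of the two sides satisfies `d²S/dz² = C² ∂_x² S` with zero value and zero
  -- derivative `Q` at `z = 0`, so all its coefficients vanish.
  set S := E (sinhInt C) - coshU C * liftDer dx (sinhInt C) with hS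
  set Q := E (coshU C) - (coshU C * liftDer dx (coshU C) +
    C ^ 2 • (liftDer dx (sinhInt C) * liftDer dx (liftDer dx (sinhInt C)))) with hQ
  have h1 : derivative DiffPoly S = Q := by
    rw [hS, hQ, map_sub, hE, derivative_liftDer, derivative_sinhInt, Derivation.leibniz,
      derivative_liftDer, derivative_sinhInt, derivative_coshU, smul_eq_mul, smul_eq_mul,
      mul_smul_comm]
  have h2 : derivative DiffPoly Q = C ^ 2 • liftDer dx (liftDer dx S) := by
    rw [hS, hQ, map_sub, map_add, derivative_smul_complex, hE, derivative_liftDer, ← hE,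
      Derivation.leibniz, Derivation.leibniz, derivative_liftDer, derivative_liftDer,
      derivative_liftDer, derivative_sinhInt, derivative_coshU]
    simp only [Derivation.map_smul, Derivation.map_sub, Derivation.leibniz, map_add, smul_eq_mul,
      comm, mul_smul_comm, ← smul_add, ← smul_sub]
    rw [mul_comm (liftDer dx (coshU C)) (liftDer dx (liftDer dx (sinhInt C)))]
  have key : ∀ n, coeff n S = 0 ∧ coeff n Q = 0 := by
    intro n
    induction n with
    | zero =>
      have hc : ∀ (D : Derivation ℂ DiffPoly DiffPoly) (f : PowerSeries DiffPoly),
          PowerSeries.constantCoeff (liftDer D f) = D (PowerSeries.constantCoeff f) := fun D f => by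
        rw [← PowerSeries.coeff_zero_eq_constantCoeff_apply, coeff_liftDer,
          PowerSeries.coeff_zero_eq_constantCoeff_apply]
      have hV : PowerSeries.constantCoeff (sinhInt C) = 0 := by
        rw [← PowerSeries.coeff_zero_eq_constantCoeff_apply, sinhInt, PowerSeries.coeff_mk]
        exact if_neg (by norm_num)
      have hv : PowerSeries.constantCoeff (coshU C) = u 0 := by
        rw [← PowerSeries.coeff_zero_eq_constantCoeff_apply, coshU, PowerSeries.coeff_mk]
        simp
      refine ⟨?_, ?_⟩
      · simp [hS, hE, hc, hV, hv]
      · simp [hQ, hE, hc, hV, hv]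
    | succ n ih =>
      have hn : ((n : ℂ) + 1) ≠ 0 := by exact_mod_cast n.succ_ne_zero
      refine ⟨(smul_eq_zero.mp ?_).resolve_left hn, (smul_eq_zero.mp ?_).resolve_left hn⟩
      · rw [← coeff_derivative_eq_smul, h1, ih.2]
      · rw [← coeff_derivative_eq_smul, h2, PowerSeries.coeff_smul, coeff_liftDer, coeff_liftDer,
          ih.1, map_zero, map_zero, smul_zero]
  rw [← sub_eq_zero, ← hS]
  ext1 n
  rw [(key n).1, map_zero]

theorem liftDer_u_two_sinhInt : liftDer (evo fun k => dx^[k] (u 2)) (sinhInt C) =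
    liftDer dx (liftDer dx (sinhInt C)) := by
  ext1 n
  have h : ∀ k, dx^[k] (u 2) = u (k + 2) := by
    intro k
    induction k with
    | zero => rw [zero_add]; rfl
    | succ k ih => rw [Function.iterate_succ_apply', ih, dx_u]
  simp only [coeff_liftDer, sinhInt, PowerSeries.coeff_mk]
  split_ifs
  · rw [Derivation.map_smul, Derivation.map_smul, Derivation.map_smul, evo_u, h, dx_u, dx_u]
  · simp

variable (C) in
/-- The divided powers of `(sinh (C z ∂_x) / C ∂_x) u`. -/
def sinhPow (m : ℕ) : PowerSeries DiffPoly := ((m.factorial : ℂ)⁻¹) • sinhInt C ^ m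

theorem inv_factorial_smul (m : ℕ) (f g : PowerSeries DiffPoly) :
    (((m + 1).factorial : ℂ)⁻¹) • ((m + 1) • f ^ m • g) = ((m.factorial : ℂ)⁻¹) • (f ^ m) * g := by
  have h : ((m : ℂ) + 1) ≠ 0 := by exact_mod_cast m.succ_ne_zero
  rw [← Nat.cast_smul_eq_nsmul ℂ, smul_smul, Nat.factorial_succ, smul_eq_mul, smul_mul_assoc]
  congr 1
  push_cast
  field_simp

theorem liftDer_sinhPow (D : Derivation ℂ DiffPoly DiffPoly) (m : ℕ) :
    liftDer D (sinhPow C (m + 1)) = sinhPow C m * liftDer D (sinhInt C) := by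
  rw [sinhPow, Derivation.map_smul, Derivation.leibniz_pow, Nat.add_sub_cancel, inv_factorial_smul,
    sinhPow]

theorem derivative_sinhPow (m : ℕ) :
    derivative DiffPoly (sinhPow C (m + 1)) = sinhPow C m * coshU C := by
  rw [sinhPow, derivative_smul_complex, Derivation.leibniz_pow, Nat.add_sub_cancel,
    inv_factorial_smul, derivative_sinhInt, sinhPow]

theorem sinhPow_zero : sinhPow C 0 = 1 := by simp [sinhPow]

theorem expShift_zero (i n : ℕ) : expShift C i 0 n = 0 := by simp [expShift]

theorem burgers_rec_zero (n : ℕ) :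
    ((n : ℂ) + 1) • dxDens (expShift C 0 (sinhPow C 0) (n + 1)) =
      C • flow (u 2) (expShift C 0 (sinhPow C 0) n) := by
  rw [← map_smul, succ_smul_expShift, flow_u_two_expShift, map_sub, map_smul, dxDens_expShift,
    dxDens_expShift, sinhPow_zero]
  simp [expShift_zero]

/-- A component of `∂_x dY/dz = [X̄, Y]`, the form of the recursion when `D-1` acts as `z d/dz`.
With `V = sinhInt C`, it reduces to the derivatives of `V` along the two flows and to `exp(-Cz∂_x) u
= dV/dz - C ∂_x V`. -/
theorem burgers_rec_succ (m n : ℕ) :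
    ((n : ℂ) + 1) • dxDens (expShift C 0 (sinhPow C (m + 1)) (n + 1)) =
      flow (u 0 * u 1) (expShift C 0 (sinhPow C m) n) +
        C • flow (u 2) (expShift C 0 (sinhPow C (m + 1)) n) := by
  rw [← map_smul, succ_smul_expShift, flow_u_two_expShift, flow_u_mul_u_one_expShift, map_sub,
    map_smul, dxDens_expShift, dxDens_expShift, liftDer_sinhPow, liftDer_sinhPow,
    derivative_sinhPow, liftDer_u_two_sinhInt]
  have h0 : liftDer dx (sinhPow C m * coshU C) =
      liftDer (evo fun k => dx^[k] (u 0 * u 1)) (sinhPow C m) +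
        sinhPow C m * liftDer dx (expNegU C) +
        C • (sinhPow C m * liftDer dx (liftDer dx (sinhInt C))) := by
    rw [Derivation.leibniz, expNegU, map_sub, Derivation.map_smul]
    rcases m with _ | m
    · rw [sinhPow_zero]
      simp
    · rw [liftDer_sinhPow, liftDer_sinhPow, liftDer_u_mul_u_one_sinhInt]
      simp only [smul_eq_mul, mul_sub, mul_smul_comm]
      ring
  have h1 : sinhPow C m * coshU C = sinhPow C m * expNegU C +
      C • (sinhPow C m * liftDer dx (sinhInt C)) := by
    rw [expNegU, mul_sub, mul_smul_comm, sub_add_cancel]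
  rw [h0, h1]
  rw [expShift_add _ (_ + _) (C • _), expShift_add _ _ (C • _), expShift_smul, expShift_smul, smul_add, smul_sub]
  abel

/-! ### Homogeneity of the Burgers hierarchy -/

theorem coeff_sinhPow_mem_pol (m n : ℕ) : coeff n (sinhPow C m) ∈ weightGrading.pol (n - m) := by
  induction m generalizing n with
  | zero =>
    rw [sinhPow_zero, PowerSeries.coeff_one]
    split_ifs with hn
    · subst hn
      intro m i h
      rw [MvPolynomial.coeff_one] at h
      split_ifs at h with hm
      · subst hm
        rw [PowerSeries.coeff_one] at h
        split_ifs at h with hi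
        · subst hi
          rw [weightGrading_ok]
          simp [Grading.level]
        · exact absurd rfl h
      · simp at h
    · exact zero_mem _
  | succ m ih =>
    have h : sinhPow C (m + 1) = ((m : ℂ) + 1)⁻¹ • (sinhPow C m * sinhInt C) := by
      have h : ((m : ℂ) + 1) ≠ 0 := by exact_mod_cast m.succ_ne_zero
      rw [sinhPow, sinhPow, Nat.factorial_succ, pow_succ, smul_mul_assoc, smul_smul]
      push_cast
      rw [mul_inv]
    rw [h, PowerSeries.coeff_smul, PowerSeries.coeff_mul]
    refine Submodule.smul_mem _ _ (Submodule.sum_mem _ fun p hp => ?_)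
    have hp := Finset.HasAntidiagonal.mem_antidiagonal.mp hp
    have hV : coeff p.2 (sinhInt C) ∈ weightGrading.pol (p.2 - 1) := by
      rw [sinhInt, PowerSeries.coeff_mk]
      split_ifs with hodd
      · obtain ⟨k, hk⟩ : ∃ k, p.2 = k + 1 := ⟨p.2 - 1, by omega⟩
        rw [hk, Nat.add_sub_cancel]
        have := weightGrading.u_mem_pol k
        refine Submodule.smul_mem _ _ ?_
        rwa [show ((k + 1 : ℕ) : ℤ) - 1 = weightGrading.t + weightGrading.δ * k by simp]
      · exact zero_mem _
    refine Grading.mul_mem_pol (ih p.1) hV (weightGrading_ok.mpr ?_)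
    rw [← hp]
    push_cast
    ring

theorem countU_coeff_sinhPow (m n : ℕ) :
    countU (coeff n (sinhPow C m)) = (m : ℂ) • coeff n (sinhPow C m) := by
  have hV : liftDer countU (sinhInt C) = sinhInt C := by
    ext1 n
    rw [coeff_liftDer, sinhInt, PowerSeries.coeff_mk]
    split_ifs
    · rw [Derivation.map_smul, countU_u]
    · rw [map_zero]
  have h : liftDer countU (sinhPow C m) = (m : ℂ) • sinhPow C m := by
    rcases m with _ | m
    · rw [sinhPow_zero]; simp
    · have h : ((m : ℂ) + 1) ≠ 0 := by exact_mod_cast m.succ_ne_zero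
      rw [liftDer_sinhPow, hV, sinhPow, sinhPow, Nat.factorial_succ, pow_succ, smul_mul_assoc,
        smul_smul]
      congr 1
      push_cast
      field_simp
  rw [← coeff_liftDer, h, PowerSeries.coeff_smul]

variable (C) in
/-- The hierarchy of the Burgers equation. -/
def burgersHierarchy (n : ℕ) : Density := fun s =>
  -- In `-exp(ε⁻¹ V(εz)) exp(-Cεz∂_x) θ_1` a term with `m` factors `V` and `zⁿ` carries `ε^{n-m}`,
  -- hence `m = n - s`.
  if s ≤ n then -expShift C 0 (sinhPow C (n - s)) n else 0

theorem burgersHierarchy_hasDegree (n : ℕ) : HasDegree 1 (burgersHierarchy C n) := by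
  rw [hasDegree_iff]
  intro s
  rw [burgersHierarchy]
  split_ifs with hs
  · refine Submodule.neg_mem _ (Submodule.sum_mem _ fun b hb => ?_)
    rw [PowerSeries.coeff_X_pow_mul', if_pos (Nat.lt_succ_iff.mp (Finset.mem_range.mp hb))]
    refine Grading.single_mem_den _ (Submodule.smul_mem _ _ (coeff_sinhPow_mem_pol _ _))
      (weightGrading_ok.mpr ?_)
    have hb := Nat.lt_succ_iff.mp (Finset.mem_range.mp hb)
    push_cast [hs, hb]
    ring
  · exact zero_mem _

theorem burgersHierarchy_zero : burgersHierarchy C 0 = -theta 1 := by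
  ext1 s
  rcases s with _ | s
  · simp [burgersHierarchy, expShift, sinhPow_zero, theta, expCoeff]
  · simp [burgersHierarchy, theta]

/-- There are `n - s` factors linear in `u`, and the order in `ε` adds `s`. -/
theorem dm_burgersHierarchy (n s : ℕ) :
    dm s (burgersHierarchy C n s) = (n : ℂ) • burgersHierarchy C n s := by
  rw [burgersHierarchy]
  split_ifs with hs
  · have h : evoDens u (expShift C 0 (sinhPow C (n - s)) n) =
        ((n - s : ℕ) : ℂ) • expShift C 0 (sinhPow C (n - s)) n := by
      rw [expShift, map_sum, Finset.smul_sum]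
      refine Finset.sum_congr rfl fun b hb => ?_
      rw [PowerSeries.coeff_X_pow_mul', if_pos (Nat.lt_succ_iff.mp (Finset.mem_range.mp hb)),
        Finsupp.smul_single, smul_comm, ← countU_coeff_sinhPow, ← Derivation.map_smul]
      exact Finsupp.mapRange_single (hf := map_zero (evo u))
    rw [map_neg, dm_apply, h, ← add_smul, Nat.cast_sub hs, sub_add_cancel, smul_neg]
  · rw [map_zero, smul_zero]

/-- `V` is divisible by `z`, so its `m`-th power has no terms below `z^m`. -/
theorem expShift_eq_zero {i m n : ℕ} (h : n < m) : expShift C i (sinhPow C m) n = 0 := by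
  have hV : X ∣ sinhInt C := by
    rw [PowerSeries.X_dvd_iff, ← PowerSeries.coeff_zero_eq_constantCoeff_apply, sinhInt,
      PowerSeries.coeff_mk]
    exact if_neg (by norm_num)
  refine Finset.sum_eq_zero fun b _ => ?_
  have hd : X ^ m ∣ X ^ b * sinhPow C m := by
    rw [sinhPow, mul_smul_comm]
    obtain ⟨g, hg⟩ := pow_dvd_pow_of_dvd hV m
    exact ⟨((m.factorial : ℂ)⁻¹) • (X ^ b * g), by rw [hg, mul_smul_comm, mul_left_comm]⟩
  rw [PowerSeries.X_pow_dvd_iff.mp hd n h, smul_zero, Finsupp.single_zero]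

theorem dxDens_dm_burgersHierarchy (n s : ℕ) : dxDens (dm s (burgersHierarchy C (n + 1) s)) =
    ∑ p ∈ antidiagonal s, flow (burgers C p.1) (burgersHierarchy C n p.2) := by
  have h0 : ∀ f, flow f 0 = 0 := fun f => act_zero _ _
  have hneg : ∀ f G, flow f (-G) = -flow f G := fun f G => act_neg _ _ G
  have hB : ∀ s, burgers C (s + 2) = 0 := fun s => by simp [burgers]
  rw [dm_burgersHierarchy, Nat.cast_add, Nat.cast_one, map_smul]
  rcases s with _ | s
  · rw [Finset.Nat.antidiagonal_zero, Finset.sum_singleton]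
    simp only [burgersHierarchy, zero_le, if_true, Nat.sub_zero, burgers, hneg, map_neg, smul_neg]
    rw [burgers_rec_succ, expShift_eq_zero (Nat.lt_succ_self n), h0, smul_zero, add_zero]
  · have hsum : ∑ p ∈ antidiagonal (s + 1), flow (burgers C p.1) (burgersHierarchy C n p.2) =
        flow (burgers C 0) (burgersHierarchy C n (s + 1)) +
          flow (burgers C 1) (burgersHierarchy C n s) := by
      rw [Finset.Nat.sum_antidiagonal_succ]
      congr 1
      rcases s with _ | s
      · rw [Finset.Nat.antidiagonal_zero, Finset.sum_singleton]
      · rw [Finset.Nat.sum_antidiagonal_succ]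
        simp [hB, flow_zero_left]
    rw [hsum]
    simp only [burgersHierarchy, burgers, flow_csmul_left]
    -- For `s = n` the density contains no factor `u` and only the `u_2` flow contributes; for `s >
    -- n` everything is zero.
    obtain hs | rfl | hs : s < n ∨ s = n ∨ n < s := by omega
    · obtain ⟨m, rfl⟩ : ∃ m, n = s + 1 + m := ⟨n - (s + 1), by omega⟩
      rw [if_pos (by omega), if_pos (by omega), if_pos (by omega),
        show s + 1 + m + 1 - (s + 1) = m + 1 by omega, show s + 1 + m - (s + 1) = m by omega,
        show s + 1 + m - s = m + 1 by omega, map_neg, smul_neg, hneg, hneg, burgers_rec_succ]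
      simp only [smul_neg, neg_add]
    · rw [if_pos (by omega), if_neg (by omega), if_pos le_rfl, Nat.sub_self, Nat.sub_self, h0,
        zero_add, map_neg, smul_neg, hneg, smul_neg, burgers_rec_zero]
    · rw [if_neg (by omega), if_neg (by omega), if_neg (by omega), h0, map_zero, h0,
        smul_zero, smul_zero, add_zero]

theorem burgers_mem_pol (s : ℕ) : burgers C s ∈ weightGrading.pol (s + 1) := by
  rcases s with _ | _ | s
  · have := Grading.mul_mem_pol (weightGrading.u_mem_pol 0) (weightGrading.u_mem_pol 1)
      (d := 1) (weightGrading_ok.mpr (by norm_num))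
    simpa [burgers] using this
  · have := weightGrading.u_mem_pol 2
    exact Submodule.smul_mem _ C (by simpa using this)
  · simp [burgers]

theorem isDRType_burgers (C : ℂ) : IsDRType (ofEquation (burgers C)) where
  homogeneous := by
    refine ⟨_, hasDegree_iff.mpr fun s => ?_, rfl⟩
    exact Grading.single_mem_den 0 (burgers_mem_pol s) (weightGrading_ok.mpr (by push_cast; ring))
  recursion := by
    refine ⟨burgersHierarchy C, burgersHierarchy_hasDegree, burgersHierarchy_zero, fun n s _ => ?_⟩
    rcases n with _ | n
    · show dxDens (dMinusOne (burgersHierarchy C 0) s) = 0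
      rw [dMinusOne_apply, dm_burgersHierarchy, Nat.cast_zero, zero_smul, map_zero]
    · show dxDens (dMinusOne (burgersHierarchy C (n + 1)) s) - bracket _ _ s = 0
      rw [dMinusOne_apply, bracket_ofEquation, dxDens_dm_burgersHierarchy, sub_self]
  unit := by
    obtain ⟨R, hR, hR'⟩ := euler_mem (P := burgers C) rfl burgers_mem_pol fun s hs => by
      rcases s with _ | _ | s
      · exact absurd rfl hs
      · simp [burgers, partialU_u]
      · simp [burgers]
    exact ⟨R, hR, fun s _ => hR' s⟩

end
end
end DRHierarchy

open DRHierarchy in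
theorem mainTheorem8 :
    (∀ X : LocalVectorField, IsDRType X →
      varTheta X 0 = u 0 * u 1 →
      ((∃ s : ℕ, 1 ≤ s ∧ s ≤ 9 ∧ varTheta X s ≠ 0) →
        ∃ s : ℕ, 1 ≤ s ∧ s ≤ 9 ∧ quasilinearCoeff (varTheta X) s ≠ 0) →
      (∃ C11 C21 C22 C31 C32 C41 C42 : ℂ, C11 ≠ 0 ∧
        ∀ s : ℕ, s ≤ 9 → varTheta X s = dKdV C11 C21 C22 C31 C32 C41 C42 s) ∨
      (∃ C : ℂ, ∀ s : ℕ, s ≤ 9 → varTheta X s = burgers C s)) ∧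
    (∀ C11 C21 C22 C31 C32 C41 C42 : ℂ, C11 ≠ 0 →
      IsDRTypeUpTo 9 (ofEquation (dKdV C11 C21 C22 C31 C32 C41 C42))) ∧
    (∀ C : ℂ, IsDRType (ofEquation (burgers C))) := by
  exact ⟨fun _ hX h0 hq => hX.classification h0 hq,
    fun _ _ _ _ _ _ _ h => isDRTypeUpTo_dKdV _ _ _ _ _ _ _ h, isDRType_burgers⟩
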